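/- Let $0<\varrho<1$, let $A=\{z\in\mathbb C:\varrho<|z|<1\}$, and let $p\neq 0$ be an integer. Let $\mathcal I_{p,p}$ be the set of $u\in H^1(A,\mathbb C)$ whose trace satisfies $|u|=1$ a.e. on $\partial A$ and has degree $p$ (in the sense of $H^{1/2}$ maps into $\mathbb S^1$, circles being oriented counter-clockwise) on each of the circles $|z|=1$ and $|z|=\varrho$. Let $u$ be a minimizer of the Dirichlet energy $E(u)=\frac12\int_A|\nabla u|^2$ in $\mathcal I_{p,p}$. Then $u$ coincides a.e. in $A$ with a harmonic function, again denoted $u$, and: 1. $\partial_r u=0$ on the circle $|z|=\sqrt\varrho$. 2. There is a real constant $c<0$ such that the Hopf differential coefficient of $u$ satisfies $$\mathcal H_u(z):=\tfrac14\big(|\partial_xu|^2-|\partial_yu|^2-2i\langle\partial_xu,\partial_yu\rangle\big)=\frac{c}{z^2}\qquad\text{for all } z\in A .$$ 3. The map $X=(u,h):A\to\mathbb R^3$ with $h(x,y)=\sqrt{|c|}\,\ln(x^2+y^2)$ is a conformal immersion parametrizing a minimal surface (zero mean curvature), and this surface is symmetric with respect to the horizontal plane at height $\sqrt{|c|}\,\ln\varrho$: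 if $S$ is the orthogonal reflection of $\mathbb R^3$ in this plane, then $S(X(A))=X(A)$, and moreover $X(\varrho/\bar z)=S(X(z))$ for all $z\in A$. -/

import Mathlib

open MeasureTheory Filter Topology
open scoped ContDiff ENNReal ComplexConjugate Matrix

noncomputable section

namespace SemiStiff

/-- The annulus `{z : ϱ < |z| < 1}`. -/
def annulus (ϱ : ℝ) : Set ℂ := {z : ℂ | ϱ < ‖z‖ ∧ ‖z‖ < 1}

/-- The vector product `a ∧ b = a₁ b₂ - a₂ b₁` of two plane vectors. -/
def wedge (a b : ℂ) : ℝ := a.re * b.im - a.im * b.re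

/-- The scalar product `a₁ b₁ + a₂ b₂` of two plane vectors. -/
def dot (a b : ℂ) : ℝ := a.re * b.re + a.im * b.im

/-- `g` is the weak partial derivative of `f` on the annulus in the direction `w`. -/
def IsWeakDeriv (ϱ : ℝ) (w : ℂ) (f g : ℂ → ℂ) : Prop :=
  ∀ φ : ℂ → ℝ, ContDiff ℝ ∞ φ → HasCompactSupport φ → tsupport φ ⊆ annulus ϱ →
    ∫ z in annulus ϱ, (fderiv ℝ φ z w) • f z = -∫ z in annulus ϱ, φ z • g z

/-- An element of the Sobolev space `H¹(A, ℂ)`, `A` the annulus, together with its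
(almost everywhere unique) weak partial derivatives. -/
structure H1Annulus (ϱ : ℝ) where
  toFun : ℂ → ℂ
  dx : ℂ → ℂ
  dy : ℂ → ℂ
  memLp_toFun : MemLp toFun 2 (volume.restrict (annulus ϱ))
  memLp_dx : MemLp dx 2 (volume.restrict (annulus ϱ))
  memLp_dy : MemLp dy 2 (volume.restrict (annulus ϱ))
  weak_dx : IsWeakDeriv ϱ 1 toFun dx
  weak_dy : IsWeakDeriv ϱ Complex.I toFun dy

/-- The Dirichlet energy `(1/2) ∫_A |∇u|²`. -/
def energy {ϱ : ℝ} (u : H1Annulus ϱ) : ℝ :=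
  (1 / 2) * ∫ z in annulus ϱ, (‖u.dx z‖ ^ 2 + ‖u.dy z‖ ^ 2)

/-- The squared `H¹(A)` distance of `u` to (the restriction to `A` of) a smooth function. -/
def h1DistSq {ϱ : ℝ} (u : H1Annulus ϱ) (φ : ℂ → ℂ) : ℝ≥0∞ :=
  ∫⁻ z in annulus ϱ, (‖φ z - u.toFun z‖ₑ ^ 2 + ‖fderiv ℝ φ z 1 - u.dx z‖ₑ ^ 2
    + ‖fderiv ℝ φ z Complex.I - u.dy z‖ₑ ^ 2)

/-- The function `θ ↦ w (r e^{iθ})`. -/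
def onCircle (w : ℂ → ℂ) (r : ℝ) : ℝ → ℂ := fun θ => w (circleMap 0 r θ)

/-- The measure `dθ` on one period. -/
def angleMeasure : Measure ℝ := volume.restrict (Set.Ioc 0 (2 * Real.pi))

/-- `g` (only its values on the two boundary circles matter) is the trace of `u` on `∂A`:
`u` is the `H¹(A)` limit of functions that are smooth on the closure of `A` and whose boundary
values converge to `g` in `L²(∂A)`. -/
def IsTrace {ϱ : ℝ} (u : H1Annulus ϱ) (g : ℂ → ℂ) : Prop :=
  (∀ r ∈ ({ϱ, 1} : Set ℝ), AEStronglyMeasurable (onCircle g r) angleMeasure) ∧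
  ∃ φ : ℕ → ℂ → ℂ, (∀ n, ContDiff ℝ ∞ (φ n)) ∧
    Tendsto (fun n => h1DistSq u (φ n)) atTop (𝓝 0) ∧
    ∀ r ∈ ({ϱ, 1} : Set ℝ),
      Tendsto (fun n => ∫⁻ θ, ‖onCircle (φ n) r θ - onCircle g r θ‖ₑ ^ 2 ∂angleMeasure)
        atTop (𝓝 0)

/-- The squared `H^{1/2}` norm of a function on the circle, written in the angle:
`∫ |w|² + ∬ |w(s) - w(t)|² / |e^{is} - e^{it}|²`. -/
def hHalfNormSq (w : ℝ → ℂ) : ℝ≥0∞ :=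
  (∫⁻ θ, ‖w θ‖ₑ ^ 2 ∂angleMeasure) +
    ∫⁻ s, ∫⁻ t, (‖w s - w t‖ₑ / ‖circleMap 0 1 s - circleMap 0 1 t‖ₑ) ^ 2
      ∂angleMeasure ∂angleMeasure

/-- A smooth map from the circle to the unit circle, written in the angle. -/
def IsSmoothCircleMap (f : ℝ → ℂ) : Prop :=
  ContDiff ℝ ∞ f ∧ Function.Periodic f (2 * Real.pi) ∧ ∀ θ, ‖f θ‖ = 1

/-- The degree `(1/2π) ∫ f ∧ ∂_τ f dτ` of a smooth map from a (counter-clockwise) circle to the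
unit circle. -/
def smoothDegree (f : ℝ → ℂ) : ℝ :=
  1 / (2 * Real.pi) * ∫ θ in (0 : ℝ)..(2 * Real.pi), wedge (f θ) (deriv f θ)

/-- The map `g`, written in the angle, has degree `d` in the sense of `H^{1/2}` maps to the unit
circle: it is an `H^{1/2}` limit of smooth unimodular maps of degree `d`. -/
def HasDegree (g : ℝ → ℂ) (d : ℤ) : Prop :=
  ∃ f : ℕ → ℝ → ℂ, (∀ n, IsSmoothCircleMap (f n) ∧ smoothDegree (f n) = d) ∧
    Tendsto (fun n => hHalfNormSq (fun θ => f n θ - g θ)) atTop (𝓝 0)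

/-- The class `𝓘_{p,q}`: maps in `H¹(A, ℂ)` whose trace has modulus one almost everywhere on
`∂A`, degree `p` on the unit circle and degree `q` on the circle of radius `ϱ`. -/
def classI (ϱ : ℝ) (p q : ℤ) : Set (H1Annulus ϱ) :=
  {u | ∃ g : ℂ → ℂ, IsTrace u g ∧
    (∀ r ∈ ({ϱ, 1} : Set ℝ), ∀ᵐ θ ∂angleMeasure, ‖onCircle g r θ‖ = 1) ∧
    HasDegree (onCircle g 1) p ∧ HasDegree (onCircle g ϱ) q}

/-- `u` minimizes the Dirichlet energy in `𝓘_{p,q}`. -/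
def IsMinimizer {ϱ : ℝ} (u : H1Annulus ϱ) (p q : ℤ) : Prop :=
  u ∈ classI ϱ p q ∧ ∀ v ∈ classI ϱ p q, energy u ≤ energy v

/-- The coefficient `(1/4) (|∂ₓU|² - |∂_yU|² - 2i ⟨∂ₓU, ∂_yU⟩)` of the Hopf quadratic
differential. -/
def hopf (U : ℂ → ℂ) (z : ℂ) : ℂ :=
  (1 / 4) * (((‖fderiv ℝ U z 1‖ ^ 2 - ‖fderiv ℝ U z Complex.I‖ ^ 2 : ℝ) : ℂ)
    - 2 * Complex.I * ((dot (fderiv ℝ U z 1) (fderiv ℝ U z Complex.I) : ℝ) : ℂ))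

/-- The radial derivative `∂U/∂r`. -/
def radialDeriv (U : ℂ → ℂ) (z : ℂ) : ℂ := fderiv ℝ U z (z / (‖z‖ : ℂ))

/-- The lift `X = (U, h)` with `h(x,y) = √|c| ln(x² + y²)`. -/
def lift (U : ℂ → ℂ) (c : ℝ) (z : ℂ) : Fin 3 → ℝ :=
  ![(U z).re, (U z).im, √|c| * Real.log (z.re ^ 2 + z.im ^ 2)]

/-- Partial derivatives of a map from the plane to three-space. -/
def pdx (X : ℂ → Fin 3 → ℝ) (z : ℂ) : Fin 3 → ℝ := fderiv ℝ X z 1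

def pdy (X : ℂ → Fin 3 → ℝ) (z : ℂ) : Fin 3 → ℝ := fderiv ℝ X z Complex.I

/-- The (unnormalised) normal `∂ₓX × ∂_yX`. -/
def normal (X : ℂ → Fin 3 → ℝ) (z : ℂ) : Fin 3 → ℝ := pdx X z ⨯₃ pdy X z

/-- `X` is an immersion of the open set `V` into Euclidean three-space. -/
def IsImmersion (X : ℂ → Fin 3 → ℝ) (V : Set ℂ) : Prop :=
  ContDiffOn ℝ ∞ X V ∧ ∀ z ∈ V, normal X z ≠ 0

/-- `X` satisfies the conformality relations on `V`. -/
def IsConformal (X : ℂ → Fin 3 → ℝ) (V : Set ℂ) : Prop :=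
  ∀ z ∈ V, pdx X z ⬝ᵥ pdx X z = pdy X z ⬝ᵥ pdy X z ∧ pdx X z ⬝ᵥ pdy X z = 0

/-- The mean curvature of the immersion `X`,
`H = (e G - 2 f F + g E) / (2 (E G - F²))`, in terms of the coefficients of the first and second
fundamental forms. -/
def meanCurvature (X : ℂ → Fin 3 → ℝ) (z : ℂ) : ℝ :=
  let E := pdx X z ⬝ᵥ pdx X z
  let F := pdx X z ⬝ᵥ pdy X z
  let G := pdy X z ⬝ᵥ pdy X z
  let N := (√(normal X z ⬝ᵥ normal X z))⁻¹ • normal X z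
  let e := pdx (pdx X) z ⬝ᵥ N
  let f := pdx (pdy X) z ⬝ᵥ N
  let g := pdy (pdy X) z ⬝ᵥ N
  (e * G - 2 * f * F + g * E) / (2 * (E * G - F ^ 2))

/-- `X` is a conformal immersion of `V` that parametrizes a minimal surface. -/
def IsConformalMinimalImmersion (X : ℂ → Fin 3 → ℝ) (V : Set ℂ) : Prop :=
  IsImmersion X V ∧ IsConformal X V ∧ ∀ z ∈ V, meanCurvature X z = 0

/-- The orthogonal reflection of three-space in the horizontal plane at height `t`. -/
def reflectPlane (t : ℝ) (P : Fin 3 → ℝ) : Fin 3 → ℝ := ![P 0, P 1, 2 * t - P 2]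

end SemiStiff

end

noncomputable section

namespace SemiStiff

open InnerProductSpace Convolution Laplacian

/-! ### Weyl's lemma -/

/-! No regularity of $u$ up to the boundary is used. All information comes from comparing $u$ with
three kinds of competitors in the same class.

Adding test functions supported in the open annulus makes $u$ weakly harmonic, and Weyl's lemma
(`WeaklyHarmonic.exists_harmonicOnNhd`) gives the harmonic representative $U$.

Folding: let $v$ and $w$ be obtained by keeping $U$ on the outer, respectively inner, half of the
annulus and reflecting it by $z\mapsto\varrho/\bar z$ into the other half. Both boundary degrees
equal $p$, so $v$ and $w$ stay in the class. The inversion is anticonformal, so $E(v)+E(w)=2E(u)$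
and both are minimizers. Hence $v$ is harmonic too; it equals $U$ on the outer half, so everywhere
by unique continuation. Thus $U(\varrho/\bar z)=U(z)$ (`IsMinimizer.inversion_invariant`). On the
fixed circle the inversion reverses the radial direction, which forces $\partial_rU=0$.

Twisting: $z\mapsto z\,e^{i\,\mathrm{Re}(\alpha z^n)}$ preserves every circle about $0$, hence the
modulus and the degrees of the trace. The first variation of the energy says that the moments of
$F(z)/|z|^2$ against $\bar z^n$ vanish for $n\ne0$, where $F=z^2\mathcal H_u$ is holomorphic
(`IsMinimizer.integral_twistDensity_eq_zero`). In polar coordinates such a moment is a positive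
multiple of the $n$-th Laurent coefficient of $F$, so $F$ is a constant $c$
(`eqOn_const_of_integral_eq_zero`).

Sign: where $\partial_rU=0$ one has $z^2\mathcal H_u=-|z\,\partial_zU|^2\le0$. If $c=0$, then $dU$
vanishes on the middle circle, hence everywhere because $\partial_zU$ and the conjugate of
$\partial_{\bar z}U$ are holomorphic. So $U$ and its trace are constant. But the degree is bounded
by the squared $H^{1/2}$ seminorm (`abs_smoothDegree_le`), so this contradicts $p\ne0$.

Finally $(\partial_zh)^2=|c|/z^2=-c/z^2$ cancels the Hopf coefficient, so $X=(u,h)$ is conformal and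
harmonic, that is, minimal. The symmetry of $U$ and $\ln|\varrho/\bar z|^2=2\ln\varrho-\ln|z|^2$
give the reflection. -/

/-- The average of a harmonic function against a radial kernel is a multiple of its value at the
centre. -/
lemma integral_radial_smul_eq_polar {k : ℝ → ℝ} {δ : ℝ} (hk : Continuous k)
    (hks : ∀ r, δ ≤ r → k r = 0) {g : ℂ → ℂ} (hg : Continuous g) {z : ℂ}
    (hgh : HarmonicOnNhd g (Metric.closedBall z δ)) :
    ∫ t : ℂ, k ‖t‖ • g (z - t) = (∫ r in Set.Ioi (0 : ℝ), r * k r * (2 * Real.pi)) • g z := by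
  rw [← Complex.integral_comp_polarCoord_symm, polarCoord_target, Measure.volume_eq_prod]
  have hint : IntegrableOn (fun p : ℝ × ℝ => p.1 • k ‖Complex.polarCoord.symm p‖ •
      g (z - Complex.polarCoord.symm p)) (Set.Ioi (0 : ℝ) ×ˢ Set.Ioo (-Real.pi) Real.pi)
      (volume.prod volume) := by
    have hc : Continuous (fun p : ℝ × ℝ => p.1 • k ‖Complex.polarCoord.symm p‖ •
      g (z - Complex.polarCoord.symm p)) := by
      simp only [Complex.polarCoord_symm_apply]
      fun_prop
    have h1 : IntegrableOn (fun p : ℝ × ℝ => p.1 • k ‖Complex.polarCoord.symm p‖ •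
      g (z - Complex.polarCoord.symm p)) (Set.Icc (0 : ℝ) δ ×ˢ Set.Icc (-Real.pi) Real.pi)
      (volume.prod volume) :=
      hc.continuousOn.integrableOn_compact (isCompact_Icc.prod isCompact_Icc)
    refine IntegrableOn.of_forall_sdiff_eq_zero h1
      (measurableSet_Ioi.prod measurableSet_Ioo) ?_
    rintro ⟨r, θ⟩ ⟨⟨hr, hθ⟩, hn⟩
    have hr' : δ ≤ r := by
      by_contra hlt
      push Not at hlt
      exact hn ⟨⟨(Set.mem_Ioi.1 hr).le, hlt.le⟩, ⟨hθ.1.le, hθ.2.le⟩⟩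
    have : k ‖Complex.polarCoord.symm (r, θ)‖ = 0 := by
      rw [Complex.norm_polarCoord_symm, abs_of_pos (Set.mem_Ioi.1 hr)]
      exact hks r hr'
    simp only [this, zero_smul, smul_zero]
  rw [setIntegral_prod _ hint, ← integral_smul_const]
  refine setIntegral_congr_fun measurableSet_Ioi fun r hr => ?_
  have hr0 : 0 < r := hr
  simp only [Complex.norm_polarCoord_symm, abs_of_pos hr0, smul_smul]
  rw [integral_smul, mul_assoc, ← smul_smul, ← smul_smul, ← smul_smul]
  rcases le_or_gt δ r with h | h
  · simp [hks r h]
  congr 2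
  have hsub : Metric.closedBall z |-r| ⊆ Metric.closedBall z δ := by
    rw [abs_neg, abs_of_pos hr0]
    exact Metric.closedBall_subset_closedBall h.le
  have hav := InnerProductSpace.HarmonicOnNhd.circleAverage_eq (hgh.mono hsub)
  rw [Real.circleAverage_def] at hav
  have hper : Function.Periodic (fun θ => g (circleMap z (-r) θ)) (2 * Real.pi) := by
    intro θ
    simp only [periodic_circleMap z (-r) θ]
  have e1 : ∫ θ in Set.Ioo (-Real.pi) Real.pi, g (z - Complex.polarCoord.symm (r, θ)) =
      ∫ θ in (0 : ℝ)..2 * Real.pi, g (circleMap z (-r) θ) := by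
    rw [← zero_add (2 * Real.pi), hper.intervalIntegral_add_eq 0 (-Real.pi),
      intervalIntegral.integral_of_le (by linarith [Real.pi_pos]),
      ← integral_Ioc_eq_integral_Ioo]
    have : -Real.pi + 2 * Real.pi = Real.pi := by ring
    rw [this]
    refine integral_congr_ae (Eventually.of_forall fun θ => ?_)
    simp [circleMap, Complex.exp_mul_I, sub_eq_add_neg]
  rw [e1, ← hav, smul_smul, mul_inv_cancel₀ (by positivity), one_smul]

lemma integral_radial_smul_eq {k : ℝ → ℝ} {δ : ℝ} (hk : Continuous k)
    (hks : ∀ r, δ ≤ r → k r = 0) {g : ℂ → ℂ} (hg : Continuous g) {z : ℂ}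
    (hgh : HarmonicOnNhd g (Metric.closedBall z δ)) :
    ∫ t : ℂ, k ‖t‖ • g (z - t) = (∫ t : ℂ, k ‖t‖) • g z := by
  rw [integral_radial_smul_eq_polar hk hks hg hgh]
  -- Testing the polar formula on the constant function $1$ identifies the radial integral with the
  -- mass of the kernel.
  have h1 := integral_radial_smul_eq_polar hk hks (g := fun _ => (1 : ℂ)) continuous_const (z := z)
    (harmonicOnNhd_const _)
  have h2 : ∫ t : ℂ, k ‖t‖ • (1 : ℂ) = ((∫ t : ℂ, k ‖t‖ : ℝ) : ℂ) := by
    rw [← integral_complex_ofReal]; simp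
  rw [h2] at h1
  have h3 : (∫ t : ℂ, k ‖t‖) = ∫ r in Set.Ioi (0 : ℝ), r * k r * (2 * Real.pi) := by
    have := congrArg Complex.re h1
    simpa using this
  rw [h3]

/-- A smooth radial kernel of mass one supported in the closed ball of radius `δ`. -/
lemma exists_radial_kernel {δ : ℝ} (hδ : 0 < δ) :
    ∃ k : ℝ → ℝ, Continuous k ∧ (∀ r, δ ≤ r → k r = 0) ∧ ContDiff ℝ ∞ (fun z : ℂ => k ‖z‖) ∧
      ∫ z : ℂ, k ‖z‖ = 1 := by
  -- The squared norm is used because the norm itself is not smooth at the origin.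
  let k₀ : ℝ → ℝ := fun r => Real.smoothTransition (δ ^ 2 - r ^ 2)
  have hk₀ : Continuous k₀ := Real.smoothTransition.continuous.comp (by fun_prop)
  have hz : ∀ z : ℂ, k₀ ‖z‖ = Real.smoothTransition (δ ^ 2 - ‖z‖ ^ 2) := fun z => rfl
  have hzero : ∀ r, δ ≤ r → k₀ r = 0 := fun r hr =>
    Real.smoothTransition.zero_of_nonpos (by nlinarith)
  have hcd : ContDiff ℝ ∞ (fun z : ℂ => k₀ ‖z‖) :=
    Real.smoothTransition.contDiff.comp (contDiff_const.sub (contDiff_norm_sq ℝ))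
  have hsupp : HasCompactSupport (fun z : ℂ => k₀ ‖z‖) := by
    refine HasCompactSupport.intro (isCompact_closedBall (0 : ℂ) δ) fun z hz => ?_
    refine hzero _ ?_
    simp only [Metric.mem_closedBall, dist_zero_right, not_le] at hz
    exact hz.le
  have hpos : 0 < ∫ z : ℂ, k₀ ‖z‖ := by
    refine hcd.continuous.integral_pos_of_hasCompactSupport_nonneg_nonzero hsupp
      (fun z => Real.smoothTransition.nonneg _) (x := 0) ?_
    have : 0 < k₀ ‖(0 : ℂ)‖ := Real.smoothTransition.pos_of_pos (by simp; positivity)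
    exact this.ne'
  refine ⟨fun r => (∫ z : ℂ, k₀ ‖z‖)⁻¹ * k₀ r, by fun_prop, fun r hr => by simp [hzero r hr],
    contDiff_const.mul hcd, ?_⟩
  rw [integral_const_mul, inv_mul_cancel₀ hpos.ne']

lemma fderiv_convolution_left_apply {φ : ℂ → ℝ} {f : ℂ → ℂ} (hφ : ContDiff ℝ ∞ φ)
    (hφc : HasCompactSupport φ) (hf : LocallyIntegrable f volume) (z w : ℂ) :
    fderiv ℝ (φ ⋆[ContinuousLinearMap.lsmul ℝ ℝ, volume] f) z w =
      ((fun t => fderiv ℝ φ t w) ⋆[ContinuousLinearMap.lsmul ℝ ℝ, volume] f) z := by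
  have hφ1 : ContDiff ℝ 1 φ := hφ.of_le (by norm_cast)
  rw [(hφc.hasFDerivAt_convolution_left (ContinuousLinearMap.lsmul ℝ ℝ) hφ1 hf z).fderiv]
  rw [convolution_def, convolution_def]
  have hex := (hφc.fderiv ℝ).convolutionExists_left
    ((ContinuousLinearMap.lsmul ℝ ℝ).precompL ℂ : (ℂ →L[ℝ] ℝ) →L[ℝ] ℂ →L[ℝ] (ℂ →L[ℝ] ℂ))
    (hφ1.continuous_fderiv one_ne_zero) hf z
  rw [ContinuousLinearMap.integral_apply hex]
  simp

lemma laplacian_apply_complex {F : Type*} [NormedAddCommGroup F] [NormedSpace ℝ F] {f : ℂ → F}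
    {z : ℂ} (hf : ContDiffAt ℝ 2 f z) :
    Δ f z = fderiv ℝ (fun w => fderiv ℝ f w 1) z 1 +
      fderiv ℝ (fun w => fderiv ℝ f w Complex.I) z Complex.I := by
  have hd : DifferentiableAt ℝ (fderiv ℝ f) z := by
    exact (hf.fderiv_right (m := 1) (by norm_num)).differentiableAt one_ne_zero
  rw [laplacian_eq_iteratedFDeriv_complexPlane]
  simp only [iteratedFDeriv_two_apply]
  rw [fderiv_clm_apply hd (by fun_prop), fderiv_clm_apply hd (by fun_prop)]
  simp

lemma contDiff_fderiv_apply {E F : Type*} [NormedAddCommGroup E] [NormedSpace ℝ E]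
    [NormedAddCommGroup F] [NormedSpace ℝ F] {f : E → F} (hf : ContDiff ℝ ∞ f) (w : E) :
    ContDiff ℝ ∞ (fun z => fderiv ℝ f z w) :=
  (hf.fderiv_right (m := ∞) (by simp)).clm_apply contDiff_const

lemma hasCompactSupport_fderiv_apply {E F : Type*} [NormedAddCommGroup E] [NormedSpace ℝ E]
    [NormedAddCommGroup F] [NormedSpace ℝ F] {f : E → F} (hf : HasCompactSupport f) (w : E) :
    HasCompactSupport (fun z => fderiv ℝ f z w) := hf.fderiv_apply ℝ w

lemma fderiv_comp_const_sub_apply {F : Type*} [NormedAddCommGroup F] [NormedSpace ℝ F]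
    {ψ : ℂ → F} (hψ : Differentiable ℝ ψ) (z t w : ℂ) :
    fderiv ℝ (fun t => ψ (z - t)) t w = - fderiv ℝ ψ (z - t) w := by
  have := (hψ (z - t)).hasFDerivAt.comp t ((hasFDerivAt_id t).const_sub z)
  rw [show (fun t => ψ (z - t)) = ψ ∘ HSub.hSub z from rfl, this.fderiv]
  simp

/-- `f` is weakly harmonic in `Ω`. -/
def WeaklyHarmonic (f : ℂ → ℂ) (Ω : Set ℂ) : Prop :=
  ∀ φ : ℂ → ℝ, ContDiff ℝ ∞ φ → HasCompactSupport φ → tsupport φ ⊆ Ω →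
    ∫ z, (Δ φ z) • f z = 0

/-- Both derivatives can be moved onto $\varphi$, so the Laplacian at $z$ is $f$ tested against
$\Delta(\varphi(z-\cdot))$, and this test function is supported in the ball about $z$. -/
lemma harmonicAt_convolution {Ω : Set ℂ} {f : ℂ → ℂ} (hf : LocallyIntegrable f volume)
    (h : WeaklyHarmonic f Ω) {φ : ℂ → ℝ} (hφ : ContDiff ℝ ∞ φ) {δ : ℝ}
    (hφs : tsupport φ ⊆ Metric.closedBall 0 δ) {z : ℂ} (hz : Metric.closedBall z δ ⊆ Ω) :
    Δ (φ ⋆[ContinuousLinearMap.lsmul ℝ ℝ, volume] f) z = 0 := by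
  have hφc : HasCompactSupport φ := (isCompact_closedBall (0 : ℂ) δ).of_isClosed_subset
    (isClosed_tsupport φ) hφs
  have hcd : ContDiff ℝ ∞ (φ ⋆[ContinuousLinearMap.lsmul ℝ ℝ, volume] f) :=
    hφc.contDiff_convolution_left _ hφ hf
  rw [laplacian_apply_complex (hcd.contDiffAt.of_le (by norm_cast))]
  simp_rw [fderiv_convolution_left_apply hφ hφc hf]
  rw [fderiv_convolution_left_apply (contDiff_fderiv_apply hφ 1)
      (hasCompactSupport_fderiv_apply hφc 1) hf,
    fderiv_convolution_left_apply (contDiff_fderiv_apply hφ Complex.I)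
      (hasCompactSupport_fderiv_apply hφc Complex.I) hf]
  have hex : ∀ w, ConvolutionExistsAt (fun t => fderiv ℝ (fun x => fderiv ℝ φ x w) t w) f z
      (ContinuousLinearMap.lsmul ℝ ℝ) volume := fun w =>
    (hasCompactSupport_fderiv_apply (hasCompactSupport_fderiv_apply hφc w) w).convolutionExists_left
      _ (contDiff_fderiv_apply (contDiff_fderiv_apply hφ w) w).continuous hf z
  rw [convolution_def, convolution_def, ← integral_add (hex 1) (hex Complex.I)]
  have key := h (fun t => φ (z - t)) (hφ.comp (contDiff_const.sub contDiff_id))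
    (hφc.comp_homeomorph (Homeomorph.subLeft z)) ?_
  · rw [← key, ← integral_sub_left_eq_self _ volume z]
    refine integral_congr_ae (Eventually.of_forall fun t => ?_)
    have hd1 : ∀ w x, fderiv ℝ (fun t => φ (z - t)) x w = - fderiv ℝ φ (z - x) w := by
      intro w x
      exact fderiv_comp_const_sub_apply (hφ.differentiable (by simp)) z x w
    have hd2 : ∀ w, fderiv ℝ (fun x => - fderiv ℝ φ (z - x) w) t w =
        fderiv ℝ (fun x => fderiv ℝ φ x w) (z - t) w := by
      intro w
      rw [fderiv_fun_neg, neg_apply, fderiv_comp_const_sub_apply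
        (ψ := fun x => fderiv ℝ φ x w) ((contDiff_fderiv_apply hφ w).differentiable (by simp)),
        neg_neg]
    simp only [ContinuousLinearMap.lsmul_apply]
    have hcd' : ContDiff ℝ ∞ (fun t => φ (z - t)) := hφ.comp (contDiff_const.sub contDiff_id)
    rw [laplacian_apply_complex (hcd'.contDiffAt.of_le (by norm_cast))]
    simp_rw [hd1, hd2]
    rw [sub_sub_cancel, add_smul]
  · have : tsupport (fun t => φ (z - t)) ⊆ Metric.closedBall z δ := by
      refine closure_minimal (fun t ht => ?_) Metric.isClosed_closedBall
      have := hφs (subset_tsupport φ (show z - t ∈ Function.support φ from ht))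
      rw [Metric.mem_closedBall, dist_zero_right] at this
      rwa [Metric.mem_closedBall, dist_comm, dist_eq_norm]
    exact this.trans hz

/-- Convolution kernels commute. -/
lemma convolution_left_comm {φ ψ : ℂ → ℝ} {f : ℂ → ℂ} (hφ : Continuous φ)
    (hφc : HasCompactSupport φ) (hψ : Continuous ψ) (hψc : HasCompactSupport ψ)
    (hf : LocallyIntegrable f volume) (z : ℂ) :
    (φ ⋆[ContinuousLinearMap.lsmul ℝ ℝ, volume]
      (ψ ⋆[ContinuousLinearMap.lsmul ℝ ℝ, volume] f)) z =
    (ψ ⋆[ContinuousLinearMap.lsmul ℝ ℝ, volume]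
      (φ ⋆[ContinuousLinearMap.lsmul ℝ ℝ, volume] f)) z := by
  have hfn : LocallyIntegrable (fun x => ‖f x‖) volume := fun x => (hf x).norm
  have key : ∀ (φ ψ : ℂ → ℝ), Continuous φ → HasCompactSupport φ → Continuous ψ →
      HasCompactSupport ψ →
      ((φ ⋆[ContinuousLinearMap.lsmul ℝ ℝ, volume] ψ) ⋆[ContinuousLinearMap.lsmul ℝ ℝ, volume] f) z
        = (φ ⋆[ContinuousLinearMap.lsmul ℝ ℝ, volume]
          (ψ ⋆[ContinuousLinearMap.lsmul ℝ ℝ, volume] f)) z := by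
    intro φ ψ hφ hφc hψ hψc
    refine convolution_assoc _ _ _ _ (fun x y z => by simp [mul_assoc]) hφ.aestronglyMeasurable
      hψ.aestronglyMeasurable hf.aestronglyMeasurable ?_ ?_ ?_
    · exact Eventually.of_forall fun y =>
        hφc.convolutionExists_left _ hφ hψ.locallyIntegrable y
    · exact Eventually.of_forall fun y =>
        hψc.norm.convolutionExists_left _ hψ.norm hfn y
    · refine hφc.norm.convolutionExists_left _ hφ.norm ?_ z
      exact (hψc.norm.continuous_convolution_left _ hψ.norm hfn).locallyIntegrable
  -- Associativity brings both sides to the convolution of a product kernel with $f$, and scalar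
  -- kernels commute.
  rw [← key φ ψ hφ hφc hψ hψc, ← key ψ φ hψ hψc hφ hφc]
  congr 1
  rw [← convolution_flip]
  congr 1
  ext
  simp

/-- Mollify by bumps $\psi_n$: $\psi_n\star f$ is harmonic near $z$, so $k\star(\psi_n\star
f)=\psi_n\star f$ at $z$ by the mean value property. After commuting the kernels,
$\psi_n\star(k\star f)$ tends to $k\star f$ by continuity, while $\psi_n\star f$ tends to $f$ almost
everywhere by Lebesgue differentiation. -/
lemma ae_eq_radial_convolution {Ω : Set ℂ} {f : ℂ → ℂ} (hf : LocallyIntegrable f volume)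
    (h : WeaklyHarmonic f Ω) {k : ℝ → ℝ} {δ : ℝ} (hδ : 0 < δ) (hk : Continuous k)
    (hks : ∀ r, δ ≤ r → k r = 0) (hk1 : ∫ z : ℂ, k ‖z‖ = 1) :
    ∀ᵐ z, Metric.closedBall z (2 * δ) ⊆ Ω →
      f z = ((fun t => k ‖t‖) ⋆[ContinuousLinearMap.lsmul ℝ ℝ, volume] f) z := by
  have hkc : HasCompactSupport (fun t : ℂ => k ‖t‖) := by
    refine HasCompactSupport.intro (isCompact_closedBall (0 : ℂ) δ) fun z hz => ?_
    refine hks _ ?_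
    simp only [Metric.mem_closedBall, dist_zero_right, not_le] at hz
    exact hz.le
  have hkn : Continuous (fun t : ℂ => k ‖t‖) := by fun_prop
  -- Outer radii at most $\delta/2$ leave room inside the ball of radius $2\delta$: $\delta$ for the
  -- mean value, $\delta/2$ for a neighbourhood and $\delta/2$ for the mollifier. The bounded ratio
  -- of the radii is required for Lebesgue differentiation.
  let ψ : ℕ → ContDiffBump (0 : ℂ) := fun n =>
    ⟨δ / (2 * (n + 2)), δ / (n + 2), by positivity, by
      rw [div_lt_div_iff_of_pos_left hδ (by positivity) (by positivity)]; linarith [n.cast_nonneg (α := ℝ)]⟩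
  have hψ0 : Tendsto (fun n => (ψ n).rOut) atTop (𝓝 0) :=
by
    have := (tendsto_const_div_atTop_nhds_zero_nat δ).comp (tendsto_add_atTop_nat 2)
    refine this.congr fun n => ?_
    change δ / ((n + 2 : ℕ) : ℝ) = δ / (n + 2)
    push_cast; rfl
  have hψK : ∀ᶠ n in atTop, (ψ n).rOut ≤ 2 * (ψ n).rIn := by
    refine Eventually.of_forall fun n => ?_
    change δ / (n + 2) ≤ 2 * (δ / (2 * (n + 2)))
    have : (n : ℝ) + 2 ≠ 0 := by positivity
    apply le_of_eq
    field_simp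
  filter_upwards [ContDiffBump.ae_convolution_tendsto_right_of_locallyIntegrable
    (μ := volume) hψ0 hψK hf] with z hz hzΩ
  refine tendsto_nhds_unique hz ?_
  have hcont := hkc.continuous_convolution_left (ContinuousLinearMap.lsmul ℝ ℝ) hkn hf
  refine (ContDiffBump.convolution_tendsto_right_of_continuous (μ := volume) hψ0 hcont z).congr
    fun n => ?_
  have hψc : HasCompactSupport ((ψ n).normed volume) := (ψ n).hasCompactSupport_normed
  rw [convolution_left_comm (ψ n).continuous_normed hψc hkn hkc hf, convolution_def]
  have hle : (ψ n).rOut ≤ δ / 2 := by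
    change δ / (n + 2) ≤ δ / 2
    exact div_le_div_of_nonneg_left hδ.le two_pos (by linarith [n.cast_nonneg (α := ℝ)])
  have hcd : ContDiff ℝ ∞ ((ψ n).normed volume ⋆[ContinuousLinearMap.lsmul ℝ ℝ, volume] f) :=
    hψc.contDiff_convolution_left _ (ψ n).contDiff_normed hf
  have hharm : HarmonicOnNhd ((ψ n).normed volume ⋆[ContinuousLinearMap.lsmul ℝ ℝ, volume] f)
      (Metric.closedBall z δ) := by
    have hzero : ∀ w, Metric.closedBall w (δ / 2) ⊆ Ω →
        Δ ((ψ n).normed volume ⋆[ContinuousLinearMap.lsmul ℝ ℝ, volume] f) w = 0 := fun w hw =>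
      harmonicAt_convolution hf h (ψ n).contDiff_normed
        ((ψ n).tsupport_normed_eq.subset.trans (Metric.closedBall_subset_closedBall hle)) hw
    intro w hw
    refine ⟨hcd.contDiffAt.of_le (by norm_cast), ?_⟩
    filter_upwards [Metric.ball_mem_nhds w (half_pos hδ)] with v hv
    refine hzero v ((Metric.closedBall_subset_closedBall' ?_).trans hzΩ)
    have := dist_triangle v w z
    have hv' : dist v w < δ / 2 := hv
    have hw' : dist w z ≤ δ := hw
    linarith
  have := integral_radial_smul_eq hk hks hcd.continuous hharm
  rw [hk1, one_smul] at this
  simpa using this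

/-- **Weyl's lemma** in the plane. -/
theorem WeaklyHarmonic.exists_harmonicOnNhd {Ω : Set ℂ} {f : ℂ → ℂ} (hΩ : IsOpen Ω)
    (hf : LocallyIntegrable f volume) (h : WeaklyHarmonic f Ω) :
    ∃ U : ℂ → ℂ, HarmonicOnNhd U Ω ∧ f =ᵐ[volume.restrict Ω] U := by
  have hpos : ∀ n : ℕ, (0 : ℝ) < 1 / (n + 1) := fun n => by positivity
  choose k hk hks hkd hk1 using fun n : ℕ => exists_radial_kernel (hpos n)
  have hkc : ∀ n, tsupport (fun t : ℂ => k n ‖t‖) ⊆ Metric.closedBall 0 (1 / (n + 1)) := by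
    refine fun n => closure_minimal (fun t ht => ?_) Metric.isClosed_closedBall
    rw [Metric.mem_closedBall, dist_zero_right]
    by_contra hlt
    exact ht (hks n _ (not_le.1 hlt).le)
  have hkcs : ∀ n, HasCompactSupport (fun t : ℂ => k n ‖t‖) := fun n =>
    (isCompact_closedBall (0 : ℂ) _).of_isClosed_subset (isClosed_tsupport _) (hkc n)
  let V : ℕ → ℂ → ℂ := fun n => (fun t => k n ‖t‖) ⋆[ContinuousLinearMap.lsmul ℝ ℝ, volume] f
  have hVd : ∀ n, ContDiff ℝ ∞ (V n) := fun n =>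
    (hkcs n).contDiff_convolution_left _ (hkd n) hf
  have hae : ∀ᵐ z, ∀ n : ℕ, Metric.closedBall z (2 * (1 / (n + 1))) ⊆ Ω → f z = V n z :=
    ae_all_iff.2 fun n => ae_eq_radial_convolution hf h (hpos n) (hk n) (hks n) (hk1 n)
  have hnear : ∀ z ∈ Ω, ∃ n : ℕ, ∀ᶠ w in 𝓝 z, Metric.closedBall w (2 * (1 / (n + 1))) ⊆ Ω := by
    intro z hz
    obtain ⟨ε, hε, hb⟩ := Metric.isOpen_iff.1 hΩ z hz
    obtain ⟨n, hn⟩ := exists_nat_one_div_lt (show 0 < ε / 4 by positivity)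
    refine ⟨n, ?_⟩
    filter_upwards [Metric.ball_mem_nhds z (show 0 < ε / 2 by positivity)] with w hw v hv
    refine hb ?_
    rw [Metric.mem_ball] at hw ⊢
    rw [Metric.mem_closedBall] at hv
    linarith [dist_triangle v w z]
  -- Two convolutions that both equal $f$ almost everywhere near $z$ are continuous; if they
  -- differed at $z$ they would differ on an open set, which has positive measure.
  have hagree : ∀ z, ∀ m n : ℕ, (∀ᶠ w in 𝓝 z, Metric.closedBall w (2 * (1 / ((m : ℝ) + 1))) ⊆ Ω) →
      (∀ᶠ w in 𝓝 z, Metric.closedBall w (2 * (1 / ((n : ℝ) + 1))) ⊆ Ω) → V m z = V n z := by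
    intro z m n hm hn
    by_contra hne
    have hev : ∀ᶠ w in 𝓝 z, V m w ≠ V n w :=
      (isOpen_ne_fun (hVd m).continuous (hVd n).continuous).mem_nhds hne
    have hbad : {w | ¬ ∀ n : ℕ, Metric.closedBall w (2 * (1 / ((n : ℝ) + 1))) ⊆ Ω → f w = V n w}
        ∈ 𝓝 z := by
      filter_upwards [hev, hm, hn] with w hw h1 h2 hcon
      exact hw ((hcon m h1).symm.trans (hcon n h2))
    have := Measure.measure_pos_of_mem_nhds (volume : Measure ℂ) hbad
    exact this.ne' hae
  classical
  -- The harmonic function is glued from convolutions whose kernel index depends on the point.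
  choose! N hN using hnear
  refine ⟨fun z => V (N z) z, fun z hz => ?_, ?_⟩
  · have heq : (fun w => V (N w) w) =ᶠ[𝓝 z] V (N z) := by
      filter_upwards [(hN z hz).eventually_nhds, hΩ.mem_nhds hz] with w hw hwΩ
      exact hagree w _ _ (hN w hwΩ) hw
    rw [harmonicAt_congr_nhds heq]
    refine ⟨(hVd _).contDiffAt.of_le (by norm_cast), ?_⟩
    filter_upwards [hN z hz] with w hw
    refine harmonicAt_convolution hf h (hkd _) (hkc _) ((Metric.closedBall_subset_closedBall ?_).trans hw)
    linarith [hpos (N z)]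
  · rw [EventuallyEq, ae_restrict_iff' hΩ.measurableSet]
    filter_upwards [hae] with z hz hzΩ
    exact hz _ (hN z hzΩ).self_of_nhds

/-! ### The annulus -/

lemma isOpen_annulus (ϱ : ℝ) : IsOpen (annulus ϱ) :=
  (isOpen_lt continuous_const continuous_norm).inter (isOpen_lt continuous_norm continuous_const)

lemma measurableSet_annulus (ϱ : ℝ) : MeasurableSet (annulus ϱ) := (isOpen_annulus ϱ).measurableSet

lemma annulus_subset_closedBall (ϱ : ℝ) : annulus ϱ ⊆ Metric.closedBall 0 1 := fun z hz => by
  simpa using hz.2.le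

instance isFiniteMeasure_annulus (ϱ : ℝ) : IsFiniteMeasure (volume.restrict (annulus ϱ)) :=
  ⟨by
    rw [Measure.restrict_apply_univ]
    exact (measure_mono (annulus_subset_closedBall ϱ)).trans_lt
      (isCompact_closedBall _ _).measure_lt_top⟩

lemma annulus_ne_zero {ϱ : ℝ} (h0 : 0 < ϱ) {z : ℂ} (hz : z ∈ annulus ϱ) : z ≠ 0 :=
  norm_pos_iff.1 (h0.trans hz.1)

/-- The annulus is the exponential image of a convex vertical strip. -/
lemma isPreconnected_annulus {ϱ : ℝ} (h0 : 0 < ϱ) : IsPreconnected (annulus ϱ) := by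
  have : annulus ϱ = Complex.exp '' {w : ℂ | Real.log ϱ < w.re ∧ w.re < 0} := by
    ext z
    constructor
    · intro hz
      have hz0 := annulus_ne_zero h0 hz
      refine ⟨Complex.log z, ⟨?_, ?_⟩, Complex.exp_log hz0⟩
      · rw [Complex.log_re]; exact Real.log_lt_log h0 hz.1
      · rw [Complex.log_re]; exact Real.log_neg (norm_pos_iff.2 hz0) hz.2
    · rintro ⟨w, ⟨h1, h2⟩, rfl⟩
      refine ⟨?_, ?_⟩
      · rw [Complex.norm_exp]; exact (Real.log_lt_iff_lt_exp h0).1 h1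
      · rw [Complex.norm_exp]; exact (Real.exp_lt_exp.2 h2).trans_eq Real.exp_zero
  rw [this]
  refine IsPreconnected.image ?_ _ Complex.continuous_exp.continuousOn
  exact ((convex_halfSpace_re_gt _).inter (convex_halfSpace_re_lt _)).isPreconnected

/-! ### Wirtinger coefficients -/

/-- The complex linear coefficient of a real linear map of the plane. -/
def wirt (L : ℂ →L[ℝ] ℂ) : ℂ := (L 1 - Complex.I * L Complex.I) / 2

/-- The antilinear coefficient of a real linear map of the plane. -/
def wirtBar (L : ℂ →L[ℝ] ℂ) : ℂ := (L 1 + Complex.I * L Complex.I) / 2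

lemma apply_eq_wirt (L : ℂ →L[ℝ] ℂ) (h : ℂ) : L h = wirt L * h + wirtBar L * conj h := by
  have h1 : L h = h.re * L 1 + h.im * L Complex.I := by
    conv_lhs => rw [show h = h.re • (1 : ℂ) + h.im • Complex.I by simp]
    rw [map_add, map_smul, map_smul]
    simp
  rw [h1, wirt, wirtBar]
  apply Complex.ext <;> (simp; ring)

lemma wirt_eq_of_apply {L : ℂ →L[ℝ] ℂ} {a b : ℂ} (h : ∀ v, L v = a * v + b * conj v) :
    wirt L = a ∧ wirtBar L = b := by
  constructor
  · rw [wirt, h, h]; apply Complex.ext <;> simp <;> ring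
  · rw [wirtBar, h, h]; apply Complex.ext <;> simp <;> ring

lemma wirt_comp (L M : ℂ →L[ℝ] ℂ) :
    wirt (L.comp M) = wirt L * wirt M + wirtBar L * conj (wirtBar M) ∧
    wirtBar (L.comp M) = wirt L * wirtBar M + wirtBar L * conj (wirt M) := by
  refine wirt_eq_of_apply fun v => ?_
  rw [ContinuousLinearMap.comp_apply, apply_eq_wirt L, apply_eq_wirt M]
  simp only [map_add, map_mul, Complex.conj_conj]
  ring

lemma norm_sq_add_norm_sq_eq_wirt (L : ℂ →L[ℝ] ℂ) :
    ‖L 1‖ ^ 2 + ‖L Complex.I‖ ^ 2 = 2 * (‖wirt L‖ ^ 2 + ‖wirtBar L‖ ^ 2) := by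
  rw [wirt, wirtBar]
  simp only [Complex.sq_norm, Complex.normSq_apply]
  simp
  ring

/-- This form makes holomorphy visible: it is $\partial_zU$ times the conjugate of $\partial_{\bar
z}U$, both holomorphic when $U$ is harmonic. -/
lemma hopf_eq_wirt (U : ℂ → ℂ) (z : ℂ) :
    hopf U z = wirt (fderiv ℝ U z) * conj (wirtBar (fderiv ℝ U z)) := by
  rw [hopf, wirt, wirtBar]
  generalize fderiv ℝ U z 1 = a
  generalize fderiv ℝ U z Complex.I = b
  have hc : conj ((a + Complex.I * b) / 2) = (conj a - Complex.I * conj b) / 2 := by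
    simp [map_ofNat, sub_eq_add_neg]
  rw [hc]
  simp only [Complex.sq_norm, Complex.normSq_apply, dot]
  apply Complex.ext <;> simp <;> ring

lemma eq_zero_of_wirt {L : ℂ →L[ℝ] ℂ} (h1 : wirt L = 0) (h2 : wirtBar L = 0) : L = 0 := by
  ext v <;> simp [apply_eq_wirt L, h1, h2]

/-! ### Harmonic functions with complex values -/

lemma HarmonicAt.analyticAt_of_complex {U : ℂ → ℂ} {z : ℂ} (hU : HarmonicAt U z) :
    AnalyticAt ℝ U z := by
  have h1 := _root_.HarmonicAt.analyticAt (hU.comp_CLM Complex.reCLM)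
  have h2 := _root_.HarmonicAt.analyticAt (hU.comp_CLM Complex.imCLM)
  have h3 := ((Complex.ofRealCLM.analyticAt _).comp h1).add
    ((((Complex.ofRealCLM.analyticAt _).comp h2)).mul (analyticAt_const (v := Complex.I)))
  refine h3.congr (Eventually.of_forall fun w => ?_)
  simp [Complex.re_add_im]

/-- Since $4\,\partial_{\bar z}\partial_zU=\Delta U$, harmonicity of $U$ is the Cauchy–Riemann
equation for $\partial_zU$. -/
lemma HarmonicAt.differentiableAt_wirt {U : ℂ → ℂ} {z : ℂ} (hU : HarmonicAt U z) :
    DifferentiableAt ℂ (fun w => wirt (fderiv ℝ U w)) z := by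
  have h2 : ContDiffAt ℝ 2 U z := hU.1
  have hd : DifferentiableAt ℝ (fderiv ℝ U) z :=
    (h2.fderiv_right (m := 1) (by norm_num)).differentiableAt one_ne_zero
  have hd1 : ∀ v, HasFDerivAt (fun w => fderiv ℝ U w v)
      ((fderiv ℝ (fderiv ℝ U) z).flip v) z := fun v => by
    have := hd.hasFDerivAt.clm_apply (hasFDerivAt_const v z)
    simpa using this
  have hsymm : fderiv ℝ (fderiv ℝ U) z 1 Complex.I = fderiv ℝ (fderiv ℝ U) z Complex.I 1 :=
    h2.isSymmSndFDerivAt (by simp) 1 Complex.I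
  have hlap := hU.2.eq_of_nhds
  simp only [laplacian_eq_iteratedFDeriv_complexPlane, iteratedFDeriv_two_apply, Fin.isValue,
    Matrix.cons_val_zero, Matrix.cons_val_one, Matrix.cons_val_fin_one, Pi.zero_apply] at hlap
  have hw : HasFDerivAt (fun w => wirt (fderiv ℝ U w))
      ((2 : ℂ)⁻¹ • ((fderiv ℝ (fderiv ℝ U) z).flip 1 -
        Complex.I • (fderiv ℝ (fderiv ℝ U) z).flip Complex.I)) z := by
    refine (((hd1 1).sub ((hd1 Complex.I).const_smul Complex.I)).const_smul
      ((2 : ℂ)⁻¹)).congr_of_eventuallyEq (Eventually.of_forall fun w => ?_)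
    simp [wirt, div_eq_inv_mul]
  rw [differentiableAt_complex_iff_differentiableAt_real]
  refine ⟨hw.differentiableAt, ?_⟩
  rw [hw.fderiv]
  simp only [smul_apply, sub_apply, ContinuousLinearMap.flip_apply, smul_eq_mul]
  rw [← hsymm, eq_neg_of_add_eq_zero_right hlap]
  linear_combination ((2 : ℂ)⁻¹ * fderiv ℝ (fderiv ℝ U) z 1 Complex.I) * Complex.I_sq

/-- The conjugate of $\partial_{\bar z}U$ is $\partial_z\bar U$, and $\bar U$ is harmonic. -/
lemma HarmonicAt.differentiableAt_conj_wirtBar {U : ℂ → ℂ} {z : ℂ} (hU : HarmonicAt U z) :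
    DifferentiableAt ℂ (fun w => conj (wirtBar (fderiv ℝ U w))) z := by
  have hc := hU.comp_CLM Complex.conjCLE.toContinuousLinearMap
  have hev : ∀ᶠ w in 𝓝 z, DifferentiableAt ℝ U w := by
    filter_upwards [hU.eventually] with w hw
    exact hw.1.differentiableAt two_ne_zero
  refine (HarmonicAt.differentiableAt_wirt hc).congr_of_eventuallyEq ?_
  filter_upwards [hev] with w hw
  rw [((Complex.conjCLE.toContinuousLinearMap.hasFDerivAt).comp w hw.hasFDerivAt).fderiv]
  simp [wirt, wirtBar, map_ofNat, sub_eq_add_neg]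

lemma HarmonicAt.differentiableAt_hopf {U : ℂ → ℂ} {z : ℂ} (hU : HarmonicAt U z) :
    DifferentiableAt ℂ (hopf U) z := by
  have := (HarmonicAt.differentiableAt_wirt hU).mul (HarmonicAt.differentiableAt_conj_wirtBar hU)
  refine this.congr_of_eventuallyEq (Eventually.of_forall fun w => ?_)
  exact hopf_eq_wirt U w

lemma eqOn_annulus_of_eventuallyEq {ϱ : ℝ} (h0 : 0 < ϱ) {U V : ℂ → ℂ}
    (hU : HarmonicOnNhd U (annulus ϱ)) (hV : HarmonicOnNhd V (annulus ϱ)) {z : ℂ}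
    (hz : z ∈ annulus ϱ) (h : U =ᶠ[𝓝 z] V) : Set.EqOn U V (annulus ϱ) :=
  AnalyticOnNhd.eqOn_of_preconnected_of_eventuallyEq
    (fun w hw => HarmonicAt.analyticAt_of_complex (hU w hw))
    (fun w hw => HarmonicAt.analyticAt_of_complex (hV w hw)) (isPreconnected_annulus h0) hz h

/-! ### Weak derivatives -/

/-- On a finite measure space $L^2$ convergence implies $L^1$ convergence, by Hölder. -/
lemma tendsto_lintegral_enorm_of_sq {α : Type*} [MeasurableSpace α] {μ : Measure α}
    [IsFiniteMeasure μ] {F : ℕ → α → ℂ} (hF : ∀ n, AEStronglyMeasurable (F n) μ)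
    (h : Tendsto (fun n => ∫⁻ z, ‖F n z‖ₑ ^ 2 ∂μ) atTop (𝓝 0)) :
    Tendsto (fun n => ∫⁻ z, ‖F n z‖ₑ ∂μ) atTop (𝓝 0) := by
  have h2 : ∀ n, ∫⁻ z, ‖F n z‖ₑ ∂μ ≤
      (∫⁻ z, ‖F n z‖ₑ ^ 2 ∂μ) ^ (1 / 2 : ℝ) * μ Set.univ ^ (1 / 2 : ℝ) := by
    intro n
    have := eLpNorm_le_eLpNorm_mul_rpow_measure_univ (p := 1) (q := 2) (by norm_num) (hF n)
    rw [eLpNorm_one_eq_lintegral_enorm, eLpNorm_eq_lintegral_rpow_enorm_toReal (by norm_num)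
      (by norm_num)] at this
    norm_num at this
    simpa using this
  have h3 : Tendsto (fun n => (∫⁻ z, ‖F n z‖ₑ ^ 2 ∂μ) ^ (1 / 2 : ℝ) * μ Set.univ ^ (1 / 2 : ℝ))
      atTop (𝓝 0) := by
    have e1 := (ENNReal.continuous_rpow_const (y := (1 / 2 : ℝ))).tendsto 0 |>.comp h
    rw [ENNReal.zero_rpow_of_pos (by norm_num)] at e1
    have e2 := ENNReal.Tendsto.mul_const (b := μ Set.univ ^ (1 / 2 : ℝ)) e1
      (Or.inr (ENNReal.rpow_ne_top_of_nonneg (by norm_num) (measure_ne_top μ _)))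
    simpa using e2
  exact tendsto_of_tendsto_of_tendsto_of_le_of_le tendsto_const_nhds h3 (fun _ => zero_le) h2

lemma integrableOn_of_memLp_two {ϱ : ℝ} {f : ℂ → ℂ}
    (hf : MemLp f 2 (volume.restrict (annulus ϱ))) : IntegrableOn f (annulus ϱ) :=
  hf.integrable (by norm_num)

lemma isWeakDeriv_of_contDiffOn {ϱ : ℝ} {U : ℂ → ℂ} (hU : ContDiffOn ℝ 1 U (annulus ϱ)) (w : ℂ) :
    IsWeakDeriv ϱ w U (fun z => fderiv ℝ U z w) := by
  intro φ hφ hφc hφs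
  have hsub : ∀ z, z ∉ annulus ϱ → φ z = 0 := fun z hz =>
    image_eq_zero_of_notMem_tsupport fun h => hz (hφs h)
  have hsub' : ∀ z, z ∉ tsupport φ → fderiv ℝ φ z w = 0 := fun z hz => by
    rw [fderiv_of_notMem_tsupport ℝ hz]; simp
  rw [setIntegral_eq_integral_of_forall_compl_eq_zero
      (fun z hz => by rw [hsub' z (fun h => hz (hφs h)), zero_smul]),
    setIntegral_eq_integral_of_forall_compl_eq_zero
      (fun z hz => by rw [hsub z hz, zero_smul])]
  have hcU : ContinuousOn U (tsupport φ) := hU.continuousOn.mono hφs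
  have hcdU : ContinuousOn (fun z => fderiv ℝ U z w) (tsupport φ) :=
    ((hU.continuousOn_fderiv_of_isOpen (isOpen_annulus ϱ) le_rfl).clm_apply
      continuousOn_const).mono hφs
  have hint : ∀ f : ℂ → ℂ, (∀ z, z ∉ tsupport φ → f z = 0) → ContinuousOn f (tsupport φ) →
      Integrable f := fun f h0 hf =>
    (integrableOn_iff_integrable_of_support_subset fun z hz => by
      by_contra h; exact hz (h0 z h)).1 (hf.integrableOn_compact hφc)
  have key := integral_smul_fderiv_eq_neg_fderiv_smul_of_integrable (μ := (volume : Measure ℂ))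
    (f := φ) (g := U) (v := w)
    (hint _ (fun z hz => by rw [hsub' z hz, zero_smul])
      ((contDiff_fderiv_apply hφ w).continuous.continuousOn.smul hcU))
    (hint _ (fun z hz => by rw [image_eq_zero_of_notMem_tsupport hz, zero_smul])
      (hφ.continuous.continuousOn.smul hcdU))
    (hint _ (fun z hz => by rw [image_eq_zero_of_notMem_tsupport hz, zero_smul])
      (hφ.continuous.continuousOn.smul hcU))
    (fun z _ => (hφ.differentiable (by simp)) z)
    (fun z hz => (hU.contDiffAt ((isOpen_annulus ϱ).mem_nhds (hφs hz))).differentiableAt one_ne_zero)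
  exact (neg_eq_iff_eq_neg.2 key).symm

/-- For a fixed test function both sides of the defining identity are continuous for $L^2$
convergence. -/
lemma IsWeakDeriv.of_tendsto {ϱ : ℝ} {w : ℂ} {f g : ℂ → ℂ} {F G : ℕ → ℂ → ℂ}
    (hF : ∀ n, MemLp (F n) 2 (volume.restrict (annulus ϱ)))
    (hG : ∀ n, MemLp (G n) 2 (volume.restrict (annulus ϱ)))
    (hf : MemLp f 2 (volume.restrict (annulus ϱ))) (hg : MemLp g 2 (volume.restrict (annulus ϱ)))
    (hFG : ∀ n, IsWeakDeriv ϱ w (F n) (G n))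
    (h1 : Tendsto (fun n => ∫⁻ z in annulus ϱ, ‖F n z - f z‖ₑ ^ 2) atTop (𝓝 0))
    (h2 : Tendsto (fun n => ∫⁻ z in annulus ϱ, ‖G n z - g z‖ₑ ^ 2) atTop (𝓝 0)) :
    IsWeakDeriv ϱ w f g := by
  have key : ∀ (ψ : ℂ → ℝ), Continuous ψ → HasCompactSupport ψ → ∀ (F : ℕ → ℂ → ℂ) (f : ℂ → ℂ),
      (∀ n, MemLp (F n) 2 (volume.restrict (annulus ϱ))) →
      MemLp f 2 (volume.restrict (annulus ϱ)) →
      Tendsto (fun n => ∫⁻ z in annulus ϱ, ‖F n z - f z‖ₑ ^ 2) atTop (𝓝 0) →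
      Tendsto (fun n => ∫ z in annulus ϱ, ψ z • F n z) atTop (𝓝 (∫ z in annulus ϱ, ψ z • f z)) := by
    intro ψ hψ hψc F f hF hf h
    obtain ⟨C, hC⟩ := hψc.exists_bound_of_continuous hψ
    have hi : ∀ f : ℂ → ℂ, MemLp f 2 (volume.restrict (annulus ϱ)) →
        Integrable (fun z => ψ z • f z) (volume.restrict (annulus ϱ)) := fun f hf =>
      (integrableOn_of_memLp_two hf).bdd_smul C hψ.aestronglyMeasurable
        (Eventually.of_forall hC)
    refine tendsto_integral_of_L1 _ (hi f hf).aestronglyMeasurable (Eventually.of_forall fun n => hi _ (hF n)) ?_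
    have e1 := tendsto_lintegral_enorm_of_sq
      (fun n => (hF n).aestronglyMeasurable.sub hf.aestronglyMeasurable) h
    have e2 : Tendsto (fun n => ENNReal.ofReal C * ∫⁻ z in annulus ϱ, ‖F n z - f z‖ₑ)
        atTop (𝓝 0) := by
      simpa using ENNReal.Tendsto.const_mul e1 (Or.inr (ENNReal.ofReal_ne_top (r := C)))
    refine tendsto_of_tendsto_of_tendsto_of_le_of_le tendsto_const_nhds e2 (fun _ => zero_le)
      fun n => ?_
    dsimp only
    rw [← lintegral_const_mul' _ _ ENNReal.ofReal_ne_top]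
    refine lintegral_mono fun z => ?_
    rw [← smul_sub, enorm_smul]
    gcongr
    rw [← ofReal_norm]
    exact ENNReal.ofReal_le_ofReal (hC z)
  intro φ hφ hφc hφs
  have e1 := key _ (contDiff_fderiv_apply hφ w).continuous (hasCompactSupport_fderiv_apply hφc w)
    F f hF hf h1
  have e2 := (key _ hφ.continuous hφc G g hG hg h2).neg
  refine tendsto_nhds_unique e1 (e2.congr fun n => ?_)
  exact (hFG n φ hφ hφc hφs).symm

/-- The weak and the classical derivative have the same pairing with every test function, so the
fundamental lemma of the calculus of variations applies. -/
lemma IsWeakDeriv.ae_eq_fderiv {ϱ : ℝ} {w : ℂ} {f g U : ℂ → ℂ} (h : IsWeakDeriv ϱ w f g)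
    (hg : MemLp g 2 (volume.restrict (annulus ϱ))) (hU : ContDiffOn ℝ 1 U (annulus ϱ))
    (hfU : f =ᵐ[volume.restrict (annulus ϱ)] U) :
    g =ᵐ[volume.restrict (annulus ϱ)] fun z => fderiv ℝ U z w := by
  have hcd : ContinuousOn (fun z => fderiv ℝ U z w) (annulus ϱ) :=
    (hU.continuousOn_fderiv_of_isOpen (isOpen_annulus ϱ) le_rfl).clm_apply continuousOn_const
  have hl1 : LocallyIntegrableOn g (annulus ϱ) volume :=
    IntegrableOn.locallyIntegrableOn (integrableOn_of_memLp_two hg)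
  have hl2 : LocallyIntegrableOn (fun z => fderiv ℝ U z w) (annulus ϱ) volume :=
    hcd.locallyIntegrableOn (measurableSet_annulus ϱ)
  have key := (isOpen_annulus ϱ).ae_eq_zero_of_integral_contDiff_smul_eq_zero
    (μ := (volume : Measure ℂ)) (hl1.sub hl2) ?_
  · rw [EventuallyEq, ae_restrict_iff' (measurableSet_annulus ϱ)]
    filter_upwards [key] with z hz hzA
    exact sub_eq_zero.1 (hz hzA)
  · intro φ hφ hφc hφs
    have hsub : ∀ z, z ∉ tsupport φ → φ z = 0 := fun z hz => image_eq_zero_of_notMem_tsupport hz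
    have hint : ∀ f : ℂ → ℂ, LocallyIntegrableOn f (annulus ϱ) volume →
        Integrable (fun z => φ z • f z) := fun f hf => by
      refine (integrableOn_iff_integrable_of_support_subset (s := tsupport φ) fun z hz => ?_).1 ?_
      · by_contra hn
        exact hz (by simp [hsub z hn])
      · exact (hf.integrableOn_compact_subset hφs hφc).continuousOn_smul
          hφ.continuous.continuousOn hφc
    have e1 := h φ hφ hφc hφs
    have e2 := isWeakDeriv_of_contDiffOn hU w φ hφ hφc hφs
    have e3 : ∫ z in annulus ϱ, (fderiv ℝ φ z w) • f z = ∫ z in annulus ϱ, (fderiv ℝ φ z w) • U z :=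
      integral_congr_ae (hfU.mono fun z hz => by simp only [hz])
    have e4 : ∫ z in annulus ϱ, φ z • g z = ∫ z in annulus ϱ, φ z • fderiv ℝ U z w := by
      rw [e3, e2] at e1
      exact (neg_injective e1).symm
    have hz0 : ∀ (f : ℂ → ℂ) z, z ∉ annulus ϱ → φ z • f z = 0 := fun f z hz => by
      rw [hsub z fun h => hz (hφs h), zero_smul]
    rw [setIntegral_eq_integral_of_forall_compl_eq_zero (hz0 _),
      setIntegral_eq_integral_of_forall_compl_eq_zero (hz0 _)] at e4
    simp only [Pi.sub_apply, smul_sub]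
    rw [integral_sub (hint _ hl1) (hint _ hl2), e4, sub_self]

/-! ### Smooth approximation in $H^1$ and change of representative -/

lemma memLp_of_continuous {ϱ : ℝ} {f : ℂ → ℂ} (hf : Continuous f) :
    MemLp f 2 (volume.restrict (annulus ϱ)) := by
  obtain ⟨C, hC⟩ := (isCompact_closedBall (0 : ℂ) 1).exists_bound_of_continuousOn hf.continuousOn
  refine MemLp.of_bound hf.aestronglyMeasurable C ?_
  rw [ae_restrict_iff' (measurableSet_annulus ϱ)]
  exact Eventually.of_forall fun z hz => hC z (annulus_subset_closedBall ϱ hz)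

/-- The squared `H¹(A)` distance between a smooth function `φ` and a function `f` with
derivatives `g` and `h`. -/
def h1Dist (ϱ : ℝ) (f g h φ : ℂ → ℂ) : ℝ≥0∞ :=
  ∫⁻ z in annulus ϱ, (‖φ z - f z‖ₑ ^ 2 + ‖fderiv ℝ φ z 1 - g z‖ₑ ^ 2
    + ‖fderiv ℝ φ z Complex.I - h z‖ₑ ^ 2)

lemma h1DistSq_eq {ϱ : ℝ} (u : H1Annulus ϱ) (φ : ℂ → ℂ) :
    h1DistSq u φ = h1Dist ϱ u.toFun u.dx u.dy φ := rfl

lemma tendsto_of_h1Dist {ϱ : ℝ} {f g h : ℂ → ℂ} {φ : ℕ → ℂ → ℂ}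
    (hd : Tendsto (fun n => h1Dist ϱ f g h (φ n)) atTop (𝓝 0)) :
    Tendsto (fun n => ∫⁻ z in annulus ϱ, ‖φ n z - f z‖ₑ ^ 2) atTop (𝓝 0) ∧
    Tendsto (fun n => ∫⁻ z in annulus ϱ, ‖fderiv ℝ (φ n) z 1 - g z‖ₑ ^ 2) atTop (𝓝 0) ∧
    Tendsto (fun n => ∫⁻ z in annulus ϱ, ‖fderiv ℝ (φ n) z Complex.I - h z‖ₑ ^ 2)
      atTop (𝓝 0) := by
  refine ⟨?_, ?_, ?_⟩ <;>
    refine tendsto_of_tendsto_of_tendsto_of_le_of_le tendsto_const_nhds hd (fun _ => zero_le)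
      fun n => lintegral_mono fun z => ?_
  · exact le_self_add.trans le_self_add
  · exact le_add_self.trans le_self_add
  · exact le_add_self

/-- Limits of smooth functions in the `H¹` distance are Sobolev functions. -/
lemma exists_h1Annulus_of_tendsto {ϱ : ℝ} {f g h : ℂ → ℂ}
    (hf : AEStronglyMeasurable f (volume.restrict (annulus ϱ)))
    (hg : AEStronglyMeasurable g (volume.restrict (annulus ϱ)))
    (hh : AEStronglyMeasurable h (volume.restrict (annulus ϱ)))
    {φ : ℕ → ℂ → ℂ} (hφ : ∀ n, ContDiff ℝ ∞ (φ n))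
    (hd : Tendsto (fun n => h1Dist ϱ f g h (φ n)) atTop (𝓝 0)) :
    ∃ v : H1Annulus ϱ, v.toFun = f ∧ v.dx = g ∧ v.dy = h := by
  obtain ⟨h1, h2, h3⟩ := tendsto_of_h1Dist hd
  have key : ∀ (F : ℕ → ℂ → ℂ) (f : ℂ → ℂ), (∀ n, Continuous (F n)) →
      AEStronglyMeasurable f (volume.restrict (annulus ϱ)) →
      Tendsto (fun n => ∫⁻ z in annulus ϱ, ‖F n z - f z‖ₑ ^ 2) atTop (𝓝 0) →
      MemLp f 2 (volume.restrict (annulus ϱ)) := by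
    intro F f hF hf ht
    -- One approximant at finite distance already puts the limit in $L^2$.
    obtain ⟨n, hn⟩ := ((tendsto_order.1 ht).2 1 one_pos).exists
    have : MemLp (fun z => F n z - f z) 2 (volume.restrict (annulus ϱ)) := by
      refine ⟨(hF n).aestronglyMeasurable.sub hf, ?_⟩
      rw [eLpNorm_lt_top_iff_lintegral_rpow_enorm_lt_top (by norm_num) (by norm_num)]
      simpa using hn.trans ENNReal.one_lt_top
    have h2 := (memLp_of_continuous (ϱ := ϱ) (hF n)).sub this
    refine h2.ae_eq (Eventually.of_forall fun z => ?_)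
    simp
  have hcd : ∀ w n, Continuous (fun z => fderiv ℝ (φ n) z w) := fun w n =>
    (contDiff_fderiv_apply (hφ n) w).continuous
  have mf := key _ f (fun n => (hφ n).continuous) hf h1
  have mg := key _ g (hcd 1) hg h2
  have mh := key _ h (hcd Complex.I) hh h3
  have hw : ∀ w n, IsWeakDeriv ϱ w (φ n) (fun z => fderiv ℝ (φ n) z w) := fun w n =>
    isWeakDeriv_of_contDiffOn ((hφ n).of_le (by norm_cast)).contDiffOn w
  exact ⟨⟨f, g, h, mf, mg, mh,
    IsWeakDeriv.of_tendsto (fun n => memLp_of_continuous (hφ n).continuous)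
      (fun n => memLp_of_continuous (hcd 1 n)) mf mg (hw 1) h1 h2,
    IsWeakDeriv.of_tendsto (fun n => memLp_of_continuous (hφ n).continuous)
      (fun n => memLp_of_continuous (hcd Complex.I n)) mf mh (hw Complex.I) h1 h3⟩, rfl, rfl, rfl⟩

lemma classI_congr {ϱ : ℝ} {p q : ℤ} {u v : H1Annulus ϱ} (hu : u ∈ classI ϱ p q)
    (h1 : u.toFun =ᵐ[volume.restrict (annulus ϱ)] v.toFun)
    (h2 : u.dx =ᵐ[volume.restrict (annulus ϱ)] v.dx)
    (h3 : u.dy =ᵐ[volume.restrict (annulus ϱ)] v.dy) : v ∈ classI ϱ p q := by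
  obtain ⟨g, ⟨hm, φ, hφ, hd, hb⟩, h⟩ := hu
  refine ⟨g, ⟨hm, φ, hφ, hd.congr fun n => ?_, hb⟩, h⟩
  refine lintegral_congr_ae ?_
  filter_upwards [h1, h2, h3] with z e1 e2 e3
  rw [e1, e2, e3]

lemma energy_congr {ϱ : ℝ} {u v : H1Annulus ϱ}
    (h2 : u.dx =ᵐ[volume.restrict (annulus ϱ)] v.dx)
    (h3 : u.dy =ᵐ[volume.restrict (annulus ϱ)] v.dy) : energy u = energy v := by
  unfold energy
  congr 1
  refine integral_congr_ae ?_
  filter_upwards [h2, h3] with z e2 e3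
  rw [e2, e3]

/-- A Sobolev function with a `C¹` representative can be replaced by it. -/
lemma exists_classical_representative {ϱ : ℝ} (u : H1Annulus ϱ) {U : ℂ → ℂ}
    (hU : ContDiffOn ℝ 1 U (annulus ϱ)) (h : u.toFun =ᵐ[volume.restrict (annulus ϱ)] U) :
    ∃ v : H1Annulus ϱ, v.toFun = U ∧ v.dx = (fun z => fderiv ℝ U z 1) ∧
      v.dy = (fun z => fderiv ℝ U z Complex.I) ∧ energy v = energy u ∧
      ∀ p q, u ∈ classI ϱ p q → v ∈ classI ϱ p q := by
  have hx := u.weak_dx.ae_eq_fderiv u.memLp_dx hU h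
  have hy := u.weak_dy.ae_eq_fderiv u.memLp_dy hU h
  exact ⟨⟨U, _, _, u.memLp_toFun.ae_eq h, u.memLp_dx.ae_eq hx, u.memLp_dy.ae_eq hy,
    isWeakDeriv_of_contDiffOn hU 1, isWeakDeriv_of_contDiffOn hU Complex.I⟩, rfl, rfl, rfl,
    energy_congr hx.symm hy.symm, fun p q hu => classI_congr hu h hx hy⟩

lemma integrable_energy_density {ϱ : ℝ} (u : H1Annulus ϱ) :
    IntegrableOn (fun z => ‖u.dx z‖ ^ 2 + ‖u.dy z‖ ^ 2) (annulus ϱ) :=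
  ((memLp_two_iff_integrable_sq_norm u.memLp_dx.1).1 u.memLp_dx).add
    ((memLp_two_iff_integrable_sq_norm u.memLp_dy.1).1 u.memLp_dy)

/-! ### Minimizers are harmonic -/

lemma circleMap_notMem_annulus {ϱ r : ℝ} (h0 : 0 < ϱ) (hr : r ∈ ({ϱ, 1} : Set ℝ)) (θ : ℝ) :
    circleMap 0 r θ ∉ annulus ϱ := by
  rintro ⟨h1, h2⟩
  rcases hr with rfl | rfl
  · simp [abs_of_pos h0] at h1
  · simp at h2

/-- Translating the smooth approximants by $\psi$ leaves their boundary values unchanged, because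
$\psi$ vanishes on both circles. -/
lemma exists_classI_add_test {ϱ : ℝ} (h0 : 0 < ϱ) {p q : ℤ} {u : H1Annulus ϱ}
    (hu : u ∈ classI ϱ p q) {ψ : ℂ → ℂ} (hψ : ContDiff ℝ ∞ ψ) (hψs : tsupport ψ ⊆ annulus ϱ) :
    ∃ v ∈ classI ϱ p q, v.dx = (fun z => u.dx z + fderiv ℝ ψ z 1) ∧
      v.dy = fun z => u.dy z + fderiv ℝ ψ z Complex.I := by
  obtain ⟨g, ⟨hm, φ, hφ, hd, hb⟩, h⟩ := hu
  have hfd : ∀ n z w, fderiv ℝ (φ n + ψ) z w = fderiv ℝ (φ n) z w + fderiv ℝ ψ z w := by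
    intro n z w
    rw [fderiv_add ((hφ n).differentiable (by simp) z) (hψ.differentiable (by simp) z)]
    rfl
  have hd' : Tendsto (fun n => h1Dist ϱ (fun z => u.toFun z + ψ z)
      (fun z => u.dx z + fderiv ℝ ψ z 1) (fun z => u.dy z + fderiv ℝ ψ z Complex.I) (φ n + ψ))
      atTop (𝓝 0) := by
    refine hd.congr fun n => ?_
    simp only [h1DistSq, h1Dist, hfd, Pi.add_apply, add_sub_add_right_eq_sub]
  have hc : ∀ w, Continuous (fun z => fderiv ℝ ψ z w) := fun w =>
    (contDiff_fderiv_apply hψ w).continuous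
  obtain ⟨v, hv0, hv1, hv2⟩ := exists_h1Annulus_of_tendsto
    (u.memLp_toFun.1.add hψ.continuous.aestronglyMeasurable)
    (u.memLp_dx.1.add (hc 1).aestronglyMeasurable)
    (u.memLp_dy.1.add (hc Complex.I).aestronglyMeasurable) (fun n => (hφ n).add hψ) hd'
  refine ⟨v, ⟨g, ⟨hm, fun n => φ n + ψ, fun n => (hφ n).add hψ, ?_, fun r hr => ?_⟩, h⟩, hv1, hv2⟩
  · simp only [h1DistSq_eq, hv0, hv1, hv2]
    exact hd'
  · refine (hb r hr).congr fun n => ?_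
    have : ∀ θ, ψ (circleMap 0 r θ) = 0 := fun θ =>
      image_eq_zero_of_notMem_tsupport fun hmem => circleMap_notMem_annulus h0 hr θ (hψs hmem)
    simp [onCircle, this]

/-- Serves to extract a vanishing first variation from minimality; the discriminant of the
nonnegative quadratic is $B^2$. -/
lemma eq_zero_of_forall_quadratic_nonneg {B C : ℝ} (h : ∀ t : ℝ, 0 ≤ t * B + t ^ 2 * C) :
    B = 0 := by
  have h1 := discrim_le_zero (a := C) (b := B) (c := 0) fun t => by nlinarith [h t]
  rw [discrim] at h1
  nlinarith [sq_nonneg B]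

/-- The Euler-Lagrange equation. -/
lemma IsMinimizer.integral_inner_eq_zero {ϱ : ℝ} (h0 : 0 < ϱ) {p q : ℤ} {u : H1Annulus ϱ}
    (hu : IsMinimizer u p q) {ψ : ℂ → ℝ} (hψ : ContDiff ℝ ∞ ψ) (hψc : HasCompactSupport ψ)
    (hψs : tsupport ψ ⊆ annulus ϱ) :
    ∫ z in annulus ϱ, ((fderiv ℝ ψ z 1) • u.dx z + (fderiv ℝ ψ z Complex.I) • u.dy z) = 0 := by
  have hcw : ∀ w, Continuous (fun z => fderiv ℝ ψ z w) := fun w =>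
    (contDiff_fderiv_apply hψ w).continuous
  have hbd : ∀ w, ∃ C, ∀ z, ‖fderiv ℝ ψ z w‖ ≤ C := fun w =>
    (hasCompactSupport_fderiv_apply hψc w).exists_bound_of_continuous (hcw w)
  have hi : ∀ w (f : ℂ → ℂ), MemLp f 2 (volume.restrict (annulus ϱ)) →
      Integrable (fun z => fderiv ℝ ψ z w • f z) (volume.restrict (annulus ϱ)) := fun w f hf => by
    obtain ⟨C, hC⟩ := hbd w
    exact (integrableOn_of_memLp_two hf).bdd_smul C (hcw w).aestronglyMeasurable
      (Eventually.of_forall hC)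
  have hI : Integrable (fun z => (fderiv ℝ ψ z 1) • u.dx z + (fderiv ℝ ψ z Complex.I) • u.dy z)
      (volume.restrict (annulus ϱ)) := (hi 1 _ u.memLp_dx).add (hi Complex.I _ u.memLp_dy)
  -- The competitor is $u+t\psi\xi$ with a fixed vector $\xi$; its energy is exactly quadratic in
  -- $t$.
  have key : ∀ ξ : ℂ, ∫ z in annulus ϱ, inner ℝ ξ
      ((fderiv ℝ ψ z 1) • u.dx z + (fderiv ℝ ψ z Complex.I) • u.dy z) = 0 := by
    intro ξ
    have hI' : Integrable (fun z => inner ℝ ξ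
      ((fderiv ℝ ψ z 1) • u.dx z + (fderiv ℝ ψ z Complex.I) • u.dy z))
      (volume.restrict (annulus ϱ)) := hI.const_inner ξ
    have hC : Integrable (fun z => (fderiv ℝ ψ z 1) ^ 2 + (fderiv ℝ ψ z Complex.I) ^ 2)
        (volume.restrict (annulus ϱ)) := by
      have h1 : ∀ w, Integrable (fun z => (fderiv ℝ ψ z w) ^ 2) (volume : Measure ℂ) := fun w =>
        ((hcw w).pow 2).integrable_of_hasCompactSupport
          (by simpa only [pow_two] using
            (hasCompactSupport_fderiv_apply hψc w).mul_right)
      exact ((h1 1).add (h1 Complex.I)).restrict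
    refine eq_zero_of_forall_quadratic_nonneg
      (C := (1 / 2) * ‖ξ‖ ^ 2 * ∫ z in annulus ϱ, ((fderiv ℝ ψ z 1) ^ 2 +
        (fderiv ℝ ψ z Complex.I) ^ 2)) fun t => ?_
    have hψ' : ContDiff ℝ ∞ (fun z => ψ z • (t • ξ)) := hψ.smul contDiff_const
    obtain ⟨v, hv, hv1, hv2⟩ := exists_classI_add_test h0 hu.1 hψ'
      ((tsupport_smul_subset_left _ _).trans hψs)
    have hfd : ∀ z w, fderiv ℝ (fun z => ψ z • (t • ξ)) z w = fderiv ℝ ψ z w • (t • ξ) := by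
      intro z w
      rw [fderiv_smul_const (hψ.differentiable (by simp) z)]
      rfl
    have hle := hu.2 v hv
    have hE : energy v = energy u + (t * (∫ z in annulus ϱ, inner ℝ ξ
      ((fderiv ℝ ψ z 1) • u.dx z + (fderiv ℝ ψ z Complex.I) • u.dy z)) + t ^ 2 *
      ((1 / 2) * ‖ξ‖ ^ 2 * ∫ z in annulus ϱ, ((fderiv ℝ ψ z 1) ^ 2 +
        (fderiv ℝ ψ z Complex.I) ^ 2))) := by
      unfold energy
      have e : ∀ z, ‖v.dx z‖ ^ 2 + ‖v.dy z‖ ^ 2 = (‖u.dx z‖ ^ 2 + ‖u.dy z‖ ^ 2) +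
          (2 * t * (inner ℝ ξ ((fderiv ℝ ψ z 1) • u.dx z + (fderiv ℝ ψ z Complex.I) • u.dy z)) +
          t ^ 2 * ‖ξ‖ ^ 2 * ((fderiv ℝ ψ z 1) ^ 2 + (fderiv ℝ ψ z Complex.I) ^ 2)) := by
        intro z
        rw [hv1, hv2]
        dsimp only
        rw [hfd, hfd, norm_add_sq_real, norm_add_sq_real, inner_add_right]
        simp only [norm_smul, real_inner_smul_right, real_inner_comm ξ, mul_pow, Real.norm_eq_abs,
          sq_abs]
        ring
      simp_rw [e]
      have hJ : Integrable (fun z => 2 * t * (inner ℝ ξ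
          ((fderiv ℝ ψ z 1) • u.dx z + (fderiv ℝ ψ z Complex.I) • u.dy z)) +
          t ^ 2 * ‖ξ‖ ^ 2 * ((fderiv ℝ ψ z 1) ^ 2 + (fderiv ℝ ψ z Complex.I) ^ 2))
          (volume.restrict (annulus ϱ)) :=
        (hI'.const_mul (2 * t)).add (hC.const_mul (t ^ 2 * ‖ξ‖ ^ 2))
      rw [integral_add (integrable_energy_density u) hJ,
        integral_add (hI'.const_mul (2 * t)) (hC.const_mul (t ^ 2 * ‖ξ‖ ^ 2)),
        integral_const_mul, integral_const_mul]
      ring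
    linarith
  have h2 : ∀ ξ : ℂ, inner ℝ ξ (∫ z in annulus ϱ, ((fderiv ℝ ψ z 1) • u.dx z +
      (fderiv ℝ ψ z Complex.I) • u.dy z)) = 0 := fun ξ => by
    rw [← integral_inner hI]
    exact key ξ
  exact inner_self_eq_zero.1 (h2 _)

lemma IsMinimizer.exists_harmonic {ϱ : ℝ} (h0 : 0 < ϱ) {p q : ℤ} {u : H1Annulus ϱ}
    (hu : IsMinimizer u p q) :
    ∃ U : ℂ → ℂ, HarmonicOnNhd U (annulus ϱ) ∧ u.toFun =ᵐ[volume.restrict (annulus ϱ)] U := by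
  have hmeas := measurableSet_annulus ϱ
  -- Weyl's lemma wants a function on the whole plane. The extension by zero suffices, as only test
  -- functions supported in the annulus occur.
  have hint : Integrable ((annulus ϱ).indicator u.toFun) :=
    (integrable_indicator_iff hmeas).2 (integrableOn_of_memLp_two u.memLp_toFun)
  have hwh : WeaklyHarmonic ((annulus ϱ).indicator u.toFun) (annulus ϱ) := by
    intro φ hφ hφc hφs
    have hcw : ∀ w, Continuous (fun z => fderiv ℝ φ z w) := fun w =>
      (contDiff_fderiv_apply hφ w).continuous
    have hi : ∀ (k : ℂ → ℝ) (f : ℂ → ℂ), Continuous k → HasCompactSupport k →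
        MemLp f 2 (volume.restrict (annulus ϱ)) →
        Integrable (fun z => k z • f z) (volume.restrict (annulus ϱ)) := fun k f hk hkc hf => by
      obtain ⟨C, hC⟩ := hkc.exists_bound_of_continuous hk
      exact (integrableOn_of_memLp_two hf).bdd_smul C hk.aestronglyMeasurable
        (Eventually.of_forall hC)
    have e1 : ∀ z, Δ φ z • (annulus ϱ).indicator u.toFun z =
        (annulus ϱ).indicator (fun z => Δ φ z • u.toFun z) z := fun z => by
      by_cases hz : z ∈ annulus ϱ <;> simp [hz]
    simp_rw [e1]
    rw [integral_indicator hmeas]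
    have e2 : ∀ z, Δ φ z • u.toFun z =
        (fderiv ℝ (fun x => fderiv ℝ φ x 1) z 1) • u.toFun z +
        (fderiv ℝ (fun x => fderiv ℝ φ x Complex.I) z Complex.I) • u.toFun z := fun z => by
      rw [laplacian_apply_complex (hφ.contDiffAt.of_le (by norm_cast)), add_smul]
    simp_rw [e2]
    -- The derivatives of $\varphi$ are themselves admissible test functions, so the weak
    -- derivatives of $u$ turn $\int u\,\Delta\varphi$ into the Euler–Lagrange integral.
    have hs : ∀ w, tsupport (fun x => fderiv ℝ φ x w) ⊆ annulus ϱ := fun w =>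
      (tsupport_fderiv_apply_subset ℝ w).trans hφs
    have hc1 := fun w => contDiff_fderiv_apply hφ w
    have hc2 := fun w => hasCompactSupport_fderiv_apply hφc w
    rw [integral_add
      (hi _ _ (contDiff_fderiv_apply (hc1 1) 1).continuous
        (hasCompactSupport_fderiv_apply (hc2 1) 1) u.memLp_toFun)
      (hi _ _ (contDiff_fderiv_apply (hc1 Complex.I) Complex.I).continuous
        (hasCompactSupport_fderiv_apply (hc2 Complex.I) Complex.I) u.memLp_toFun),
      u.weak_dx _ (hc1 1) (hc2 1) (hs 1),
      u.weak_dy _ (hc1 Complex.I) (hc2 Complex.I) (hs Complex.I), ← neg_add,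
      ← integral_add (hi _ _ (hcw 1) (hc2 1) u.memLp_dx)
        (hi _ _ (hcw Complex.I) (hc2 Complex.I) u.memLp_dy),
      hu.integral_inner_eq_zero h0 hφ hφc hφs, neg_zero]
  obtain ⟨U, hU, hae⟩ := hwh.exists_harmonicOnNhd (isOpen_annulus ϱ) hint.locallyIntegrable
  refine ⟨U, hU, ?_⟩
  filter_upwards [hae, ae_restrict_mem hmeas] with z hz hzA
  rwa [Set.indicator_of_mem hzA] at hz

lemma contDiffOn_of_harmonic {Ω : Set ℂ} {U : ℂ → ℂ} (hU : HarmonicOnNhd U Ω) :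
    ContDiffOn ℝ ∞ U Ω := fun z hz =>
  (HarmonicAt.analyticAt_of_complex (hU z hz)).contDiffAt.contDiffWithinAt

/-! ### Composition of Sobolev maps with changes of variables -/

/-- A self-map `T` of the annulus, with almost everywhere derivative `DT`, such that composition
with `T` preserves Sobolev functions and their traces. -/
structure IsAdmissible (ϱ : ℝ) (T : ℂ → ℂ) (DT : ℂ → ℂ →L[ℝ] ℂ) : Prop where
  continuousOn : ContinuousOn T (annulus ϱ)
  mapsTo : Set.MapsTo T (annulus ϱ) (annulus ϱ)
  -- The fold is only Lipschitz, so it enters through smooth maps with uniformly bounded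
  -- derivatives. They need not be smooth at the origin, which lies outside the closed annulus.
  approx : ∃ S : ℕ → ℂ → ℂ, (∀ k, ContDiffOn ℝ ∞ (S k) {0}ᶜ) ∧
    (∃ C, ∀ k z, ϱ ≤ ‖z‖ → ‖z‖ ≤ 1 → ‖S k z‖ ≤ C ∧ ‖fderiv ℝ (S k) z‖ ≤ C) ∧
    (∀ z, ϱ ≤ ‖z‖ → ‖z‖ ≤ 1 → Tendsto (fun k => S k z) atTop (𝓝 (T z))) ∧
    ∀ᵐ z ∂volume.restrict (annulus ϱ), Tendsto (fun k => fderiv ℝ (S k) z) atTop (𝓝 (DT z))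
  -- The two integral bounds make composition with `T` continuous on $L^2$ of the annulus and of its
  -- boundary circles.
  lintegral_le : ∃ K : ℝ≥0∞, K ≠ ⊤ ∧ ∀ F : ℂ → ℝ≥0∞,
    ∫⁻ z in annulus ϱ, F (T z) ≤ K * ∫⁻ z in annulus ϱ, F z
  circle_le : ∀ r ∈ ({ϱ, 1} : Set ℝ), ∃ r' ∈ ({ϱ, 1} : Set ℝ), ∃ K : ℝ≥0∞, K ≠ ⊤ ∧
    ∀ F : ℂ → ℝ≥0∞, ∫⁻ θ, F (T (circleMap 0 r θ)) ∂angleMeasure ≤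
      K * ∫⁻ θ, F (circleMap 0 r' θ) ∂angleMeasure

lemma enorm_sq_eq_ofReal (a : ℂ) : ‖a‖ₑ ^ 2 = ENNReal.ofReal (‖a‖ ^ 2) := by
  rw [ENNReal.ofReal_pow (norm_nonneg _), ofReal_norm]

lemma enorm_sub_sq_le (a b c : ℂ) : ‖a - c‖ₑ ^ 2 ≤ 2 * ‖a - b‖ₑ ^ 2 + 2 * ‖b - c‖ₑ ^ 2 := by
  simp only [enorm_sq_eq_ofReal]
  rw [← ENNReal.ofReal_ofNat 2, ← ENNReal.ofReal_mul zero_le_two, ← ENNReal.ofReal_mul zero_le_two,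
    ← ENNReal.ofReal_add (by positivity) (by positivity)]
  refine ENNReal.ofReal_le_ofReal ?_
  have := norm_sub_le_norm_sub_add_norm_sub a b c
  nlinarith [sq_nonneg (‖a - b‖ - ‖b - c‖), norm_nonneg (a - c)]

lemma enorm_apply_sq_le (L : ℂ →L[ℝ] ℂ) (v : ℂ) :
    ‖L v‖ₑ ^ 2 ≤ 2 * ‖v‖ₑ ^ 2 * (‖L 1‖ₑ ^ 2 + ‖L Complex.I‖ₑ ^ 2) := by
  simp only [enorm_sq_eq_ofReal]
  rw [← ENNReal.ofReal_ofNat 2, ← ENNReal.ofReal_mul zero_le_two,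
    ← ENNReal.ofReal_add (by positivity) (by positivity), ← ENNReal.ofReal_mul (by positivity)]
  refine ENNReal.ofReal_le_ofReal ?_
  have h1 : ‖L v‖ ≤ |v.re| * ‖L 1‖ + |v.im| * ‖L Complex.I‖ := by
    conv_lhs => rw [show v = v.re • (1 : ℂ) + v.im • Complex.I by simp]
    rw [map_add, map_smul, map_smul]
    refine (norm_add_le _ _).trans ?_
    rw [norm_smul, norm_smul, Real.norm_eq_abs, Real.norm_eq_abs]
  have h2 : ‖L v‖ ≤ ‖v‖ * ‖L 1‖ + ‖v‖ * ‖L Complex.I‖ := h1.trans (by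
    gcongr
    · exact Complex.abs_re_le_norm v
    · exact Complex.abs_im_le_norm v)
  calc ‖L v‖ ^ 2 ≤ (‖v‖ * ‖L 1‖ + ‖v‖ * ‖L Complex.I‖) ^ 2 := by gcongr
    _ ≤ _ := by nlinarith [sq_nonneg (‖v‖ * ‖L 1‖ - ‖v‖ * ‖L Complex.I‖)]

/-- Only the error at the chosen index is controlled, which is enough to pick a diagonal sequence of
approximants. -/
lemma exists_tendsto_zero_diagonal {a : ℕ → ℕ → ℝ≥0∞}
    (h : ∀ n, Tendsto (a n) atTop (𝓝 0)) :
    ∃ k : ℕ → ℕ, Tendsto (fun n => a n (k n)) atTop (𝓝 0) := by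
  have : ∀ n : ℕ, ∃ k, a n k ≤ ((n : ℝ≥0∞) + 1)⁻¹ := fun n =>
    (((tendsto_order.1 (h n)).2 _ (ENNReal.inv_pos.2 (by finiteness))).exists).imp
      fun k hk => hk.le
  choose k hk using this
  refine ⟨k, tendsto_of_tendsto_of_tendsto_of_le_of_le tendsto_const_nhds ?_
    (fun _ => zero_le) hk⟩
  have := ENNReal.tendsto_inv_nat_nhds_zero.comp (tendsto_add_atTop_nat 1)
  refine this.congr fun n => ?_
  simp

lemma tendsto_lintegral_enorm_sub_sq {α : Type*} [MeasurableSpace α] {μ : Measure α}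
    [IsFiniteMeasure μ] {F : ℕ → α → ℂ} {f : α → ℂ} (hF : ∀ n, AEStronglyMeasurable (F n) μ)
    {C : ℝ} (hC : ∀ n, ∀ᵐ z ∂μ, ‖F n z‖ ≤ C)
    (h : ∀ᵐ z ∂μ, Tendsto (fun n => F n z) atTop (𝓝 (f z))) :
    Tendsto (fun n => ∫⁻ z, ‖F n z - f z‖ₑ ^ 2 ∂μ) atTop (𝓝 0) := by
  have hf : AEStronglyMeasurable f μ := aestronglyMeasurable_of_tendsto_ae _ hF h
  have hC' : ∀ᵐ z ∂μ, ∀ n, ‖F n z‖ ≤ C := ae_all_iff.2 hC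
  have := tendsto_lintegral_of_dominated_convergence' (μ := μ)
    (F := fun n z => ‖F n z - f z‖ₑ ^ 2) (f := fun _ => 0) (fun _ => ENNReal.ofReal ((2 * C) ^ 2))
    (fun n => ((hF n).sub hf).enorm.pow_const 2) (fun n => ?_) ?_ ?_
  · simpa using this
  · filter_upwards [hC', h] with z hz ht
    have hfz : ‖f z‖ ≤ C := le_of_tendsto ht.norm (Eventually.of_forall hz)
    rw [enorm_sq_eq_ofReal]
    refine ENNReal.ofReal_le_ofReal ?_
    have := norm_sub_le (F n z) (f z)
    have := hz n
    gcongr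
    linarith
  · simp only [lintegral_const]
    finiteness
  · filter_upwards [h] with z hz
    have h1 : Tendsto (fun n => F n z - f z) atTop (𝓝 0) := by
      simpa using hz.sub_const (f z)
    have h2 := (ENNReal.continuous_pow 2).tendsto _ |>.comp h1.enorm
    simpa [Function.comp_def] using h2

instance isFiniteMeasure_angleMeasure : IsFiniteMeasure angleMeasure := by
  unfold angleMeasure; infer_instance

/-- Multiplication by the cutoff makes functions that are smooth only off the origin smooth on the
plane, without changing them near the closed annulus. -/
lemma exists_smooth_cutoff {ϱ : ℝ} (h0 : 0 < ϱ) :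
    ∃ χ : ℂ → ℝ, ContDiff ℝ ∞ χ ∧ (∀ᶠ z in 𝓝 0, χ z = 0) ∧ ∀ z, ϱ / 2 ≤ ‖z‖ → χ z = 1 := by
  let b : ContDiffBump (0 : ℂ) := ⟨ϱ / 4, ϱ / 2, by positivity, by linarith⟩
  refine ⟨fun z => 1 - b z, contDiff_const.sub b.contDiff, ?_, fun z hz => ?_⟩
  · filter_upwards [b.eventuallyEq_one] with z hz
    simp [hz]
  · have : b z = 0 := b.zero_of_le_dist (by rwa [dist_zero_right])
    simp [this]

lemma contDiff_smul_of_contDiffOn {χ : ℂ → ℝ} (hχ : ContDiff ℝ ∞ χ) (hχ0 : ∀ᶠ z in 𝓝 0, χ z = 0)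
    {f : ℂ → ℂ} (hf : ContDiffOn ℝ ∞ f {0}ᶜ) : ContDiff ℝ ∞ (fun z => χ z • f z) := by
  rw [contDiff_iff_contDiffAt]
  intro z
  by_cases hz : z = 0
  · subst hz
    refine (contDiffAt_const (c := (0 : ℂ))).congr_of_eventuallyEq ?_
    filter_upwards [hχ0] with w hw
    simp [hw]
  · exact hχ.contDiffAt.smul (hf.contDiffAt (isOpen_compl_singleton.mem_nhds hz))

/-- The approximants are $\varphi_n\circ S_k$, where $\varphi_n$ approximates $u$ and $S_k$
approximates `T`. For fixed $n$, dominated convergence lets $k\to\infty$ and gives $\varphi_n\circ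
T$. The latter tends to $U\circ T$ as $n\to\infty$ by the integral bounds in `IsAdmissible`. A
diagonal choice of $k$ combines both limits. -/
lemma IsAdmissible.exists_comp {ϱ : ℝ} (h0 : 0 < ϱ) (hϱ1 : ϱ < 1) {T : ℂ → ℂ} {DT : ℂ → ℂ →L[ℝ] ℂ}
    (hT : IsAdmissible ϱ T DT) {u : H1Annulus ϱ} {U : ℂ → ℂ} (hU : ContDiffOn ℝ 1 U (annulus ϱ))
    (hu0 : u.toFun = U) (hux : u.dx = fun z => fderiv ℝ U z 1)
    (huy : u.dy = fun z => fderiv ℝ U z Complex.I) {g : ℂ → ℂ} (hg : IsTrace u g)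
    (hgm : ∀ r ∈ ({ϱ, 1} : Set ℝ),
      AEStronglyMeasurable (onCircle (fun z => g (T z)) r) angleMeasure) :
    ∃ v : H1Annulus ϱ, v.toFun = (fun z => U (T z)) ∧
      v.dx = (fun z => fderiv ℝ U (T z) (DT z 1)) ∧
      v.dy = (fun z => fderiv ℝ U (T z) (DT z Complex.I)) ∧ IsTrace v fun z => g (T z) := by
  obtain ⟨S, hS, ⟨C, hC⟩, hSt, hSd⟩ := hT.approx
  obtain ⟨K, hK, hKle⟩ := hT.lintegral_le
  obtain ⟨-, φ, hφ, hd, hb⟩ := hg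
  obtain ⟨χ, hχ, hχ0, hχ1⟩ := exists_smooth_cutoff h0
  have hmeas := measurableSet_annulus ϱ
  have hAn : ∀ z ∈ annulus ϱ, ϱ ≤ ‖z‖ ∧ ‖z‖ ≤ 1 := fun z hz => ⟨hz.1.le, hz.2.le⟩
  let W : ℕ → ℕ → ℂ → ℂ := fun n k z => χ z • φ n (S k z)
  have hW : ∀ n k, ContDiff ℝ ∞ (W n k) := fun n k =>
    contDiff_smul_of_contDiffOn hχ hχ0 ((hφ n).comp_contDiffOn (hS k))
  have hWeq : ∀ n k z, ϱ / 2 ≤ ‖z‖ → W n k z = φ n (S k z) := fun n k z hz => by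
    simp [W, hχ1 z hz]
  have hWd : ∀ n k, ∀ z ∈ annulus ϱ, ∀ w, fderiv ℝ (W n k) z w =
      fderiv ℝ (φ n) (S k z) (fderiv ℝ (S k) z w) := by
    intro n k z hz w
    have hev : W n k =ᶠ[𝓝 z] φ n ∘ S k := by
      filter_upwards [(isOpen_annulus ϱ).mem_nhds hz] with y hy
      exact hWeq n k y (by linarith [hy.1])
    rw [hev.fderiv_eq, fderiv_comp z ((hφ n).differentiable (by simp) _)
      (((hS k).contDiffAt (isOpen_compl_singleton.mem_nhds
        (annulus_ne_zero h0 hz))).differentiableAt (by simp))]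
    rfl
  have hDT : ∀ᵐ z ∂volume.restrict (annulus ϱ), ‖DT z‖ ≤ C := by
    filter_upwards [hSd, ae_restrict_mem hmeas] with z hz hzA
    exact le_of_tendsto hz.norm
      (Eventually.of_forall fun k => (hC k z (hAn z hzA).1 (hAn z hzA).2).2)
  have hDTm : ∀ w, AEStronglyMeasurable (fun z => DT z w) (volume.restrict (annulus ϱ)) := by
    intro w
    refine aestronglyMeasurable_of_tendsto_ae atTop (f := fun k z => fderiv ℝ (S k) z w)
      (fun k => ?_) ?_
    · have : ContinuousOn (fun z => fderiv ℝ (S k) z w) (annulus ϱ) := by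
        refine (((hS k).of_le (m := 1) (by norm_cast)).continuousOn_fderiv_of_isOpen
          isOpen_compl_singleton le_rfl).clm_apply continuousOn_const |>.mono fun z hz => ?_
        exact annulus_ne_zero h0 hz
      exact this.aestronglyMeasurable hmeas
    · filter_upwards [hSd] with z hz
      exact ((ContinuousLinearMap.apply ℝ ℂ w).continuous.tendsto _).comp hz
  have hcomp : ∀ (V : ℂ → ℂ) (w : ℂ), ContDiffOn ℝ 1 V (annulus ϱ) →
      AEStronglyMeasurable (fun z => V (T z)) (volume.restrict (annulus ϱ)) ∧
      AEStronglyMeasurable (fun z => fderiv ℝ V (T z) (DT z w))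
        (volume.restrict (annulus ϱ)) := by
    intro V w hV
    refine ⟨(hV.continuousOn.comp hT.continuousOn hT.mapsTo).aestronglyMeasurable hmeas, ?_⟩
    have h1 : AEStronglyMeasurable (fun z => fderiv ℝ V (T z)) (volume.restrict (annulus ϱ)) :=
      ((hV.continuousOn_fderiv_of_isOpen (isOpen_annulus ϱ) le_rfl).comp hT.continuousOn
        hT.mapsTo).aestronglyMeasurable hmeas
    exact isBoundedBilinearMap_apply.continuous.comp_aestronglyMeasurable (h1.prodMk (hDTm w))
  have hφ1 : ∀ n, ContDiffOn ℝ 1 (φ n) (annulus ϱ) := fun n =>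
    ((hφ n).of_le (by norm_cast)).contDiffOn
  -- convergence of the composed test functions for a fixed index
  have hball : ∀ n, ∃ M, ∀ z ∈ Metric.closedBall (0 : ℂ) C, ‖φ n z‖ ≤ M ∧ ‖fderiv ℝ (φ n) z‖ ≤ M := by
    intro n
    obtain ⟨M₁, h1⟩ := (isCompact_closedBall (0 : ℂ) C).exists_bound_of_continuousOn
      (hφ n).continuous.continuousOn
    obtain ⟨M₂, h2⟩ := (isCompact_closedBall (0 : ℂ) C).exists_bound_of_continuousOn
      ((hφ n).continuous_fderiv (by simp)).continuousOn
    exact ⟨max M₁ M₂, fun z hz => ⟨(h1 z hz).trans (le_max_left _ _),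
      (h2 z hz).trans (le_max_right _ _)⟩⟩
  have hfix0 : ∀ n, Tendsto (fun k => ∫⁻ z in annulus ϱ, ‖W n k z - φ n (T z)‖ₑ ^ 2) atTop
      (𝓝 0) := by
    intro n
    obtain ⟨M, hM⟩ := hball n
    refine tendsto_lintegral_enorm_sub_sq (C := M) (fun k => (hW n k).continuous.aestronglyMeasurable)
      (fun k => ?_) ?_
    · filter_upwards [ae_restrict_mem hmeas] with z hz
      rw [hWeq n k z (by linarith [hz.1])]
      refine (hM _ ?_).1
      rw [mem_closedBall_zero_iff]
      exact (hC k z (hAn z hz).1 (hAn z hz).2).1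
    · filter_upwards [ae_restrict_mem hmeas] with z hz
      simp_rw [hWeq n _ z (by linarith [hz.1] : ϱ / 2 ≤ ‖z‖)]
      exact ((hφ n).continuous.tendsto _).comp (hSt z (hAn z hz).1 (hAn z hz).2)
  have hfixw : ∀ w n, Tendsto (fun k => ∫⁻ z in annulus ϱ,
      ‖fderiv ℝ (W n k) z w - fderiv ℝ (φ n) (T z) (DT z w)‖ₑ ^ 2) atTop (𝓝 0) := by
    intro w n
    obtain ⟨M, hM⟩ := hball n
    refine tendsto_lintegral_enorm_sub_sq (C := M * (C * ‖w‖))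
      (fun k => (contDiff_fderiv_apply (hW n k) w).continuous.aestronglyMeasurable)
      (fun k => ?_) ?_
    · filter_upwards [ae_restrict_mem hmeas] with z hz
      have hCz := hC k z (hAn z hz).1 (hAn z hz).2
      have hMz := (hM (S k z) (by rw [mem_closedBall_zero_iff]; exact hCz.1)).2
      rw [hWd n k z hz]
      refine (ContinuousLinearMap.le_opNorm _ _).trans ?_
      refine mul_le_mul hMz ((ContinuousLinearMap.le_opNorm _ _).trans ?_) (norm_nonneg _)
        ((norm_nonneg _).trans hMz)
      gcongr
      exact hCz.2
    · filter_upwards [ae_restrict_mem hmeas, hSd] with z hz hzd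
      simp_rw [hWd n _ z hz]
      have e1 : Tendsto (fun k => fderiv ℝ (φ n) (S k z)) atTop (𝓝 (fderiv ℝ (φ n) (T z))) :=
        (((hφ n).continuous_fderiv (by simp)).tendsto _).comp (hSt z (hAn z hz).1 (hAn z hz).2)
      have e2 : Tendsto (fun k => fderiv ℝ (S k) z w) atTop (𝓝 (DT z w)) :=
        ((ContinuousLinearMap.apply ℝ ℂ w).continuous.tendsto _).comp hzd
      exact (isBoundedBilinearMap_apply.continuous.tendsto
        (fderiv ℝ (φ n) (T z), DT z w)).comp (e1.prodMk_nhds e2)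
  have hfixb : ∀ r ∈ ({ϱ, 1} : Set ℝ), ∀ n, Tendsto (fun k => ∫⁻ θ,
      ‖onCircle (W n k) r θ - φ n (T (circleMap 0 r θ))‖ₑ ^ 2 ∂angleMeasure) atTop (𝓝 0) := by
    intro r hr n
    obtain ⟨M, hM⟩ := hball n
    have hnorm : ∀ θ, ‖circleMap 0 r θ‖ = r := fun θ => by
      rcases hr with rfl | rfl <;> simp [abs_of_pos h0]
    have hr1 : ϱ ≤ r ∧ r ≤ 1 := by
      rcases hr with rfl | rfl
      · exact ⟨le_rfl, hϱ1.le⟩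
      · exact ⟨hϱ1.le, le_rfl⟩
    have hWc : ∀ k θ, onCircle (W n k) r θ = φ n (S k (circleMap 0 r θ)) := fun k θ =>
      hWeq n k _ (by rw [hnorm]; linarith)
    refine tendsto_lintegral_enorm_sub_sq (C := M)
      (fun k => ((hW n k).continuous.comp (continuous_circleMap 0 r)).aestronglyMeasurable)
      (fun k => Eventually.of_forall fun θ => ?_) (Eventually.of_forall fun θ => ?_)
    · rw [hWc]
      refine (hM _ ?_).1
      rw [mem_closedBall_zero_iff]
      exact (hC k _ (by rw [hnorm]; exact hr1.1) (by rw [hnorm]; exact hr1.2)).1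
    · simp_rw [hWc]
      exact ((hφ n).continuous.tendsto _).comp
        (hSt _ (by rw [hnorm]; exact hr1.1) (by rw [hnorm]; exact hr1.2))
  -- A single index has to control five errors: the function, its two derivatives and the two
  -- boundary traces.
  obtain ⟨k, hk⟩ := exists_tendsto_zero_diagonal (a := fun n k =>
    (∫⁻ z in annulus ϱ, ‖W n k z - φ n (T z)‖ₑ ^ 2) +
    (∫⁻ z in annulus ϱ, ‖fderiv ℝ (W n k) z 1 - fderiv ℝ (φ n) (T z) (DT z 1)‖ₑ ^ 2) +
    (∫⁻ z in annulus ϱ,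
      ‖fderiv ℝ (W n k) z Complex.I - fderiv ℝ (φ n) (T z) (DT z Complex.I)‖ₑ ^ 2) +
    ((∫⁻ θ, ‖onCircle (W n k) ϱ θ - φ n (T (circleMap 0 ϱ θ))‖ₑ ^ 2 ∂angleMeasure) +
    ∫⁻ θ, ‖onCircle (W n k) 1 θ - φ n (T (circleMap 0 1 θ))‖ₑ ^ 2 ∂angleMeasure))
    (fun n => by
      have := (((hfix0 n).add (hfixw 1 n)).add (hfixw Complex.I n)).add
        ((hfixb ϱ (by simp) n).add (hfixb 1 (by simp) n))
      simpa only [add_zero] using this)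
  have hkA := tendsto_of_tendsto_of_tendsto_of_le_of_le tendsto_const_nhds hk
    (fun _ => zero_le) (fun n => (le_self_add : (∫⁻ z in annulus ϱ, ‖W n (k n) z - φ n (T z)‖ₑ ^ 2) +
    (∫⁻ z in annulus ϱ, ‖fderiv ℝ (W n (k n)) z 1 - fderiv ℝ (φ n) (T z) (DT z 1)‖ₑ ^ 2) +
    (∫⁻ z in annulus ϱ,
      ‖fderiv ℝ (W n (k n)) z Complex.I - fderiv ℝ (φ n) (T z) (DT z Complex.I)‖ₑ ^ 2) ≤ _))
  have hkB : ∀ r ∈ ({ϱ, 1} : Set ℝ), Tendsto (fun n => ∫⁻ θ,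
      ‖onCircle (W n (k n)) r θ - φ n (T (circleMap 0 r θ))‖ₑ ^ 2 ∂angleMeasure) atTop (𝓝 0) := by
    intro r hr
    refine tendsto_of_tendsto_of_tendsto_of_le_of_le tendsto_const_nhds hk (fun _ => zero_le)
      fun n => ?_
    rcases hr with rfl | rfl
    · exact le_self_add.trans le_add_self
    · exact le_add_self.trans le_add_self
  let c : ℝ≥0∞ := ENNReal.ofReal (C ^ 2)
  -- The error is split at $\varphi_n\circ T$. Each of the two derivatives contributes $2\cdot 2c$
  -- to the second term through `enorm_apply_sq_le`, in total $8c=2\cdot4c$.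
  have hmain : ∀ n, h1Dist ϱ (fun z => U (T z)) (fun z => fderiv ℝ U (T z) (DT z 1))
      (fun z => fderiv ℝ U (T z) (DT z Complex.I)) (W n (k n)) ≤
      2 * ((∫⁻ z in annulus ϱ, ‖W n (k n) z - φ n (T z)‖ₑ ^ 2) +
    (∫⁻ z in annulus ϱ, ‖fderiv ℝ (W n (k n)) z 1 - fderiv ℝ (φ n) (T z) (DT z 1)‖ₑ ^ 2) +
    (∫⁻ z in annulus ϱ,
      ‖fderiv ℝ (W n (k n)) z Complex.I - fderiv ℝ (φ n) (T z) (DT z Complex.I)‖ₑ ^ 2)) +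
      (2 * (1 + 4 * c) * K) * h1DistSq u (φ n) := by
    intro n
    let D : ℂ → ℝ≥0∞ := fun z => ‖φ n z - U z‖ₑ ^ 2 + ‖fderiv ℝ (φ n) z 1 - fderiv ℝ U z 1‖ₑ ^ 2 +
      ‖fderiv ℝ (φ n) z Complex.I - fderiv ℝ U z Complex.I‖ₑ ^ 2
    have hDle : ∫⁻ z in annulus ϱ, D (T z) ≤ K * h1DistSq u (φ n) := by
      have := hKle D
      rwa [show ∫⁻ z in annulus ϱ, D z = h1DistSq u (φ n) by
        simp only [h1DistSq, hu0, hux, huy, D]] at this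
    have m0 : AEMeasurable (fun z => ‖W n (k n) z - φ n (T z)‖ₑ ^ 2)
        (volume.restrict (annulus ϱ)) :=
      ((hW n (k n)).continuous.aestronglyMeasurable.sub
        (hcomp (φ n) 1 (hφ1 n)).1).enorm.pow_const 2
    have mw : ∀ w, AEMeasurable (fun z => ‖fderiv ℝ (W n (k n)) z w -
        fderiv ℝ (φ n) (T z) (DT z w)‖ₑ ^ 2) (volume.restrict (annulus ϱ)) := fun w =>
      ((contDiff_fderiv_apply (hW n (k n)) w).continuous.aestronglyMeasurable.sub
        (hcomp (φ n) w (hφ1 n)).2).enorm.pow_const 2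
    have hpt : ∀ᵐ z ∂volume.restrict (annulus ϱ), ‖W n (k n) z - U (T z)‖ₑ ^ 2 +
        ‖fderiv ℝ (W n (k n)) z 1 - fderiv ℝ U (T z) (DT z 1)‖ₑ ^ 2 +
        ‖fderiv ℝ (W n (k n)) z Complex.I - fderiv ℝ U (T z) (DT z Complex.I)‖ₑ ^ 2 ≤
        2 * (‖W n (k n) z - φ n (T z)‖ₑ ^ 2 +
        ‖fderiv ℝ (W n (k n)) z 1 - fderiv ℝ (φ n) (T z) (DT z 1)‖ₑ ^ 2 +
        ‖fderiv ℝ (W n (k n)) z Complex.I - fderiv ℝ (φ n) (T z) (DT z Complex.I)‖ₑ ^ 2) +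
        2 * (1 + 4 * c) * D (T z) := by
      filter_upwards [hDT] with z hz
      have hw : ∀ w, ‖w‖ = 1 → ‖fderiv ℝ (φ n) (T z) (DT z w) - fderiv ℝ U (T z) (DT z w)‖ₑ ^ 2 ≤
          2 * c * (‖fderiv ℝ (φ n) (T z) 1 - fderiv ℝ U (T z) 1‖ₑ ^ 2 +
          ‖fderiv ℝ (φ n) (T z) Complex.I - fderiv ℝ U (T z) Complex.I‖ₑ ^ 2) := by
        intro w hw
        refine (enorm_apply_sq_le (fderiv ℝ (φ n) (T z) - fderiv ℝ U (T z)) (DT z w)).trans ?_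
        have : ‖DT z w‖ₑ ^ 2 ≤ c := by
          rw [enorm_sq_eq_ofReal]
          refine ENNReal.ofReal_le_ofReal ?_
          have := (DT z).le_opNorm w
          rw [hw, mul_one] at this
          exact pow_le_pow_left₀ (norm_nonneg _) (this.trans hz) 2
        simp only [sub_apply]
        gcongr
      have e0 := enorm_sub_sq_le (W n (k n) z) (φ n (T z)) (U (T z))
      have e1 := (enorm_sub_sq_le (fderiv ℝ (W n (k n)) z 1) (fderiv ℝ (φ n) (T z) (DT z 1))
        (fderiv ℝ U (T z) (DT z 1))).trans (add_le_add_right (mul_le_mul_right (hw 1 (by simp)) 2) _)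
      have e2 := (enorm_sub_sq_le (fderiv ℝ (W n (k n)) z Complex.I)
        (fderiv ℝ (φ n) (T z) (DT z Complex.I)) (fderiv ℝ U (T z) (DT z Complex.I))).trans
        (add_le_add_right (mul_le_mul_right (hw Complex.I (by simp)) 2) _)
      refine (add_le_add (add_le_add e0 e1) e2).trans ?_
      simp only [D]
      generalize ‖W n (k n) z - φ n (T z)‖ₑ ^ 2 = x0
      generalize ‖fderiv ℝ (W n (k n)) z 1 - fderiv ℝ (φ n) (T z) (DT z 1)‖ₑ ^ 2 = x1
      generalize ‖fderiv ℝ (W n (k n)) z Complex.I - fderiv ℝ (φ n) (T z) (DT z Complex.I)‖ₑ ^ 2 = x2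
      generalize ‖φ n (T z) - U (T z)‖ₑ ^ 2 = y0
      generalize ‖fderiv ℝ (φ n) (T z) 1 - fderiv ℝ U (T z) 1‖ₑ ^ 2 = y1
      generalize ‖fderiv ℝ (φ n) (T z) Complex.I - fderiv ℝ U (T z) Complex.I‖ₑ ^ 2 = y2
      calc _ = 2 * (x0 + x1 + x2) + (2 * y0 + 8 * c * (y1 + y2)) := by ring
        -- Adding the missing terms completes the right side to a multiple of the full density `D`,
        -- to which the bound on $\int D\circ T$ applies.
        _ ≤ 2 * (x0 + x1 + x2) + ((2 * y0 + 8 * c * (y1 + y2)) + (2 * (y1 + y2) + 8 * c * y0)) :=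
          add_le_add_right le_self_add _
        _ = _ := by ring
    refine (lintegral_mono_ae hpt).trans ?_
    have m1 : AEMeasurable (fun z => ‖W n (k n) z - φ n (T z)‖ₑ ^ 2 +
        ‖fderiv ℝ (W n (k n)) z 1 - fderiv ℝ (φ n) (T z) (DT z 1)‖ₑ ^ 2)
        (volume.restrict (annulus ϱ)) := m0.add (mw 1)
    have m2 : AEMeasurable (fun z => 2 * (‖W n (k n) z - φ n (T z)‖ₑ ^ 2 +
        ‖fderiv ℝ (W n (k n)) z 1 - fderiv ℝ (φ n) (T z) (DT z 1)‖ₑ ^ 2 +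
        ‖fderiv ℝ (W n (k n)) z Complex.I - fderiv ℝ (φ n) (T z) (DT z Complex.I)‖ₑ ^ 2))
        (volume.restrict (annulus ϱ)) := (m1.add (mw Complex.I)).const_mul 2
    rw [lintegral_add_left' m2,
      lintegral_const_mul' _ _ (by finiteness), lintegral_const_mul' _ _ (by finiteness),
      lintegral_add_left' m1, lintegral_add_left' m0, mul_assoc (2 * (1 + 4 * c)) K]
    gcongr
  have hdist : Tendsto (fun n => h1Dist ϱ (fun z => U (T z)) (fun z => fderiv ℝ U (T z) (DT z 1))
      (fun z => fderiv ℝ U (T z) (DT z Complex.I)) (W n (k n))) atTop (𝓝 0) := by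
    refine tendsto_of_tendsto_of_tendsto_of_le_of_le tendsto_const_nhds ?_ (fun _ => zero_le) hmain
    have e1 := ENNReal.Tendsto.const_mul hkA (Or.inr (ENNReal.ofNat_ne_top (n := 2)))
    have e2 := ENNReal.Tendsto.const_mul (a := 2 * (1 + 4 * c) * K) hd (Or.inr (by finiteness))
    simpa using e1.add e2
  obtain ⟨v, hv0, hv1, hv2⟩ := exists_h1Annulus_of_tendsto (hcomp U 1 hU).1 (hcomp U 1 hU).2
    (hcomp U Complex.I hU).2 (fun n => hW n (k n)) hdist
  refine ⟨v, hv0, hv1, hv2, hgm, fun n => W n (k n), fun n => hW n (k n), ?_, fun r hr => ?_⟩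
  · simp only [h1DistSq_eq, hv0, hv1, hv2]
    exact hdist
  · obtain ⟨r', hr', K', hK', hle⟩ := hT.circle_le r hr
    have hbd : ∀ n, ∫⁻ θ, ‖onCircle (W n (k n)) r θ - onCircle (fun z => g (T z)) r θ‖ₑ ^ 2
        ∂angleMeasure ≤ 2 * (∫⁻ θ, ‖onCircle (W n (k n)) r θ - φ n (T (circleMap 0 r θ))‖ₑ ^ 2
          ∂angleMeasure) + (2 * K') * ∫⁻ θ, ‖onCircle (φ n) r' θ - onCircle g r' θ‖ₑ ^ 2
          ∂angleMeasure := by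
      intro n
      refine (lintegral_mono fun θ => enorm_sub_sq_le (onCircle (W n (k n)) r θ)
        (φ n (T (circleMap 0 r θ))) (onCircle (fun z => g (T z)) r θ)).trans ?_
      have hm : AEMeasurable (fun θ => ‖φ n (T (circleMap 0 r θ)) -
          onCircle (fun z => g (T z)) r θ‖ₑ ^ 2) angleMeasure := by
        refine (AEStronglyMeasurable.sub ?_ (hgm r hr)).enorm.pow_const 2
        have hnorm : ∀ θ, ϱ ≤ ‖circleMap 0 r θ‖ ∧ ‖circleMap 0 r θ‖ ≤ 1 := fun θ => by
          rcases hr with rfl | rfl <;> simp [abs_of_pos h0, hϱ1.le]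
        refine aestronglyMeasurable_of_tendsto_ae atTop
          (f := fun j θ => φ n (S j (circleMap 0 r θ))) (fun j => ?_)
          (Eventually.of_forall fun θ => ((hφ n).continuous.tendsto _).comp
            (hSt _ (hnorm θ).1 (hnorm θ).2))
        refine ((hφ n).continuous.comp ?_).aestronglyMeasurable
        refine (hS j).continuousOn.comp_continuous (continuous_circleMap 0 r) fun θ => ?_
        exact norm_pos_iff.1 (h0.trans_le (hnorm θ).1)
      rw [lintegral_add_right' _ (hm.const_mul 2), lintegral_const_mul' _ _ (by finiteness),
        lintegral_const_mul' _ _ (by finiteness), mul_assoc 2 K']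
      gcongr
      exact hle fun z => ‖φ n z - g z‖ₑ ^ 2
    refine tendsto_of_tendsto_of_tendsto_of_le_of_le tendsto_const_nhds ?_ (fun _ => zero_le) hbd
    have e1 := ENNReal.Tendsto.const_mul (hkB r hr) (Or.inr (ENNReal.ofNat_ne_top (n := 2)))
    have e2 := ENNReal.Tendsto.const_mul (a := 2 * K') (hb r' hr') (Or.inr (by finiteness))
    simpa using e1.add e2

/-! ### The inversion and the fold across the middle circle -/

lemma det_eq_wirt (L : ℂ →L[ℝ] ℂ) : L.det = ‖wirt L‖ ^ 2 - ‖wirtBar L‖ ^ 2 := by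
  rw [ContinuousLinearMap.det, ← LinearMap.det_toMatrix Complex.basisOneI, Matrix.det_fin_two]
  simp only [LinearMap.toMatrix_apply, Complex.coe_basisOneI_repr, Complex.coe_basisOneI,
    Matrix.cons_val_zero, Matrix.cons_val_one, ContinuousLinearMap.coe_coe, wirt, wirtBar,
    Complex.sq_norm, Complex.normSq_apply]
  simp
  ring

/-- The antilinear map `v ↦ β conj v`. -/
def antiMul (β : ℂ) : ℂ →L[ℝ] ℂ := β • (Complex.conjCLE : ℂ →L[ℝ] ℂ)

@[simp] lemma antiMul_apply (β v : ℂ) : antiMul β v = β * conj v := by simp [antiMul]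

lemma wirt_antiMul (β : ℂ) : wirt (antiMul β) = 0 ∧ wirtBar (antiMul β) = β :=
  wirt_eq_of_apply fun v => by simp

/-- The inversion in the middle circle of the annulus. -/
def inversion (ϱ : ℝ) (z : ℂ) : ℂ := (ϱ : ℂ) / conj z

lemma norm_inversion {ϱ : ℝ} (h0 : 0 < ϱ) (z : ℂ) : ‖inversion ϱ z‖ = ϱ / ‖z‖ := by
  simp [inversion, abs_of_pos h0]

lemma inversion_inversion {ϱ : ℝ} (h0 : 0 < ϱ) {z : ℂ} (hz : z ≠ 0) :
    inversion ϱ (inversion ϱ z) = z := by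
  have : (ϱ : ℂ) ≠ 0 := by exact_mod_cast h0.ne'
  simp only [inversion, map_div₀, Complex.conj_ofReal, Complex.conj_conj]
  field_simp

lemma inversion_mem_annulus {ϱ : ℝ} (h0 : 0 < ϱ) {z : ℂ} (hz : z ∈ annulus ϱ) :
    inversion ϱ z ∈ annulus ϱ := by
  have hz0 : 0 < ‖z‖ := h0.trans hz.1
  refine ⟨?_, ?_⟩
  · rw [norm_inversion h0, lt_div_iff₀ hz0]
    nlinarith [hz.2]
  · rw [norm_inversion h0, div_lt_one hz0]
    exact hz.1

lemma inversion_eq_self {ϱ : ℝ} {z : ℂ} (hz0 : z ≠ 0) (hz : ‖z‖ ^ 2 = ϱ) : inversion ϱ z = z := by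
  have : conj z ≠ 0 := by simpa using hz0
  rw [inversion, div_eq_iff this, Complex.mul_conj, Complex.normSq_eq_norm_sq, hz]

lemma hasFDerivAt_inversion (ϱ : ℝ) {z : ℂ} (hz : z ≠ 0) :
    HasFDerivAt (inversion ϱ) (antiMul (-(ϱ / conj z ^ 2))) z := by
  have h1 : HasDerivAt (fun w : ℂ => (ϱ : ℂ) / w) (-(ϱ / z ^ 2)) z := by
    have := (hasDerivAt_inv hz).const_mul (ϱ : ℂ)
    simpa [div_eq_mul_inv] using this
  have h2 := (Complex.conjCLE : ℂ →L[ℝ] ℂ).hasFDerivAt.comp z (h1.hasFDerivAt.restrictScalars ℝ)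
  have e1 : inversion ϱ = (⇑(Complex.conjCLE : ℂ →L[ℝ] ℂ)) ∘ fun w : ℂ => (ϱ : ℂ) / w := by
    ext w; simp [inversion]
  rw [e1]
  refine h2.congr_fderiv ?_
  ext v <;> simp [mul_comm]

lemma abs_det_fderiv_inversion {ϱ : ℝ} {z : ℂ} :
    |(antiMul (-(ϱ / conj z ^ 2))).det| = ‖(ϱ : ℂ) / conj z ^ 2‖ ^ 2 := by
  rw [det_eq_wirt, (wirt_antiMul _).1, (wirt_antiMul _).2]
  simp

lemma injOn_inversion {ϱ : ℝ} (h0 : 0 < ϱ) {s : Set ℂ} (hs : s ⊆ annulus ϱ) :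
    Set.InjOn (inversion ϱ) s := fun z hz w hw h => by
  rw [← inversion_inversion h0 (annulus_ne_zero h0 (hs hz)), h,
    inversion_inversion h0 (annulus_ne_zero h0 (hs hw))]

/-- The part of the annulus that the fold keeps: the outer half for `σ = 1` and the inner half
for `σ = -1`. -/
def foldKeep (ϱ σ : ℝ) : Set ℂ := {z | 0 ≤ σ * (‖z‖ ^ 2 - ϱ)}

open Classical in
/-- The fold of the annulus onto one of its halves. -/
def fold (ϱ σ : ℝ) (z : ℂ) : ℂ := if z ∈ foldKeep ϱ σ then z else inversion ϱ z

open Classical in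
/-- The derivative of the fold. -/
def foldDeriv (ϱ σ : ℝ) (z : ℂ) : ℂ →L[ℝ] ℂ :=
  if z ∈ foldKeep ϱ σ then ContinuousLinearMap.id ℝ ℂ else antiMul (-(ϱ / conj z ^ 2))

lemma isClosed_foldKeep (ϱ σ : ℝ) : IsClosed (foldKeep ϱ σ) :=
  isClosed_le continuous_const (by fun_prop)

/-! ### Smooth approximation of the fold -/

/-- The smooth approximation of the dilation factor of the fold. -/
def foldFactor (ϱ σ δ q : ℝ) : ℝ := (1 + ϱ / q + σ * √((1 - ϱ / q) ^ 2 + δ ^ 2)) / 2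

def foldFactorDeriv (ϱ σ δ q : ℝ) : ℝ :=
  (-(ϱ / q ^ 2) + σ * ((1 - ϱ / q) * (ϱ / q ^ 2) / √((1 - ϱ / q) ^ 2 + δ ^ 2))) / 2

lemma hasDerivAt_foldFactor {ϱ σ δ q : ℝ} (hδ : 0 < δ) (hq : q ≠ 0) :
    HasDerivAt (foldFactor ϱ σ δ) (foldFactorDeriv ϱ σ δ q) q := by
  have h1 : HasDerivAt (fun q => ϱ / q) (-(ϱ / q ^ 2)) q := by
    have := (hasDerivAt_inv hq).const_mul ϱ
    simpa [div_eq_mul_inv] using this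
  have h2 : HasDerivAt (fun q => (1 - ϱ / q) ^ 2 + δ ^ 2)
      (2 * (1 - ϱ / q) * (ϱ / q ^ 2)) q := by
    have := ((h1.const_sub 1).pow 2).add_const (δ ^ 2)
    refine this.congr_deriv ?_
    simp
  have h3 := h2.sqrt (by positivity)
  have h4 := ((h1.const_add 1).add (h3.const_mul σ)).div_const 2
  refine h4.congr_deriv ?_
  unfold foldFactorDeriv
  have : √((1 - ϱ / q) ^ 2 + δ ^ 2) ≠ 0 := (Real.sqrt_pos.2 (by positivity)).ne'
  field_simp

lemma tendsto_foldFactor {ϱ σ : ℝ} (q : ℝ) :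
    Tendsto (fun k : ℕ => foldFactor ϱ σ (1 / (k + 1)) q) atTop
      (𝓝 ((1 + ϱ / q + σ * |1 - ϱ / q|) / 2)) := by
  have hc : Continuous (fun δ => foldFactor ϱ σ δ q) := by
    unfold foldFactor; fun_prop
  have := (hc.tendsto 0).comp (tendsto_one_div_add_atTop_nhds_zero_nat (𝕜 := ℝ))
  simpa [foldFactor, Function.comp_def, Real.sqrt_sq_eq_abs] using this

/-- The hypothesis excludes the middle circle, where the absolute value has its kink. -/
lemma tendsto_foldFactorDeriv {ϱ σ : ℝ} {q : ℝ} (hq : 1 - ϱ / q ≠ 0) :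
    Tendsto (fun k : ℕ => foldFactorDeriv ϱ σ (1 / (k + 1)) q) atTop
      (𝓝 ((-(ϱ / q ^ 2) + σ * ((1 - ϱ / q) * (ϱ / q ^ 2) / |1 - ϱ / q|)) / 2)) := by
  have hc : ContinuousAt (fun δ => foldFactorDeriv ϱ σ δ q) 0 := by
    unfold foldFactorDeriv
    have : √((1 - ϱ / q) ^ 2 + (0 : ℝ) ^ 2) ≠ 0 := by
      simp [Real.sqrt_sq_eq_abs, hq]
    fun_prop (disch := exact this)
  have := hc.tendsto.comp (tendsto_one_div_add_atTop_nhds_zero_nat (𝕜 := ℝ))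
  simpa [foldFactorDeriv, Function.comp_def, Real.sqrt_sq_eq_abs] using this

/-- The smooth approximations of the fold. -/
def foldApprox (ϱ σ δ : ℝ) (z : ℂ) : ℂ := foldFactor ϱ σ δ (‖z‖ ^ 2) • z

/-- The derivative of `z ↦ m(|z|²) z` in terms of the values `m` and `m'`. -/
def radialScaleDeriv (z : ℂ) (m m' : ℝ) : ℂ →L[ℝ] ℂ :=
  m • ContinuousLinearMap.id ℝ ℂ + (m' • (2 : ℝ) • innerSL ℝ z).smulRight z

lemma radialScaleDeriv_apply (z : ℂ) (m m' : ℝ) (v : ℂ) :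
    radialScaleDeriv z m m' v = m * v + m' * (z * conj v + conj z * v) * z := by
  simp only [radialScaleDeriv, add_apply, smul_apply,
    ContinuousLinearMap.smulRight_apply, innerSL_apply_apply, Complex.inner]
  apply Complex.ext <;> simp <;> ring

lemma hasFDerivAt_foldApprox {ϱ σ δ : ℝ} (hδ : 0 < δ) {z : ℂ} (hz : z ≠ 0) :
    HasFDerivAt (foldApprox ϱ σ δ) (radialScaleDeriv z (foldFactor ϱ σ δ (‖z‖ ^ 2))
      (foldFactorDeriv ϱ σ δ (‖z‖ ^ 2))) z := by
  have h1 : HasFDerivAt (fun z : ℂ => ‖z‖ ^ 2) ((2 : ℝ) • innerSL ℝ z) z := by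
    refine (hasStrictFDerivAt_norm_sq z).hasFDerivAt.congr_fderiv ?_
    rw [two_smul, two_smul]
  have hq : ‖z‖ ^ 2 ≠ 0 := by simpa using hz
  have h2 := (hasDerivAt_foldFactor (ϱ := ϱ) (σ := σ) hδ hq).comp_hasFDerivAt z h1
  exact h2.smul (hasFDerivAt_id z)

lemma contDiffOn_foldApprox {ϱ σ δ : ℝ} (hδ : 0 < δ) :
    ContDiffOn ℝ ∞ (foldApprox ϱ σ δ) {0}ᶜ := by
  intro z hz
  have hq : ‖z‖ ^ 2 ≠ 0 := by simpa using hz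
  have h1 : ContDiffAt ℝ ∞ (fun z : ℂ => ϱ / ‖z‖ ^ 2) z :=
    contDiffAt_const.div (contDiff_norm_sq ℝ (E := ℂ)).contDiffAt hq
  refine ContDiffAt.contDiffWithinAt ?_
  unfold foldApprox foldFactor
  have h2 : ContDiffAt ℝ ∞ (fun z : ℂ => (1 - ϱ / ‖z‖ ^ 2) ^ 2 + δ ^ 2) z :=
    ((contDiffAt_const.sub h1).pow 2).add contDiffAt_const
  have h3 : ContDiffAt ℝ ∞ (fun z : ℂ => (1 + ϱ / ‖z‖ ^ 2 +
      σ * √((1 - ϱ / ‖z‖ ^ 2) ^ 2 + δ ^ 2)) / 2) z :=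
    ((contDiffAt_const.add h1).add (contDiffAt_const.mul (h2.sqrt (by positivity)))).div_const 2
  exact h3.smul contDiffAt_id

lemma mul_abs_eq_of_keep {ϱ σ q : ℝ} (hσ : σ = 1 ∨ σ = -1) (hq : 0 < q)
    (h : 0 ≤ σ * (q - ϱ)) : σ * |1 - ϱ / q| = 1 - ϱ / q := by
  have e : 1 - ϱ / q = (q - ϱ) / q := by field_simp
  rw [e]
  rcases hσ with rfl | rfl
  · rw [abs_of_nonneg (div_nonneg (by linarith) hq.le)]; ring
  · rw [abs_of_nonpos (div_nonpos_of_nonpos_of_nonneg (by linarith) hq.le)]; ring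

lemma mul_abs_eq_of_not_keep {ϱ σ q : ℝ} (hσ : σ = 1 ∨ σ = -1) (hq : 0 < q)
    (h : ¬ 0 ≤ σ * (q - ϱ)) : σ * |1 - ϱ / q| = -(1 - ϱ / q) := by
  have e : 1 - ϱ / q = (q - ϱ) / q := by field_simp
  rw [e]
  rcases hσ with rfl | rfl
  · rw [abs_of_nonpos (div_nonpos_of_nonpos_of_nonneg (by linarith) hq.le)]; ring
  · rw [abs_of_nonneg (div_nonneg (by linarith) hq.le)]; ring

lemma inversion_eq_smul {ϱ : ℝ} {z : ℂ} (hz : z ≠ 0) : inversion ϱ z = (ϱ / ‖z‖ ^ 2) • z := by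
  have h1 : conj z ≠ 0 := by simpa using hz
  have h2 : ((‖z‖ ^ 2 : ℝ) : ℂ) = z * conj z := by rw [Complex.mul_conj, Complex.normSq_eq_norm_sq]
  rw [inversion, Complex.real_smul, Complex.ofReal_div, h2]
  field_simp

/-- The fold scales $z$ by the larger ($\sigma=1$) or the smaller ($\sigma=-1$) of $1$ and
$\varrho/|z|^2$. Writing this as $(a+b\pm|a-b|)/2$ prepares the smoothing of $|x|$ to
$\sqrt{x^2+\delta^2}$. -/
lemma fold_eq_smul {ϱ σ : ℝ} (hσ : σ = 1 ∨ σ = -1) {z : ℂ} (hz : z ≠ 0) :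
    fold ϱ σ z = ((1 + ϱ / ‖z‖ ^ 2 + σ * |1 - ϱ / ‖z‖ ^ 2|) / 2) • z := by
  have hq : 0 < ‖z‖ ^ 2 := by positivity
  by_cases h : z ∈ foldKeep ϱ σ
  · rw [fold, if_pos h, mul_abs_eq_of_keep hσ hq h]
    ring_nf
    simp
  · rw [fold, if_neg h, mul_abs_eq_of_not_keep hσ hq h, inversion_eq_smul hz]
    congr 1
    ring

lemma foldDeriv_eq {ϱ σ : ℝ} (hσ : σ = 1 ∨ σ = -1) {z : ℂ} (hz : z ≠ 0)
    (hne : 1 - ϱ / ‖z‖ ^ 2 ≠ 0) :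
    foldDeriv ϱ σ z = radialScaleDeriv z ((1 + ϱ / ‖z‖ ^ 2 + σ * |1 - ϱ / ‖z‖ ^ 2|) / 2)
      ((-(ϱ / (‖z‖ ^ 2) ^ 2) + σ * ((1 - ϱ / ‖z‖ ^ 2) * (ϱ / (‖z‖ ^ 2) ^ 2) /
        |1 - ϱ / ‖z‖ ^ 2|)) / 2) := by
  have hq : 0 < ‖z‖ ^ 2 := by positivity
  have hσ2 : σ * σ = 1 := by rcases hσ with rfl | rfl <;> norm_num
  have habs : |1 - ϱ / ‖z‖ ^ 2| ≠ 0 := abs_ne_zero.2 hne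
  have hz' : conj z ≠ 0 := by simpa using hz
  have h2 : ((‖z‖ : ℂ)) ^ 2 = z * conj z := by
    rw [Complex.mul_conj, Complex.normSq_eq_norm_sq]; push_cast; rfl
  -- Here $s$ is $1$ on the kept half and $-1$ on the reflected half, so that the absolute value can
  -- be removed in both cases at once.
  have hs : ∀ s : ℝ, σ * |1 - ϱ / ‖z‖ ^ 2| = s * (1 - ϱ / ‖z‖ ^ 2) → s * s = 1 →
      σ * ((1 - ϱ / ‖z‖ ^ 2) * (ϱ / (‖z‖ ^ 2) ^ 2) / |1 - ϱ / ‖z‖ ^ 2|) =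
        s * (ϱ / (‖z‖ ^ 2) ^ 2) := by
    intro s hs hss
    have e : |1 - ϱ / ‖z‖ ^ 2| = σ * s * (1 - ϱ / ‖z‖ ^ 2) := by
      linear_combination σ * hs - |1 - ϱ / ‖z‖ ^ 2| * hσ2
    have e2 : σ * (1 - ϱ / ‖z‖ ^ 2) = s * |1 - ϱ / ‖z‖ ^ 2| := by
      rw [e]; linear_combination -σ * (1 - ϱ / ‖z‖ ^ 2) * hss
    rw [← mul_div_assoc, ← mul_assoc, e2, div_eq_iff habs]
    ring
  by_cases h : z ∈ foldKeep ϱ σ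
  · have hk := mul_abs_eq_of_keep hσ hq h
    rw [hs 1 (by rw [hk, one_mul]) (by norm_num), hk, foldDeriv, if_pos h]
    refine ContinuousLinearMap.ext fun v => ?_
    rw [radialScaleDeriv_apply]
    simp
  · have hk := mul_abs_eq_of_not_keep hσ hq h
    rw [hs (-1) (by rw [hk]; ring) (by norm_num), hk, foldDeriv, if_neg h]
    refine ContinuousLinearMap.ext fun v => ?_
    rw [radialScaleDeriv_apply, antiMul_apply]
    push_cast
    rw [h2]
    field_simp
    ring

/-- Uniform in $\delta\le1$: with $q=|z|^2\ge\varrho^2$ one has $\varrho/q\le1/\varrho$. -/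
lemma abs_foldFactor_le {ϱ σ δ q : ℝ} (hσ : σ = 1 ∨ σ = -1) (h0 : 0 < ϱ) (hδ0 : 0 ≤ δ)
    (hδ : δ ≤ 1) (hq : ϱ ^ 2 ≤ q) : |foldFactor ϱ σ δ q| ≤ 2 + 1 / ϱ := by
  have hq0 : 0 < q := lt_of_lt_of_le (by positivity) hq
  have hx : ϱ / q ≤ 1 / ϱ := by
    rw [div_le_div_iff₀ hq0 h0]; nlinarith
  have hx0 : 0 < ϱ / q := by positivity
  have hs : √((1 - ϱ / q) ^ 2 + δ ^ 2) ≤ 2 + ϱ / q := by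
    rw [Real.sqrt_le_left (by positivity)]
    nlinarith
  have hs0 := Real.sqrt_nonneg ((1 - ϱ / q) ^ 2 + δ ^ 2)
  unfold foldFactor
  rw [abs_le]
  rcases hσ with rfl | rfl <;> constructor <;> linarith

/-- Uniform in $\delta$ because $|x|\le\sqrt{x^2+\delta^2}$: the smoothed absolute value has slope
at most one. -/
lemma abs_foldFactorDeriv_le {ϱ σ δ q : ℝ} (hσ : σ = 1 ∨ σ = -1) (h0 : 0 < ϱ) (hδ0 : 0 < δ)
    (hq : ϱ ^ 2 ≤ q) : |foldFactorDeriv ϱ σ δ q| ≤ 1 / ϱ ^ 3 := by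
  have hq0 : 0 < q := lt_of_lt_of_le (by positivity) hq
  have hx : ϱ / q ^ 2 ≤ 1 / ϱ ^ 3 := by
    rw [div_le_div_iff₀ (by positivity) (by positivity)]
    have := pow_le_pow_left₀ (by positivity) hq 2
    nlinarith
  have hx0 : 0 < ϱ / q ^ 2 := by positivity
  have hs0 : 0 < √((1 - ϱ / q) ^ 2 + δ ^ 2) := Real.sqrt_pos.2 (by positivity)
  have hle : |1 - ϱ / q| ≤ √((1 - ϱ / q) ^ 2 + δ ^ 2) :=
    Real.abs_le_sqrt (by nlinarith)
  have h1 : |(1 - ϱ / q) * (ϱ / q ^ 2) / √((1 - ϱ / q) ^ 2 + δ ^ 2)| ≤ ϱ / q ^ 2 := by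
    rw [abs_div, abs_mul, abs_of_pos hs0, abs_of_pos hx0, div_le_iff₀ hs0]
    nlinarith
  have h2 := abs_le.1 h1
  unfold foldFactorDeriv
  rw [abs_le]
  rcases hσ with rfl | rfl <;> constructor <;> linarith [h2.1, h2.2]

/-- Both boundary circles go to the one that is kept, with the angle unchanged. The folded map
therefore has one and the same trace on both circles, and this is where equality of the two
prescribed degrees matters. -/
lemma fold_circleMap {ϱ σ : ℝ} (h0 : 0 < ϱ) (h1 : ϱ < 1) {r r' : ℝ} (hr : r ∈ ({ϱ, 1} : Set ℝ))
    (hσ : σ = 1 ∧ r' = 1 ∨ σ = -1 ∧ r' = ϱ) (θ : ℝ) :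
    fold ϱ σ (circleMap 0 r θ) = circleMap 0 r' θ := by
  have hinv : ∀ s : ℝ, inversion ϱ (circleMap 0 s θ) = circleMap 0 (ϱ / s) θ := by
    intro s
    simp only [inversion, circleMap_zero, map_mul, Complex.conj_ofReal, ← Complex.exp_conj,
      Complex.conj_I]
    rw [mul_neg, Complex.exp_neg]
    push_cast
    have := Complex.exp_ne_zero (θ * Complex.I)
    field_simp
  rw [fold, foldKeep]
  simp only [Set.mem_ofPred_eq, norm_circleMap_zero, hinv]
  rcases hr with rfl | hr
  · rcases hσ with ⟨rfl, rfl⟩ | ⟨rfl, rfl⟩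
    · rw [if_neg, div_self h0.ne']
      rw [abs_of_pos h0]; nlinarith
    · rw [if_pos]
      rw [abs_of_pos h0]; nlinarith
  · rw [Set.mem_singleton_iff] at hr
    subst hr
    rcases hσ with ⟨rfl, rfl⟩ | ⟨rfl, rfl⟩
    · rw [if_pos]
      rw [abs_one]; linarith
    · rw [if_neg, div_one]
      rw [abs_one]; linarith

lemma fold_mem_annulus {ϱ σ : ℝ} (h0 : 0 < ϱ) {z : ℂ} (hz : z ∈ annulus ϱ) :
    fold ϱ σ z ∈ annulus ϱ := by
  rw [fold]
  split_ifs
  · exact hz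
  · exact inversion_mem_annulus h0 hz

/-- The kept half contributes the constant $1$. On the reflected half the Jacobian $\varrho^2/|z|^4$
of the inversion is at least $\varrho^2$, whence $1/\varrho^2$. -/
lemma lintegral_fold_le {ϱ σ : ℝ} (h0 : 0 < ϱ) (F : ℂ → ℝ≥0∞) :
    ∫⁻ z in annulus ϱ, F (fold ϱ σ z) ≤
      (1 + ENNReal.ofReal (1 / ϱ ^ 2)) * ∫⁻ z in annulus ϱ, F z := by
  have hm := (isClosed_foldKeep ϱ σ).measurableSet
  have hmA := measurableSet_annulus ϱ
  rw [← lintegral_inter_add_sdiff (fun z => F (fold ϱ σ z)) (annulus ϱ) hm, add_mul, one_mul]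
  refine add_le_add ?_ ?_
  · rw [setLIntegral_congr_fun (g := F) (hmA.inter hm) fun z hz => by
      simp only [fold, if_pos hz.2]]
    exact lintegral_mono_set Set.inter_subset_left
  · have hd : ∀ z ∈ annulus ϱ \ foldKeep ϱ σ, HasFDerivWithinAt (inversion ϱ)
        (antiMul (-(ϱ / conj z ^ 2))) (annulus ϱ \ foldKeep ϱ σ) z := fun z hz =>
      (hasFDerivAt_inversion ϱ (annulus_ne_zero h0 hz.1)).hasFDerivWithinAt
    have hcv := lintegral_image_eq_lintegral_abs_det_fderiv_mul volume (hmA.diff hm) hd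
      (injOn_inversion h0 Set.sdiff_subset) F
    have hsub : inversion ϱ '' (annulus ϱ \ foldKeep ϱ σ) ⊆ annulus ϱ := by
      rintro _ ⟨z, hz, rfl⟩
      exact inversion_mem_annulus h0 hz.1
    calc ∫⁻ z in annulus ϱ \ foldKeep ϱ σ, F (fold ϱ σ z)
        ≤ ∫⁻ z in annulus ϱ \ foldKeep ϱ σ, ENNReal.ofReal (1 / ϱ ^ 2) *
          (ENNReal.ofReal |(antiMul (-(ϱ / conj z ^ 2))).det| * F (inversion ϱ z)) := by
          refine setLIntegral_mono' (hmA.diff hm) fun z hz => ?_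
          rw [fold, if_neg hz.2, ← mul_assoc, ← ENNReal.ofReal_mul (by positivity),
            abs_det_fderiv_inversion]
          refine le_mul_of_one_le_left zero_le ?_
          rw [ENNReal.one_le_ofReal]
          have hz0 : 0 < ‖z‖ := h0.trans hz.1.1
          have e : 1 / ϱ ^ 2 * ‖(ϱ : ℂ) / conj z ^ 2‖ ^ 2 = 1 / (‖z‖ ^ 2) ^ 2 := by
            simp only [norm_div, norm_pow, RCLike.norm_conj, Complex.norm_real, Real.norm_eq_abs,
              abs_of_pos h0, div_pow]
            field_simp
          rw [e, one_le_div (by positivity)]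
          exact pow_le_one₀ (by positivity) (pow_le_one₀ hz0.le hz.1.2.le)
      _ = ENNReal.ofReal (1 / ϱ ^ 2) * ∫⁻ z in inversion ϱ '' (annulus ϱ \ foldKeep ϱ σ), F z := by
          rw [lintegral_const_mul' _ _ ENNReal.ofReal_ne_top, hcv]
      _ ≤ _ := by
          gcongr

lemma radialScaleDeriv_eq (z : ℂ) (m m' : ℝ) : radialScaleDeriv z m m' =
    m • radialScaleDeriv z 1 0 + m' • radialScaleDeriv z 0 1 := by
  refine ContinuousLinearMap.ext fun v => ?_
  simp only [add_apply, smul_apply, radialScaleDeriv_apply, Complex.real_smul]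
  push_cast
  ring

lemma tendsto_radialScaleDeriv (z : ℂ) {a b : ℕ → ℝ} {A B : ℝ} (ha : Tendsto a atTop (𝓝 A))
    (hb : Tendsto b atTop (𝓝 B)) :
    Tendsto (fun k => radialScaleDeriv z (a k) (b k)) atTop (𝓝 (radialScaleDeriv z A B)) := by
  rw [radialScaleDeriv_eq z A B]
  refine Tendsto.congr (fun k => (radialScaleDeriv_eq z (a k) (b k)).symm) ?_
  exact (ha.smul_const _).add (hb.smul_const _)

lemma isAdmissible_fold {ϱ σ : ℝ} (h0 : 0 < ϱ) (h1 : ϱ < 1) (hσ : σ = 1 ∨ σ = -1) :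
    IsAdmissible ϱ (fold ϱ σ) (foldDeriv ϱ σ) where
  continuousOn := by
    have hc : ContinuousOn (fun z : ℂ => ((1 + ϱ / ‖z‖ ^ 2 + σ * |1 - ϱ / ‖z‖ ^ 2|) / 2) • z)
        (annulus ϱ) := by
      have : ContinuousOn (fun z : ℂ => ϱ / ‖z‖ ^ 2) (annulus ϱ) :=
        continuousOn_const.div (by fun_prop) fun z hz => by
          simpa using annulus_ne_zero h0 hz
      fun_prop
    exact hc.congr fun z hz => fold_eq_smul hσ (annulus_ne_zero h0 hz)
  mapsTo := fun z hz => fold_mem_annulus h0 hz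
  approx := by
    have hk0 : ∀ k : ℕ, (0 : ℝ) < 1 / (k + 1) := fun k => by positivity
    have hk1 : ∀ k : ℕ, (1 : ℝ) / (k + 1) ≤ 1 := fun k => by
      rw [div_le_one (by positivity)]; linarith [k.cast_nonneg (α := ℝ)]
    refine ⟨fun k => foldApprox ϱ σ (1 / (k + 1)), fun k => contDiffOn_foldApprox (hk0 k),
      -- The bound $2+1/\varrho$ is that of the factor $m$; the derivative of $m(|z|^2)z$ adds
      -- $2|z|^2|m'|\le2/\varrho^3$.
      ⟨2 + 1 / ϱ + 2 / ϱ ^ 3, fun k z hz1 hz2 => ⟨?_, ?_⟩⟩, fun z hz1 hz2 => ?_, ?_⟩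
    · have hf := abs_foldFactor_le hσ h0 (hk0 k).le (hk1 k) (pow_le_pow_left₀ h0.le hz1 2)
      change ‖foldFactor ϱ σ (1 / (k + 1)) (‖z‖ ^ 2) • z‖ ≤ _
      rw [norm_smul, Real.norm_eq_abs]
      have : 0 < 2 / ϱ ^ 3 := by positivity
      nlinarith [norm_nonneg z, abs_nonneg (foldFactor ϱ σ (1 / (k + 1)) (‖z‖ ^ 2))]
    · have hf := abs_foldFactor_le hσ h0 (hk0 k).le (hk1 k) (pow_le_pow_left₀ h0.le hz1 2)
      have hf' := abs_foldFactorDeriv_le hσ h0 (hk0 k) (pow_le_pow_left₀ h0.le hz1 2)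
      have hz0 : z ≠ 0 := norm_pos_iff.1 (h0.trans_le hz1)
      rw [(hasFDerivAt_foldApprox (hk0 k) hz0).fderiv]
      refine ContinuousLinearMap.opNorm_le_bound _ (by positivity) fun v => ?_
      rw [radialScaleDeriv_apply]
      generalize foldFactor ϱ σ (1 / (k + 1)) (‖z‖ ^ 2) = m at hf
      generalize foldFactorDeriv ϱ σ (1 / (k + 1)) (‖z‖ ^ 2) = m' at hf'
      have e1 : ‖z * conj v + conj z * v‖ ≤ 2 * ‖v‖ := by
        refine (norm_add_le _ _).trans ?_
        rw [norm_mul, norm_mul, RCLike.norm_conj, RCLike.norm_conj]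
        nlinarith [norm_nonneg v]
      calc ‖(m : ℂ) * v + m' * (z * conj v + conj z * v) * z‖
          ≤ ‖(m : ℂ) * v‖ + ‖m' * (z * conj v + conj z * v) * z‖ := norm_add_le _ _
        _ = |m| * ‖v‖ + |m'| * ‖z * conj v + conj z * v‖ * ‖z‖ := by
          rw [norm_mul, norm_mul, norm_mul, Complex.norm_real, Complex.norm_real,
            Real.norm_eq_abs, Real.norm_eq_abs]
        _ ≤ (2 + 1 / ϱ) * ‖v‖ + 1 / ϱ ^ 3 * (2 * ‖v‖) * 1 := by gcongr
        _ = _ := by ring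
    · have hz0 : z ≠ 0 := norm_pos_iff.1 (h0.trans_le hz1)
      rw [fold_eq_smul hσ hz0]
      exact (tendsto_foldFactor _).smul_const z
    -- The derivatives may fail to converge to that of the fold only on the middle circle, a null
    -- set.
    · have hae : ∀ᵐ z : ℂ, ‖z‖ ^ 2 ≠ ϱ := by
        have : (volume : Measure ℂ) (Metric.sphere 0 (√ϱ)) = 0 := Measure.addHaar_sphere _ _ _
        rw [ae_iff]
        refine measure_mono_null (fun z hz => ?_) this
        simp only [ne_eq, not_not, Set.mem_ofPred_eq] at hz
        rw [mem_sphere_zero_iff_norm, ← hz, Real.sqrt_sq (norm_nonneg _)]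
      filter_upwards [ae_restrict_of_ae hae, ae_restrict_mem (measurableSet_annulus ϱ)] with z hz hzA
      have hz0 := annulus_ne_zero h0 hzA
      have hne : 1 - ϱ / ‖z‖ ^ 2 ≠ 0 := by
        have : ‖z‖ ^ 2 ≠ 0 := by simpa using hz0
        rw [sub_ne_zero, ne_comm, ne_eq, div_eq_one_iff_eq this]
        exact fun h => hz h.symm
      rw [foldDeriv_eq hσ hz0 hne]
      have e : ∀ k : ℕ, fderiv ℝ (foldApprox ϱ σ (1 / (k + 1))) z = radialScaleDeriv z
          (foldFactor ϱ σ (1 / (k + 1)) (‖z‖ ^ 2)) (foldFactorDeriv ϱ σ (1 / (k + 1)) (‖z‖ ^ 2)) :=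
        fun k => (hasFDerivAt_foldApprox (hk0 k) hz0).fderiv
      refine Tendsto.congr (fun k => (e k).symm) ?_
      exact tendsto_radialScaleDeriv z (tendsto_foldFactor _) (tendsto_foldFactorDeriv hne)
  lintegral_le := ⟨1 + ENNReal.ofReal (1 / ϱ ^ 2), by finiteness, lintegral_fold_le h0⟩
  circle_le := fun r hr => by
    rcases hσ with rfl | rfl
    · refine ⟨1, by simp, 1, by finiteness, fun F => ?_⟩
      simp_rw [fold_circleMap h0 h1 hr (Or.inl ⟨rfl, rfl⟩)]
      simp
    · refine ⟨ϱ, by simp, 1, by finiteness, fun F => ?_⟩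
      simp_rw [fold_circleMap h0 h1 hr (Or.inr ⟨rfl, rfl⟩)]
      simp

/-! ### Reflection symmetry of minimizers -/

lemma inversion_mem_of_notMem_foldKeep {ϱ σ : ℝ} (h0 : 0 < ϱ) {z : ℂ}
    (hz : z ∈ annulus ϱ \ foldKeep ϱ σ) : inversion ϱ z ∈ annulus ϱ \ foldKeep ϱ (-σ) := by
  refine ⟨inversion_mem_annulus h0 hz.1, fun h => hz.2 ?_⟩
  have hz0 : 0 < ‖z‖ := h0.trans hz.1.1
  simp only [foldKeep, Set.mem_ofPred_eq, norm_inversion h0] at h ⊢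
  have e : -σ * ((ϱ / ‖z‖) ^ 2 - ϱ) = (ϱ / ‖z‖ ^ 2) * (σ * (‖z‖ ^ 2 - ϱ)) := by
    field_simp
    ring
  rw [e] at h
  exact nonneg_of_mul_nonneg_right h (by positivity)

lemma image_inversion_diff {ϱ σ : ℝ} (h0 : 0 < ϱ) :
    inversion ϱ '' (annulus ϱ \ foldKeep ϱ σ) = annulus ϱ \ foldKeep ϱ (-σ) := by
  refine Set.Subset.antisymm ?_ fun w hw => ?_
  · rintro _ ⟨z, hz, rfl⟩
    exact inversion_mem_of_notMem_foldKeep h0 hz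
  · have := inversion_mem_of_notMem_foldKeep h0 hw
    rw [neg_neg] at this
    exact ⟨_, this, inversion_inversion h0 (annulus_ne_zero h0 hw.1)⟩

/-- Twice the Dirichlet energy density of a differentiable map. -/
def gradSq (U : ℂ → ℂ) (z : ℂ) : ℝ := ‖fderiv ℝ U z 1‖ ^ 2 + ‖fderiv ℝ U z Complex.I‖ ^ 2

/-- An anticonformal change of variables multiplies the energy density by its Jacobian, the source
of the conformal invariance of the Dirichlet energy. -/
lemma norm_sq_comp_antiMul (L : ℂ →L[ℝ] ℂ) (β : ℂ) :
    ‖L (antiMul β 1)‖ ^ 2 + ‖L (antiMul β Complex.I)‖ ^ 2 =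
      ‖β‖ ^ 2 * (‖L 1‖ ^ 2 + ‖L Complex.I‖ ^ 2) := by
  have h := norm_sq_add_norm_sq_eq_wirt (L.comp (antiMul β))
  rw [(wirt_comp L _).1, (wirt_comp L _).2, (wirt_antiMul β).1, (wirt_antiMul β).2] at h
  rw [norm_sq_add_norm_sq_eq_wirt L]
  simp only [ContinuousLinearMap.comp_apply] at h
  rw [h]
  simp [mul_pow]
  ring

/-- By conformal invariance the reflected half carries the same energy as the kept half. Up to the
middle circle both integrals are over the kept half; the second omits that circle, which makes the
sum over $\sigma=\pm1$ come out exactly. -/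
lemma integral_fold_energy {ϱ σ : ℝ} (h0 : 0 < ϱ) {U : ℂ → ℂ} {v : H1Annulus ϱ}
    (hx : v.dx = fun z => fderiv ℝ U (fold ϱ σ z) (foldDeriv ϱ σ z 1))
    (hy : v.dy = fun z => fderiv ℝ U (fold ϱ σ z) (foldDeriv ϱ σ z Complex.I)) :
    2 * energy v = (∫ z in annulus ϱ ∩ foldKeep ϱ σ, gradSq U z) +
      ∫ z in annulus ϱ \ foldKeep ϱ (-σ), gradSq U z := by
  have hm := (isClosed_foldKeep ϱ σ).measurableSet
  have hmA := measurableSet_annulus ϱ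
  have hd : ∀ z ∈ annulus ϱ \ foldKeep ϱ σ, HasFDerivWithinAt (inversion ϱ)
      (antiMul (-(ϱ / conj z ^ 2))) (annulus ϱ \ foldKeep ϱ σ) z := fun z hz =>
    (hasFDerivAt_inversion ϱ (annulus_ne_zero h0 hz.1)).hasFDerivWithinAt
  rw [← image_inversion_diff h0, integral_image_eq_integral_abs_det_fderiv_smul volume
    (hmA.diff hm) hd (injOn_inversion h0 Set.sdiff_subset), energy, ← mul_assoc]
  norm_num only [one_mul]
  rw [← integral_inter_add_sdiff hm (integrable_energy_density v)]
  congr 1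
  · refine setIntegral_congr_fun (hmA.inter hm) fun z hz => ?_
    simp only [hx, hy, fold, foldDeriv, if_pos hz.2, gradSq]
    rfl
  · refine setIntegral_congr_fun (hmA.diff hm) fun z hz => ?_
    simp only [hx, hy, fold, foldDeriv, if_neg hz.2, gradSq]
    rw [norm_sq_comp_antiMul, abs_det_fderiv_inversion, norm_neg, smul_eq_mul]

/-- The fold of a map of the class `𝓘_{p,p}`. -/
lemma exists_classI_fold {ϱ σ : ℝ} (h0 : 0 < ϱ) (h1 : ϱ < 1) (hσ : σ = 1 ∨ σ = -1) {p : ℤ}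
    {u : H1Annulus ϱ} (hu : u ∈ classI ϱ p p) {U : ℂ → ℂ} (hU : ContDiffOn ℝ 1 U (annulus ϱ))
    (hu0 : u.toFun = U) (hux : u.dx = fun z => fderiv ℝ U z 1)
    (huy : u.dy = fun z => fderiv ℝ U z Complex.I) :
    ∃ v ∈ classI ϱ p p, v.toFun = (fun z => U (fold ϱ σ z)) ∧
      v.dx = (fun z => fderiv ℝ U (fold ϱ σ z) (foldDeriv ϱ σ z 1)) ∧
      v.dy = (fun z => fderiv ℝ U (fold ϱ σ z) (foldDeriv ϱ σ z Complex.I)) := by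
  obtain ⟨g, hg, hg1, hd1, hdϱ⟩ := hu
  obtain ⟨r', hr', hσr⟩ : ∃ r' ∈ ({ϱ, 1} : Set ℝ), σ = 1 ∧ r' = 1 ∨ σ = -1 ∧ r' = ϱ := by
    rcases hσ with rfl | rfl
    · exact ⟨1, by simp, Or.inl ⟨rfl, rfl⟩⟩
    · exact ⟨ϱ, by simp, Or.inr ⟨rfl, rfl⟩⟩
  have hcirc : ∀ r ∈ ({ϱ, 1} : Set ℝ), onCircle (fun z => g (fold ϱ σ z)) r = onCircle g r' :=
    fun r hr => funext fun θ => by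
      simp only [onCircle, fold_circleMap h0 h1 hr hσr]
  have hdeg : HasDegree (onCircle g r') p := by
    rcases hr' with rfl | h
    · exact hdϱ
    · rw [Set.mem_singleton_iff] at h
      rw [h]; exact hd1
  obtain ⟨v, hv0, hvx, hvy, hvt⟩ := (isAdmissible_fold h0 h1 hσ).exists_comp h0 h1 hU hu0 hux huy
    hg (fun r hr => by rw [hcirc r hr]; exact hg.1 r' hr')
  refine ⟨v, ⟨_, hvt, fun r hr => ?_, ?_, ?_⟩, hv0, hvx, hvy⟩
  · rw [hcirc r hr]; exact hg1 r' hr'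
  · rw [hcirc 1 (by simp)]; exact hdeg
  · rw [hcirc ϱ (by simp)]; exact hdeg

lemma IsMinimizer.inversion_invariant {ϱ : ℝ} (h0 : 0 < ϱ) (h1 : ϱ < 1) {p : ℤ}
    {u : H1Annulus ϱ} (hu : IsMinimizer u p p) {U : ℂ → ℂ} (hU : HarmonicOnNhd U (annulus ϱ))
    (hu0 : u.toFun = U) (hux : u.dx = fun z => fderiv ℝ U z 1)
    (huy : u.dy = fun z => fderiv ℝ U z Complex.I) {z : ℂ} (hz : z ∈ annulus ϱ) :
    U (inversion ϱ z) = U z := by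
  have hU1 : ContDiffOn ℝ 1 U (annulus ϱ) := (contDiffOn_of_harmonic hU).of_le (by norm_cast)
  obtain ⟨v, hv, hv0, hvx, hvy⟩ := exists_classI_fold h0 h1 (Or.inl rfl) hu.1 hU1 hu0 hux huy
  obtain ⟨w, hw, hw0, hwx, hwy⟩ := exists_classI_fold h0 h1 (Or.inr rfl) hu.1 hU1 hu0 hux huy
  have hint : IntegrableOn (gradSq U) (annulus ϱ) := by
    have h := integrable_energy_density u
    rw [hux, huy] at h
    exact h
  have hEu : 2 * energy u = ∫ z in annulus ϱ, gradSq U z := by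
    rw [energy, ← mul_assoc]
    norm_num only [one_mul]
    simp only [hux, huy, gradSq]
  have hEv := integral_fold_energy h0 hvx hvy
  have hEw := integral_fold_energy h0 hwx hwy
  rw [neg_neg] at hEw
  have e1 := integral_inter_add_sdiff (isClosed_foldKeep ϱ 1).measurableSet hint
  have e2 := integral_inter_add_sdiff (isClosed_foldKeep ϱ (-1)).measurableSet hint
  -- The two folds satisfy $E(v)+E(w)=2E(u)$ and neither is below $E(u)$.
  have hvE : energy v = energy u := le_antisymm (by linarith [hu.2 w hw]) (hu.2 v hv)
  have hvmin : IsMinimizer v p p := ⟨hv, fun w hw => hvE ▸ hu.2 w hw⟩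
  -- The outer fold is a minimizer, so it too is harmonic, even across the middle circle.
  obtain ⟨V, hV, hae⟩ := hvmin.exists_harmonic h0
  rw [hv0] at hae
  have hcV : ContinuousOn V (annulus ϱ) := hV.continuousOn
  have hcT : ContinuousOn (fun z => U (fold ϱ 1 z)) (annulus ϱ) :=
    hU.continuousOn.comp (isAdmissible_fold h0 h1 (Or.inl rfl)).continuousOn
      fun z hz => fold_mem_annulus h0 hz
  have hVT : Set.EqOn (fun z => U (fold ϱ 1 z)) V (annulus ϱ) :=
    Measure.eqOn_open_of_ae_eq hae (isOpen_annulus ϱ) hcT hcV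
  have hkeep : ∀ z : ℂ, z ∈ foldKeep ϱ 1 ↔ ϱ ≤ ‖z‖ ^ 2 := fun z => by
    simp [foldKeep]
  have hpt : ((1 + √ϱ) / 2 : ℝ) < 1 ∧ √ϱ < (1 + √ϱ) / 2 := by
    have : √ϱ < 1 := by rw [Real.sqrt_lt' one_pos]; simpa using h1
    constructor <;> linarith
  have hs0 : 0 < √ϱ := Real.sqrt_pos.2 h0
  have hss : √ϱ ^ 2 = ϱ := Real.sq_sqrt h0.le
  -- A point strictly inside the outer half, from which unique continuation starts.
  set x : ℂ := (((1 + √ϱ) / 2 : ℝ) : ℂ) with hx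
  have hxn : ‖x‖ = (1 + √ϱ) / 2 := by
    rw [hx, Complex.norm_real, Real.norm_eq_abs, abs_of_pos (by positivity)]
  have hxA : x ∈ annulus ϱ := by
    refine ⟨?_, ?_⟩
    · rw [hxn]; nlinarith
    · rw [hxn]; exact hpt.1
  have hxk : ϱ < ‖x‖ ^ 2 := by rw [hxn]; nlinarith
  have hUV : U =ᶠ[𝓝 x] V := by
    have ho : IsOpen {z : ℂ | ϱ < ‖z‖ ^ 2} := isOpen_lt continuous_const (by fun_prop)
    filter_upwards [ho.mem_nhds hxk, (isOpen_annulus ϱ).mem_nhds hxA] with z hz hzA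
    have := hVT hzA
    beta_reduce at this
    rwa [show fold ϱ 1 z = z by rw [fold, if_pos ((hkeep z).2 (le_of_lt hz))]] at this
  have hall : Set.EqOn U V (annulus ϱ) := eqOn_annulus_of_eventuallyEq h0 hU hV hxA hUV
  have hinner : ∀ z ∈ annulus ϱ, ‖z‖ ^ 2 < ϱ → U (inversion ϱ z) = U z := by
    intro z hz hlt
    have := hVT hz
    simp only [fold, if_neg (fun h => not_le.2 hlt ((hkeep z).1 h))] at this
    rw [this, hall hz]
  have hz0 : 0 < ‖z‖ := h0.trans hz.1
  -- The invariance is known in the inner half; the outer half follows since the inversion is an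
  -- involution.
  rcases lt_trichotomy (‖z‖ ^ 2) ϱ with h | h | h
  · exact hinner z hz h
  · rw [inversion_eq_self (annulus_ne_zero h0 hz) h]
  · have := hinner _ (inversion_mem_annulus h0 hz) (by
      rw [norm_inversion h0, div_pow, div_lt_iff₀ (by positivity)]
      nlinarith)
    rw [inversion_inversion h0 (annulus_ne_zero h0 hz)] at this
    exact this.symm

/-- The inversion fixes the middle circle pointwise and its derivative there reverses the radial
direction, so the chain rule gives $\partial_rU=-\partial_rU$. -/
lemma radialDeriv_eq_zero_of_inversion_invariant {ϱ : ℝ} (h0 : 0 < ϱ) (h1 : ϱ < 1) {U : ℂ → ℂ}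
    (hU : DifferentiableOn ℝ U (annulus ϱ))
    (hinv : ∀ z ∈ annulus ϱ, U (inversion ϱ z) = U z) {z : ℂ} (hz : ‖z‖ = √ϱ) :
    radialDeriv U z = 0 := by
  have hs0 : 0 < √ϱ := Real.sqrt_pos.2 h0
  have hss : √ϱ ^ 2 = ϱ := Real.sq_sqrt h0.le
  have hs1 : √ϱ < 1 := by rw [Real.sqrt_lt' one_pos]; simpa using h1
  have hzA : z ∈ annulus ϱ := ⟨by rw [hz]; nlinarith, by rw [hz]; exact hs1⟩
  have hz0 : z ≠ 0 := annulus_ne_zero h0 hzA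
  have hn := (isOpen_annulus ϱ).mem_nhds hzA
  have hself : inversion ϱ z = z := inversion_eq_self hz0 (by rw [hz, hss])
  have hd : HasFDerivAt U (fderiv ℝ U z) (inversion ϱ z) := by
    rw [hself]; exact (hU.differentiableAt hn).hasFDerivAt
  have h2 := hd.comp z (hasFDerivAt_inversion ϱ hz0)
  have h3 : U ∘ inversion ϱ =ᶠ[𝓝 z] U := by
    filter_upwards [hn] with w hw using hinv w hw
  have h4 := h3.fderiv_eq (𝕜 := ℝ)
  rw [h2.fderiv] at h4
  have h5 := DFunLike.congr_fun h4 (z / (‖z‖ : ℂ))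
  rw [ContinuousLinearMap.comp_apply, antiMul_apply] at h5
  have hc : conj z ≠ 0 := by simpa using hz0
  have hϱ : (ϱ : ℂ) = z * conj z := by
    rw [Complex.mul_conj, Complex.normSq_eq_norm_sq, hz, hss]
  have h6 : -((ϱ : ℂ) / conj z ^ 2) * conj (z / (‖z‖ : ℂ)) = -(z / (‖z‖ : ℂ)) := by
    have : (‖z‖ : ℂ) ≠ 0 := by exact_mod_cast (norm_pos_iff.2 hz0).ne'
    rw [map_div₀, Complex.conj_ofReal, hϱ]
    field_simp
  rw [h6, map_neg] at h5
  exact CharZero.eq_neg_self_iff.1 h5.symm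

/-! ### Reparametrizations of the circle -/

lemma setLIntegral_Ioc_of_periodic {G : ℝ → ℝ≥0∞} (hG : Function.Periodic G (2 * Real.pi))
    (a b : ℝ) :
    ∫⁻ θ in Set.Ioc a (a + 2 * Real.pi), G θ = ∫⁻ θ in Set.Ioc b (b + 2 * Real.pi), G θ := by
  have : VAddInvariantMeasure (AddSubgroup.zmultiples (2 * Real.pi)) ℝ volume :=
    ⟨fun c s _ => measure_preimage_add _ _ _⟩
  refine (isAddFundamentalDomain_Ioc Real.two_pi_pos a).setLIntegral_eq
    (isAddFundamentalDomain_Ioc Real.two_pi_pos b) G fun g x => ?_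
  obtain ⟨g, k, rfl⟩ := g
  have := hG.zsmul k x
  simpa [AddSubgroup.vadd_def, add_comm] using this

/-- A smooth reparametrization of the circle, written in the angle. -/
structure IsCircleShift (τ : ℝ → ℝ) : Prop where
  contDiff : ContDiff ℝ ∞ τ
  add_two_pi : ∀ θ, τ (θ + 2 * Real.pi) = τ θ + 2 * Real.pi
  half_le_deriv : ∀ θ, 1 / 2 ≤ deriv τ θ
  norm_le : ∀ s t, ‖circleMap 0 1 (τ s) - circleMap 0 1 (τ t)‖ ≤
    2 * ‖circleMap 0 1 s - circleMap 0 1 t‖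

namespace IsCircleShift

variable {τ : ℝ → ℝ}

lemma hasDerivAt (hτ : IsCircleShift τ) (θ : ℝ) : HasDerivAt τ (deriv τ θ) θ :=
  (hτ.contDiff.differentiable (by simp) θ).hasDerivAt

lemma strictMono (hτ : IsCircleShift τ) : StrictMono τ :=
  strictMono_of_deriv_pos fun θ => by linarith [hτ.half_le_deriv θ]

/-- Change of variables: the derivative is at least $1/2$, whence the constant $2$, and the image of
one period is contained in one period. -/
lemma lintegral_comp_le (hτ : IsCircleShift τ) {G : ℝ → ℝ≥0∞}
    (hG : Function.Periodic G (2 * Real.pi)) :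
    ∫⁻ θ, G (τ θ) ∂angleMeasure ≤ 2 * ∫⁻ θ, G θ ∂angleMeasure := by
  unfold angleMeasure
  calc ∫⁻ θ in Set.Ioc 0 (2 * Real.pi), G (τ θ)
      ≤ ∫⁻ θ in Set.Ioc 0 (2 * Real.pi), 2 * (ENNReal.ofReal |deriv τ θ| * G (τ θ)) := by
        refine lintegral_mono fun θ => ?_
        rw [← mul_assoc]
        refine le_mul_of_one_le_left zero_le ?_
        rw [← ENNReal.ofReal_ofNat 2, ← ENNReal.ofReal_mul zero_le_two, ENNReal.one_le_ofReal]
        linarith [le_abs_self (deriv τ θ), hτ.half_le_deriv θ]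
    _ = 2 * ∫⁻ θ in τ '' Set.Ioc 0 (2 * Real.pi), G θ := by
        rw [lintegral_const_mul' _ _ (by finiteness),
          lintegral_image_eq_lintegral_abs_deriv_mul measurableSet_Ioc
            (fun θ _ => (hτ.hasDerivAt θ).hasDerivWithinAt) hτ.strictMono.injective.injOn]
    _ ≤ 2 * ∫⁻ θ in Set.Ioc (τ 0) (τ 0 + 2 * Real.pi), G θ := by
        gcongr
        rintro _ ⟨θ, hθ, rfl⟩
        refine ⟨hτ.strictMono hθ.1, ?_⟩
        have := hτ.strictMono.monotone hθ.2
        rwa [← zero_add (2 * Real.pi), hτ.add_two_pi] at this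
    _ = 2 * ∫⁻ θ in Set.Ioc 0 (2 * Real.pi), G θ := by
        rw [setLIntegral_Ioc_of_periodic hG (τ 0) 0, zero_add]

/-- Lets almost-everywhere statements and measurability pass through the shift. The reduction modulo
$2\pi$ is needed because `angleMeasure` lives on one period only. -/
lemma quasiMeasurePreserving (hτ : IsCircleShift τ) :
    Measure.QuasiMeasurePreserving (fun θ => toIocMod Real.two_pi_pos 0 (τ θ))
      angleMeasure angleMeasure := by
  have hρ : Measurable (toIocMod Real.two_pi_pos (0 : ℝ)) := by
    have : toIocMod Real.two_pi_pos (0 : ℝ) = fun b : ℝ =>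
        b + (⌊(0 + 2 * Real.pi - b) / (2 * Real.pi)⌋ : ℝ) * (2 * Real.pi) := by
      funext b
      rw [toIocMod, toIocDiv_eq_neg_floor, zsmul_eq_mul]
      push_cast
      ring
    rw [this]
    fun_prop
  refine ⟨hρ.comp hτ.contDiff.continuous.measurable, ?_⟩
  refine Measure.AbsolutelyContinuous.mk fun s hs h0 => ?_
  change Measure.map (toIocMod Real.two_pi_pos 0 ∘ τ) angleMeasure s = 0
  rw [Measure.map_apply (hρ.comp hτ.contDiff.continuous.measurable) hs,
    ← lintegral_indicator_one (hρ.comp hτ.contDiff.continuous.measurable hs)]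
  have h := hτ.lintegral_comp_le
    (G := fun θ => s.indicator 1 (toIocMod Real.two_pi_pos 0 θ)) fun θ => by
      simp only [toIocMod_periodic Real.two_pi_pos (0 : ℝ) θ]
  have h1 : ∫⁻ θ, s.indicator 1 (toIocMod Real.two_pi_pos 0 θ) ∂angleMeasure = 0 := by
    have h2 : ∫⁻ θ, s.indicator 1 (toIocMod Real.two_pi_pos 0 θ) ∂angleMeasure =
        ∫⁻ θ, s.indicator 1 θ ∂angleMeasure := by
      refine setLIntegral_congr_fun measurableSet_Ioc fun θ hθ => ?_
      have : toIocMod Real.two_pi_pos 0 θ = θ :=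
        (toIocMod_eq_self Real.two_pi_pos).2 (by simpa using hθ)
      simp only [this]
    rw [h2, lintegral_indicator_one hs, h0]
  rw [h1, mul_zero] at h
  exact le_antisymm h zero_le

lemma comp_eq (G : ℝ → ℂ) (hG : Function.Periodic G (2 * Real.pi)) (θ : ℝ) :
    G (toIocMod Real.two_pi_pos 0 (τ θ)) = G (τ θ) := by
  rw [toIocMod]
  exact hG.sub_zsmul_eq _

lemma aestronglyMeasurable_comp (hτ : IsCircleShift τ) {G : ℝ → ℂ}
    (hG : Function.Periodic G (2 * Real.pi)) (hm : AEStronglyMeasurable G angleMeasure) :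
    AEStronglyMeasurable (fun θ => G (τ θ)) angleMeasure :=
  (hm.comp_quasiMeasurePreserving hτ.quasiMeasurePreserving).congr
    (Eventually.of_forall fun θ => comp_eq G hG θ)

lemma ae_norm_comp (hτ : IsCircleShift τ) {G : ℝ → ℂ}
    (hG : Function.Periodic G (2 * Real.pi)) (hm : ∀ᵐ θ ∂angleMeasure, ‖G θ‖ = 1) :
    ∀ᵐ θ ∂angleMeasure, ‖G (τ θ)‖ = 1 := by
  filter_upwards [hτ.quasiMeasurePreserving.ae hm] with θ hθ
  rwa [comp_eq G hG θ] at hθ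

/-- The constant is $16=4\cdot2\cdot2$: chords are stretched by at most $2$, which is squared, and
each of the two variables is changed once. -/
lemma hHalfNormSq_comp_le (hτ : IsCircleShift τ) {w : ℝ → ℂ}
    (hw : Function.Periodic w (2 * Real.pi)) :
    hHalfNormSq (fun θ => w (τ θ)) ≤ 16 * hHalfNormSq w := by
  unfold hHalfNormSq
  rw [mul_add]
  refine add_le_add ?_ ?_
  · refine (hτ.lintegral_comp_le (G := fun θ => ‖w θ‖ₑ ^ 2) fun θ => by simp only [hw θ]).trans ?_
    gcongr
    norm_num
  · let G : ℝ → ℝ → ℝ≥0∞ := fun s t =>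
      (‖w s - w t‖ₑ / ‖circleMap 0 1 s - circleMap 0 1 t‖ₑ) ^ 2
    have hc := periodic_circleMap (0 : ℂ) 1
    have hG1 : ∀ s, Function.Periodic (G s) (2 * Real.pi) := fun s t => by
      simp only [G, hw t, hc t]
    have hG2 : ∀ t s, G (s + 2 * Real.pi) t = G s t := fun t s => by
      simp only [G, hw s, hc s]
    have hpt : ∀ s t, (‖w (τ s) - w (τ t)‖ₑ / ‖circleMap 0 1 s - circleMap 0 1 t‖ₑ) ^ 2 ≤
        4 * G (τ s) (τ t) := by
      intro s t
      have h1 : ‖circleMap 0 1 (τ s) - circleMap 0 1 (τ t)‖ₑ ≤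
          2 * ‖circleMap 0 1 s - circleMap 0 1 t‖ₑ := by
        rw [← ofReal_norm, ← ofReal_norm, ← ENNReal.ofReal_ofNat 2, ← ENNReal.ofReal_mul zero_le_two]
        exact ENNReal.ofReal_le_ofReal (hτ.norm_le s t)
      have h2 : ‖w (τ s) - w (τ t)‖ₑ / ‖circleMap 0 1 s - circleMap 0 1 t‖ₑ ≤
          2 * (‖w (τ s) - w (τ t)‖ₑ / ‖circleMap 0 1 (τ s) - circleMap 0 1 (τ t)‖ₑ) := by
        calc _ = 2 * ‖w (τ s) - w (τ t)‖ₑ / (2 * ‖circleMap 0 1 s - circleMap 0 1 t‖ₑ) := by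
              rw [ENNReal.mul_div_mul_left _ _ (by norm_num) (by norm_num)]
          _ ≤ 2 * ‖w (τ s) - w (τ t)‖ₑ / ‖circleMap 0 1 (τ s) - circleMap 0 1 (τ t)‖ₑ :=
              ENNReal.div_le_div_left h1 _
          _ = _ := by rw [mul_div_assoc]
      calc _ ≤ (2 * (‖w (τ s) - w (τ t)‖ₑ / ‖circleMap 0 1 (τ s) - circleMap 0 1 (τ t)‖ₑ)) ^ 2 := by
            gcongr
        _ = _ := by rw [mul_pow]; norm_num [G]
    calc _ ≤ ∫⁻ s, ∫⁻ t, 4 * G (τ s) (τ t) ∂angleMeasure ∂angleMeasure :=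
          lintegral_mono fun s => lintegral_mono fun t => hpt s t
      _ ≤ ∫⁻ s, 8 * ∫⁻ t, G (τ s) t ∂angleMeasure ∂angleMeasure := by
          refine lintegral_mono fun s => ?_
          rw [lintegral_const_mul' _ _ (by finiteness), show (8 : ℝ≥0∞) = 4 * 2 by norm_num,
            mul_assoc]
          gcongr
          exact hτ.lintegral_comp_le (hG1 (τ s))
      _ ≤ 16 * ∫⁻ s, ∫⁻ t, G s t ∂angleMeasure ∂angleMeasure := by
          rw [lintegral_const_mul' _ _ (by finiteness), show (16 : ℝ≥0∞) = 8 * 2 by norm_num,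
            mul_assoc]
          gcongr
          exact hτ.lintegral_comp_le (G := fun s => ∫⁻ t, G s t ∂angleMeasure)
            fun s => by simp only [hG2 _ s]

lemma isSmoothCircleMap_comp (hτ : IsCircleShift τ) {f : ℝ → ℂ} (hf : IsSmoothCircleMap f) :
    IsSmoothCircleMap (fun θ => f (τ θ)) :=
  ⟨hf.1.comp hτ.contDiff, fun θ => by simp only [hτ.add_two_pi, hf.2.1 (τ θ)], fun θ => hf.2.2 _⟩

lemma smoothDegree_comp (hτ : IsCircleShift τ) {f : ℝ → ℂ} (hf : IsSmoothCircleMap f) :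
    smoothDegree (fun θ => f (τ θ)) = smoothDegree f := by
  unfold smoothDegree
  congr 1
  have hfd : Differentiable ℝ f := hf.1.differentiable (by simp)
  have hcd : Continuous (deriv f) := hf.1.continuous_deriv (by simp)
  have hcw : Continuous (fun θ => wedge (f θ) (deriv f θ)) := by
    have := hf.1.continuous
    unfold wedge
    fun_prop
  have hd : ∀ θ, wedge (f (τ θ)) (deriv (fun θ => f (τ θ)) θ) =
      wedge (f (τ θ)) (deriv f (τ θ)) * deriv τ θ := fun θ => by
    have := (hfd (τ θ)).hasDerivAt.scomp θ (hτ.hasDerivAt θ)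
    rw [show deriv (fun θ => f (τ θ)) θ = deriv τ θ • deriv f (τ θ) from this.deriv]
    simp [wedge]
    ring
  simp_rw [hd]
  have := intervalIntegral.integral_comp_mul_deriv (a := 0) (b := 2 * Real.pi)
    (fun θ _ => hτ.hasDerivAt θ) (hτ.contDiff.continuous_deriv (by simp)).continuousOn hcw
  simp only [Function.comp_apply] at this
  rw [this]
  have hper : Function.Periodic (fun θ => wedge (f θ) (deriv f θ)) (2 * Real.pi) := by
    intro θ
    have hdp : deriv f (θ + 2 * Real.pi) = deriv f θ := by
      have h1 : (fun x => f (x + 2 * Real.pi)) = f := funext hf.2.1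
      rw [← deriv_comp_add_const, h1]
    simp only [hf.2.1 θ, hdp]
  have e : τ (2 * Real.pi) = τ 0 + 2 * Real.pi := by
    have := hτ.add_two_pi 0
    rwa [zero_add] at this
  rw [e, hper.intervalIntegral_add_eq (τ 0) 0, zero_add]

lemma hasDegree_comp (hτ : IsCircleShift τ) {g : ℝ → ℂ} (hg : Function.Periodic g (2 * Real.pi))
    {d : ℤ} (h : HasDegree g d) : HasDegree (fun θ => g (τ θ)) d := by
  obtain ⟨f, hf, ht⟩ := h
  refine ⟨fun n θ => f n (τ θ), fun n => ⟨hτ.isSmoothCircleMap_comp (hf n).1, ?_⟩, ?_⟩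
  · rw [hτ.smoothDegree_comp (hf n).1, (hf n).2]
  · have h16 := ENNReal.Tendsto.const_mul (a := 16) ht (Or.inr (by finiteness))
    rw [mul_zero] at h16
    refine tendsto_of_tendsto_of_tendsto_of_le_of_le tendsto_const_nhds h16 (fun _ => zero_le)
      fun n => ?_
    exact hτ.hHalfNormSq_comp_le (w := fun θ => f n θ - g θ) fun θ => by
      simp only [(hf n).1.2.1 θ, hg θ]

end IsCircleShift

/-! ### Twisting the annulus -/

/-- The angle by which `twist α n` rotates the point `z`. -/
def twistAngle (α : ℂ) (n : ℤ) (z : ℂ) : ℝ := (α * z ^ n).re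

/-- The map that rotates each point `z` by the angle `Re (α zⁿ)`. -/
def twist (α : ℂ) (n : ℤ) (z : ℂ) : ℂ := z * Complex.exp (twistAngle α n z * Complex.I)

/-- The amplitude `α` is small enough for `twist α n` to be a diffeomorphism of the annulus,
with `δ` controlling the size of its derivative. -/
def IsTwistBound (ϱ : ℝ) (α : ℂ) (n : ℤ) (δ : ℝ) : Prop :=
  ∀ z : ℂ, ϱ ≤ ‖z‖ → ‖z‖ ≤ 1 → |(n : ℝ)| * ‖α * z ^ n‖ ≤ δ

@[simp] lemma norm_twist (α : ℂ) (n : ℤ) (z : ℂ) : ‖twist α n z‖ = ‖z‖ := by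
  rw [twist, norm_mul, Complex.norm_exp_ofReal_mul_I, mul_one]

lemma twist_mem_annulus {ϱ : ℝ} {α : ℂ} {n : ℤ} {z : ℂ} (hz : z ∈ annulus ϱ) :
    twist α n z ∈ annulus ϱ := by
  simpa [annulus] using hz

lemma twist_circleMap (α : ℂ) (n : ℤ) (r θ : ℝ) : twist α n (circleMap 0 r θ) =
    circleMap 0 r (θ + twistAngle α n (circleMap 0 r θ)) := by
  rw [twist]
  generalize twistAngle α n (circleMap 0 r θ) = t
  simp only [circleMap_zero]
  rw [mul_assoc, ← Complex.exp_add]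
  push_cast
  ring_nf

lemma hasFDerivAt_twistAngle (α : ℂ) (n : ℤ) {z : ℂ} (hz : z ≠ 0) :
    HasFDerivAt (twistAngle α n)
      (Complex.reCLM.comp ((ContinuousLinearMap.toSpanSingleton ℂ
        (α * (n * z ^ (n - 1)))).restrictScalars ℝ)) z := by
  have h := ((hasDerivAt_zpow n z (Or.inl hz)).const_mul α).hasFDerivAt.restrictScalars ℝ
  exact Complex.reCLM.hasFDerivAt.comp z h

/-- The derivative of `twist α n`. -/
def twistDeriv (α : ℂ) (n : ℤ) (z : ℂ) : ℂ →L[ℝ] ℂ := fderiv ℝ (twist α n) z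

/-- With $\kappa=n\alpha z^n/2$ the coefficients are $e^{i\psi}(1+i\kappa)$ and $e^{i\psi}\,i(z/\bar
z)\bar\kappa$. The antilinear one appears because the rotation angle is a real part. -/
lemma hasFDerivAt_twist_apply (α : ℂ) (n : ℤ) {z : ℂ} (hz : z ≠ 0) :
    ∃ L : ℂ →L[ℝ] ℂ, HasFDerivAt (twist α n) L z ∧ ∀ v, L v =
      Complex.exp (twistAngle α n z * Complex.I) *
        (1 + Complex.I * (n * (α * z ^ n) / 2)) * v +
      Complex.exp (twistAngle α n z * Complex.I) *
        (Complex.I * (z / conj z) * conj (n * (α * z ^ n) / 2)) * conj v := by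
  have h1 : HasFDerivAt (fun w => (twistAngle α n w : ℂ) * Complex.I) _ z :=
    ((Complex.ofRealCLM.hasFDerivAt.comp z (hasFDerivAt_twistAngle α n hz)).mul_const Complex.I)
  have h2 := ((Complex.hasDerivAt_exp ((twistAngle α n z : ℂ) * Complex.I)).hasFDerivAt.restrictScalars
    ℝ).comp z h1
  have h3 := (hasFDerivAt_id (𝕜 := ℝ) z).mul h2
  refine ⟨_, h3, fun v => ?_⟩
  have hz' : conj z ≠ 0 := by simpa using hz
  have e : ((α * (n * z ^ (n - 1)) * v).re : ℂ) * z =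
      n * (α * z ^ n) / 2 * v + (z / conj z) * conj (n * (α * z ^ n) / 2) * conj v := by
    rw [Complex.re_eq_add_conj, zpow_sub_one₀ hz]
    simp only [map_mul, map_div₀, map_inv₀, map_zpow₀, map_intCast, map_ofNat]
    field_simp
  change z * (Complex.I * (((v * (α * (n * z ^ (n - 1)))).re : ℝ) : ℂ) *
    Complex.exp (twistAngle α n z * Complex.I)) + Complex.exp (twistAngle α n z * Complex.I) * v = _
  rw [mul_comm v]
  linear_combination Complex.exp (twistAngle α n z * Complex.I) * Complex.I * e

lemma contDiffOn_twist (α : ℂ) (n : ℤ) : ContDiffOn ℝ ∞ (twist α n) {0}ᶜ := by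
  have h1 : ContDiffOn ℝ ∞ (fun z : ℂ => α * z ^ n) {0}ᶜ := fun z hz => by
    have h : DifferentiableOn ℂ (fun z : ℂ => α * z ^ n) {0}ᶜ := fun w hw =>
      ((differentiableAt_zpow.2 (Or.inl hw)).const_mul α).differentiableWithinAt
    exact ((h.contDiffOn (n := ∞) isOpen_compl_singleton) z hz).restrict_scalars ℝ
  have h2 : ContDiffOn ℝ ∞ (twistAngle α n) {0}ᶜ := Complex.reCLM.contDiff.comp_contDiffOn h1
  have h3 : ContDiffOn ℝ ∞ (fun z => (twistAngle α n z : ℂ) * Complex.I) {0}ᶜ :=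
    (Complex.ofRealCLM.contDiff.comp_contDiffOn h2).mul contDiffOn_const
  exact contDiffOn_id.mul ((Complex.contDiff_exp (𝕜 := ℝ)).comp_contDiffOn h3)

lemma hasFDerivAt_twist (α : ℂ) (n : ℤ) {z : ℂ} (hz : z ≠ 0) :
    HasFDerivAt (twist α n) (twistDeriv α n z) z := by
  obtain ⟨L, hL, -⟩ := hasFDerivAt_twist_apply α n hz
  exact hL.differentiableAt.hasFDerivAt

lemma wirt_twistDeriv (α : ℂ) (n : ℤ) {z : ℂ} (hz : z ≠ 0) :
    wirt (twistDeriv α n z) = Complex.exp (twistAngle α n z * Complex.I) *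
        (1 + Complex.I * (n * (α * z ^ n) / 2)) ∧
      wirtBar (twistDeriv α n z) = Complex.exp (twistAngle α n z * Complex.I) *
        (Complex.I * (z / conj z) * conj (n * (α * z ^ n) / 2)) := by
  obtain ⟨L, hL, h⟩ := hasFDerivAt_twist_apply α n hz
  rw [twistDeriv, hL.fderiv]
  exact wirt_eq_of_apply h

lemma norm_sq_wirt_twistDeriv (α : ℂ) (n : ℤ) {z : ℂ} (hz : z ≠ 0) :
    ‖wirt (twistDeriv α n z)‖ ^ 2 =
        1 - n * (α * z ^ n).im + (n * ‖α * z ^ n‖) ^ 2 / 4 ∧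
      ‖wirtBar (twistDeriv α n z)‖ ^ 2 = (n * ‖α * z ^ n‖) ^ 2 / 4 := by
  have hz' : ‖z‖ ≠ 0 := by simpa using hz
  rw [(wirt_twistDeriv α n hz).1, (wirt_twistDeriv α n hz).2]
  constructor
  · rw [norm_mul, Complex.norm_exp_ofReal_mul_I, one_mul, mul_pow]
    simp only [Complex.sq_norm, Complex.normSq_apply]
    simp
    ring
  · rw [norm_mul, Complex.norm_exp_ofReal_mul_I, one_mul]
    simp [div_self hz']
    rw [div_pow, mul_pow, sq_abs, mul_pow]
    norm_num
    ring

lemma det_twistDeriv (α : ℂ) (n : ℤ) {z : ℂ} (hz : z ≠ 0) :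
    (twistDeriv α n z).det = 1 - n * (α * z ^ n).im := by
  rw [det_eq_wirt, (norm_sq_wirt_twistDeriv α n hz).1, (norm_sq_wirt_twistDeriv α n hz).2]
  ring

lemma IsTwistBound.abs_le {ϱ : ℝ} {α : ℂ} {n : ℤ} {δ : ℝ} (h : IsTwistBound ϱ α n δ) {z : ℂ}
    (h1 : ϱ ≤ ‖z‖) (h2 : ‖z‖ ≤ 1) : |n * (α * z ^ n).im| ≤ δ := by
  rw [abs_mul]
  exact (mul_le_mul_of_nonneg_left (Complex.abs_im_le_norm _) (abs_nonneg _)).trans (h z h1 h2)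

lemma norm_zpow_sub_zpow_le {a b : ℂ} (ha : ‖a‖ = 1) (hb : ‖b‖ = 1) (n : ℤ) :
    ‖a ^ n - b ^ n‖ ≤ |(n : ℝ)| * ‖a - b‖ := by
  have key : ∀ (m : ℕ) {a b : ℂ}, ‖a‖ = 1 → ‖b‖ = 1 → ‖a ^ m - b ^ m‖ ≤ m * ‖a - b‖ := by
    intro m a b ha hb
    induction m with
    | zero => simp
    | succ m ih =>
      have e : a ^ (m + 1) - b ^ (m + 1) = a ^ m * (a - b) + (a ^ m - b ^ m) * b := by ring
      rw [e]
      refine (norm_add_le _ _).trans ?_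
      rw [norm_mul, norm_mul, norm_pow, ha, hb, one_pow, one_mul, mul_one]
      push_cast
      linarith
  obtain ⟨m, rfl | rfl⟩ := n.eq_nat_or_neg
  · simpa using key m ha hb
  · have hinv : ‖a⁻¹ - b⁻¹‖ = ‖a - b‖ := by
      have ha0 : a ≠ 0 := norm_pos_iff.1 (by rw [ha]; norm_num)
      have hb0 : b ≠ 0 := norm_pos_iff.1 (by rw [hb]; norm_num)
      rw [inv_sub_inv ha0 hb0, norm_div, norm_mul, ha, hb, norm_sub_rev]
      simp
    have := key m (a := a⁻¹) (b := b⁻¹) (by simp [ha]) (by simp [hb])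
    rw [hinv] at this
    simpa using this

lemma circleMap_eq_mul (r θ : ℝ) : circleMap 0 r θ = r * circleMap 0 1 θ := by
  simp [circleMap_zero]

lemma hasDerivAt_twistAngle_circleMap (α : ℂ) (n : ℤ) {r : ℝ} (hr : 0 < r) (θ : ℝ) :
    HasDerivAt (fun θ => twistAngle α n (circleMap 0 r θ))
      (-(n * (α * circleMap 0 r θ ^ n).im)) θ := by
  have hz : circleMap 0 r θ ≠ 0 := circleMap_ne_center hr.ne'
  have h := (hasFDerivAt_twistAngle α n hz).comp_hasDerivAt θ (hasDerivAt_circleMap 0 r θ)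
  refine h.congr_deriv ?_
  change ((circleMap 0 r θ * Complex.I) * (α * (n * circleMap 0 r θ ^ (n - 1)))).re = _
  rw [zpow_sub_one₀ hz]
  have e : (circleMap 0 r θ * Complex.I) * (α * (n * (circleMap 0 r θ ^ n * (circleMap 0 r θ)⁻¹))) =
      ((n : ℝ) : ℂ) * ((α * circleMap 0 r θ ^ n) * Complex.I) := by
    field_simp
    push_cast
    ring
  rw [e, Complex.re_ofReal_mul, Complex.mul_I_re]
  ring

/-- On a circle the twist shifts the angle by $\mathrm{Re}(\alpha r^ne^{in\theta})$, whose
derivative is at most $\delta$ in absolute value. -/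
lemma isCircleShift_twist {ϱ : ℝ} (h0 : 0 < ϱ) {α : ℂ} {n : ℤ} {δ : ℝ}
    (hα : IsTwistBound ϱ α n δ) (hδ : δ ≤ 1 / 4) {r : ℝ} (hr : ϱ ≤ r) (hr1 : r ≤ 1) :
    IsCircleShift fun θ => θ + twistAngle α n (circleMap 0 r θ) where
  contDiff := by
    refine contDiff_id.add (Complex.reCLM.contDiff.comp (contDiff_const.mul ?_))
    have e : (fun θ => circleMap 0 r θ ^ n) = fun θ : ℝ => (r : ℂ) ^ n *
        Complex.exp (n * ((θ : ℂ) * Complex.I)) := by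
      funext θ
      rw [circleMap_zero, mul_zpow, Complex.exp_int_mul]
    rw [e]
    exact contDiff_const.mul (contDiff_const.mul (Complex.ofRealCLM.contDiff.mul contDiff_const)).cexp
  add_two_pi := fun θ => by
    have := periodic_circleMap 0 r θ
    simp only [this]
    ring
  half_le_deriv := fun θ => by
    have hr0 : 0 < r := h0.trans_le hr
    have h := (hasDerivAt_id θ).add (hasDerivAt_twistAngle_circleMap α n hr0 θ)
    have hn : ‖circleMap 0 r θ‖ = r := by simp [abs_of_pos hr0]
    have hb := hα.abs_le (z := circleMap 0 r θ) (by rw [hn]; exact hr) (by rw [hn]; exact hr1)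
    have hd : deriv (fun θ => θ + twistAngle α n (circleMap 0 r θ)) θ = _ := h.deriv
    rw [hd]
    linarith [(abs_le.1 hb).2]
  norm_le := fun s t => by
    have hr0 : 0 < r := h0.trans_le hr
    set ψ := fun θ => twistAngle α n (circleMap 0 r θ) with hψ
    have e : ∀ θ, circleMap 0 1 (θ + ψ θ) = circleMap 0 1 θ * Complex.exp (ψ θ * Complex.I) := by
      intro θ
      simp only [circleMap_zero, Complex.ofReal_one, one_mul, ← Complex.exp_add]
      push_cast
      ring_nf
    have hexp : ‖Complex.exp (ψ s * Complex.I) - Complex.exp (ψ t * Complex.I)‖ ≤ |ψ s - ψ t| := by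
      have := Real.norm_exp_I_mul_ofReal_sub_one_le (x := ψ s - ψ t)
      have e2 : Complex.exp (ψ s * Complex.I) - Complex.exp (ψ t * Complex.I) =
          Complex.exp (ψ t * Complex.I) * (Complex.exp (Complex.I * ((ψ s - ψ t : ℝ) : ℂ)) - 1) := by
        rw [mul_sub, ← Complex.exp_add, mul_one]
        push_cast
        ring_nf
      rw [e2, norm_mul, Complex.norm_exp_ofReal_mul_I, one_mul]
      simpa using this
    have hψd : |ψ s - ψ t| ≤ δ * ‖circleMap 0 1 s - circleMap 0 1 t‖ := by
      have hb := hα r (by simpa [abs_of_pos hr0] using hr) (by simpa [abs_of_pos hr0] using hr1)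
      have e3 : ψ s - ψ t = (α * (r : ℂ) ^ n * (circleMap 0 1 s ^ n - circleMap 0 1 t ^ n)).re := by
        simp only [hψ, twistAngle]
        rw [← Complex.sub_re, circleMap_eq_mul r s, circleMap_eq_mul r t, mul_zpow, mul_zpow]
        ring_nf
      rw [e3]
      refine (Complex.abs_re_le_norm _).trans ?_
      rw [norm_mul]
      calc _ ≤ ‖α * (r : ℂ) ^ n‖ * (|(n : ℝ)| * ‖circleMap 0 1 s - circleMap 0 1 t‖) := by
            gcongr
            exact norm_zpow_sub_zpow_le (by simp) (by simp) n
        _ = (|(n : ℝ)| * ‖α * (r : ℂ) ^ n‖) * ‖circleMap 0 1 s - circleMap 0 1 t‖ := by ring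
        _ ≤ _ := by gcongr
    change ‖circleMap 0 1 (s + ψ s) - circleMap 0 1 (t + ψ t)‖ ≤ _
    rw [e s, e t]
    have e4 : circleMap 0 1 s * Complex.exp (ψ s * Complex.I) -
        circleMap 0 1 t * Complex.exp (ψ t * Complex.I) =
        (circleMap 0 1 s - circleMap 0 1 t) * Complex.exp (ψ s * Complex.I) +
        circleMap 0 1 t * (Complex.exp (ψ s * Complex.I) - Complex.exp (ψ t * Complex.I)) := by ring
    rw [e4]
    refine (norm_add_le _ _).trans ?_
    rw [norm_mul, norm_mul, Complex.norm_exp_ofReal_mul_I, mul_one, norm_circleMap_zero, abs_one,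
      one_mul]
    -- The chord is stretched by at most $1+\delta\le2$.
    nlinarith [norm_nonneg (circleMap 0 1 s - circleMap 0 1 t)]

lemma IsCircleShift.surjective_of_abs_sub_le {τ : ℝ → ℝ} (hτ : IsCircleShift τ) {C : ℝ}
    (hC : ∀ θ, |τ θ - θ| ≤ C) : Function.Surjective τ := fun t => by
  have h1 := abs_le.1 (hC (t - C))
  have h2 := abs_le.1 (hC (t + C))
  have hC0 : 0 ≤ C := (abs_nonneg _).trans (hC 0)
  obtain ⟨x, -, hx⟩ := intermediate_value_Icc (by linarith : t - C ≤ t + C)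
    hτ.contDiff.continuous.continuousOn (show t ∈ Set.Icc _ _ from ⟨by linarith, by linarith⟩)
  exact ⟨x, hx⟩

lemma IsCircleShift.add_int_mul {τ : ℝ → ℝ} (hτ : IsCircleShift τ) (θ : ℝ) (k : ℤ) :
    τ (θ + k * (2 * Real.pi)) = τ θ + k * (2 * Real.pi) := by
  have hp : Function.Periodic (fun θ => τ θ - θ) (2 * Real.pi) := fun θ => by
    simp only [hτ.add_two_pi]; ring
  have := hp.int_mul k θ
  linarith

lemma eq_circleMap_arg (z : ℂ) : z = circleMap 0 ‖z‖ z.arg := by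
  rw [circleMap_zero, Complex.norm_mul_exp_arg_mul_I]

lemma abs_twistAngle_circleMap_le (α : ℂ) (n : ℤ) (r θ : ℝ) :
    |twistAngle α n (circleMap 0 r θ)| ≤ ‖α‖ * |r| ^ n := by
  refine (Complex.abs_re_le_norm _).trans ?_
  simp

/-- The twist preserves the modulus, so this reduces to a single circle, where the angle map is
strictly increasing and commutes with translation by $2\pi$. -/
lemma injOn_twist {ϱ : ℝ} (h0 : 0 < ϱ) {α : ℂ} {n : ℤ} {δ : ℝ}
    (hα : IsTwistBound ϱ α n δ) (hδ : δ ≤ 1 / 4) : Set.InjOn (twist α n) (annulus ϱ) := by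
  intro z hz w hw h
  have hn : ‖w‖ = ‖z‖ := by rw [← norm_twist α n w, ← h, norm_twist]
  have hτ := isCircleShift_twist h0 hα hδ hz.1.le hz.2.le
  rw [eq_circleMap_arg z, eq_circleMap_arg w, hn, twist_circleMap, twist_circleMap] at h
  obtain ⟨k, hk⟩ := (circleMap_eq_circleMap_iff 0 (h0.trans hz.1).ne').1 h
  have h2 := hτ.add_int_mul w.arg k
  have h3 : z.arg = w.arg + k * (2 * Real.pi) := hτ.strictMono.injective (by
    rw [h2]
    have : ((z.arg + twistAngle α n (circleMap 0 ‖z‖ z.arg) : ℝ) : ℂ) * Complex.I =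
      ((w.arg + twistAngle α n (circleMap 0 ‖z‖ w.arg) + k * (2 * Real.pi) : ℝ) : ℂ) *
        Complex.I := by
      rw [hk]; push_cast; ring
    exact_mod_cast mul_right_cancel₀ Complex.I_ne_zero this)
  rw [eq_circleMap_arg z, eq_circleMap_arg w, hn, h3]
  exact (periodic_circleMap 0 ‖z‖).int_mul k w.arg

lemma image_twist {ϱ : ℝ} (h0 : 0 < ϱ) {α : ℂ} {n : ℤ} {δ : ℝ}
    (hα : IsTwistBound ϱ α n δ) (hδ : δ ≤ 1 / 4) : twist α n '' annulus ϱ = annulus ϱ := by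
  refine Set.Subset.antisymm ?_ fun w hw => ?_
  · rintro _ ⟨z, hz, rfl⟩
    exact twist_mem_annulus hz
  · have hτ := isCircleShift_twist h0 hα hδ hw.1.le hw.2.le
    obtain ⟨θ, hθ⟩ := hτ.surjective_of_abs_sub_le (C := ‖α‖ * |‖w‖| ^ n) (fun θ => by
      rw [add_sub_cancel_left]; exact abs_twistAngle_circleMap_le _ _ _ _) w.arg
    refine ⟨circleMap 0 ‖w‖ θ, by simpa [annulus] using hw, ?_⟩
    rw [twist_circleMap]
    simp only at hθ
    rw [hθ, ← eq_circleMap_arg]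

lemma three_quarters_le_det_twistDeriv {ϱ : ℝ} (h0 : 0 < ϱ) {α : ℂ} {n : ℤ} {δ : ℝ}
    (hα : IsTwistBound ϱ α n δ) (hδ : δ ≤ 1 / 4) {z : ℂ} (hz : z ∈ annulus ϱ) :
    3 / 4 ≤ (twistDeriv α n z).det := by
  rw [det_twistDeriv α n (annulus_ne_zero h0 hz)]
  linarith [(abs_le.1 (hα.abs_le hz.1.le hz.2.le)).2]

lemma isAdmissible_twist {ϱ : ℝ} (h0 : 0 < ϱ) (h1 : ϱ < 1) {α : ℂ} {n : ℤ} {δ : ℝ}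
    (hα : IsTwistBound ϱ α n δ) (hδ : δ ≤ 1 / 4) :
    IsAdmissible ϱ (twist α n) (twistDeriv α n) where
  continuousOn := (contDiffOn_twist α n).continuousOn.mono fun z hz => annulus_ne_zero h0 hz
  mapsTo := fun z hz => twist_mem_annulus hz
  approx := by
    have hcpt : IsCompact {z : ℂ | ϱ ≤ ‖z‖ ∧ ‖z‖ ≤ 1} := by
      have : {z : ℂ | ϱ ≤ ‖z‖ ∧ ‖z‖ ≤ 1} = Metric.closedBall 0 1 ∩ {z : ℂ | ϱ ≤ ‖z‖} := by
        ext z; simp [and_comm]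
      rw [this]
      exact (isCompact_closedBall 0 1).inter_right (isClosed_le continuous_const continuous_norm)
    obtain ⟨C, hC⟩ := hcpt.exists_bound_of_continuousOn
      (((contDiffOn_twist α n).continuousOn_fderiv_of_isOpen isOpen_compl_singleton
        (by norm_cast)).mono fun z hz => norm_pos_iff.1 (h0.trans_le hz.1))
    -- The twist is already smooth off the origin, so a constant sequence approximates it.
    exact ⟨fun _ => twist α n, fun _ => contDiffOn_twist α n,
      ⟨max 1 C, fun _ z hz1 hz2 => ⟨by rw [norm_twist]; exact hz2.trans (le_max_left _ _),
        (hC z ⟨hz1, hz2⟩).trans (le_max_right _ _)⟩⟩,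
      fun z _ _ => tendsto_const_nhds, Eventually.of_forall fun z => tendsto_const_nhds⟩
  lintegral_le := by
    -- The Jacobian is at least $3/4$, so any constant not below $4/3$ works.
    refine ⟨2, by finiteness, fun F => ?_⟩
    have hm := measurableSet_annulus ϱ
    have hch := lintegral_image_eq_lintegral_abs_det_fderiv_mul volume hm
      (fun z hz => (hasFDerivAt_twist α n (annulus_ne_zero h0 hz)).hasFDerivWithinAt)
      (injOn_twist h0 hα hδ) F
    rw [image_twist h0 hα hδ] at hch
    rw [hch, ← lintegral_const_mul' _ _ (by finiteness)]
    refine setLIntegral_mono' hm fun z hz => ?_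
    rw [← mul_assoc]
    refine le_mul_of_one_le_left zero_le ?_
    rw [← ENNReal.ofReal_ofNat 2, ← ENNReal.ofReal_mul zero_le_two, ENNReal.one_le_ofReal]
    linarith [le_abs_self (twistDeriv α n z).det, three_quarters_le_det_twistDeriv h0 hα hδ hz]
  circle_le := fun r hr => by
    refine ⟨r, hr, 2, by finiteness, fun F => ?_⟩
    have hr' : ϱ ≤ r ∧ r ≤ 1 := by
      rcases hr with rfl | h
      · exact ⟨le_rfl, h1.le⟩
      · rw [Set.mem_singleton_iff] at h
        exact ⟨h ▸ h1.le, h.le⟩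
    simp_rw [twist_circleMap]
    exact (isCircleShift_twist h0 hα hδ hr'.1 hr'.2).lintegral_comp_le
      (G := fun θ => F (circleMap 0 r θ)) fun θ => by simp only [periodic_circleMap 0 r θ]

/-- Twisting a map of the class `𝓘_{p,q}`. -/
lemma exists_classI_twist {ϱ : ℝ} (h0 : 0 < ϱ) (h1 : ϱ < 1) {α : ℂ} {n : ℤ} {δ : ℝ}
    (hα : IsTwistBound ϱ α n δ) (hδ : δ ≤ 1 / 4) {p q : ℤ}
    {u : H1Annulus ϱ} (hu : u ∈ classI ϱ p q) {U : ℂ → ℂ} (hU : ContDiffOn ℝ 1 U (annulus ϱ))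
    (hu0 : u.toFun = U) (hux : u.dx = fun z => fderiv ℝ U z 1)
    (huy : u.dy = fun z => fderiv ℝ U z Complex.I) :
    ∃ v ∈ classI ϱ p q, v.dx = (fun z => fderiv ℝ U (twist α n z) (twistDeriv α n z 1)) ∧
      v.dy = (fun z => fderiv ℝ U (twist α n z) (twistDeriv α n z Complex.I)) := by
  obtain ⟨g, hg, hg1, hdp, hdq⟩ := hu
  have hτ : ∀ r ∈ ({ϱ, 1} : Set ℝ),
      IsCircleShift fun θ => θ + twistAngle α n (circleMap 0 r θ) := fun r hr => by
    rcases hr with rfl | h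
    · exact isCircleShift_twist h0 hα hδ le_rfl h1.le
    · rw [Set.mem_singleton_iff] at h
      exact isCircleShift_twist h0 hα hδ (h ▸ h1.le) h.le
  have hper : ∀ r, Function.Periodic (onCircle g r) (2 * Real.pi) := fun r θ => by
    simp only [onCircle, periodic_circleMap 0 r θ]
  have hcirc : ∀ r, onCircle (fun z => g (twist α n z)) r =
      fun θ => onCircle g r (θ + twistAngle α n (circleMap 0 r θ)) := fun r => funext fun θ => by
    simp only [onCircle, twist_circleMap]
  obtain ⟨v, -, hvx, hvy, hvt⟩ := (isAdmissible_twist h0 h1 hα hδ).exists_comp h0 h1 hU hu0 hux huy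
    hg (fun r hr => by
      rw [hcirc r]; exact (hτ r hr).aestronglyMeasurable_comp (hper r) (hg.1 r hr))
  refine ⟨v, ⟨_, hvt, fun r hr => ?_, ?_, ?_⟩, hvx, hvy⟩
  · rw [hcirc r]; exact (hτ r hr).ae_norm_comp (hper r) (hg1 r hr)
  · rw [hcirc 1]; exact (hτ 1 (by simp)).hasDegree_comp (hper 1) hdp
  · rw [hcirc ϱ]; exact (hτ ϱ (by simp)).hasDegree_comp (hper ϱ) hdq

/-! ### The first variation under twists -/

/-- The cross term contains the Hopf coefficient of `L`. This is how the Hopf differential enters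
the variation of the energy under changes of variables. -/
lemma half_norm_sq_comp (L M : ℂ →L[ℝ] ℂ) :
    (‖L (M 1)‖ ^ 2 + ‖L (M Complex.I)‖ ^ 2) / 2 =
      (‖wirt L‖ ^ 2 + ‖wirtBar L‖ ^ 2) * (‖wirt M‖ ^ 2 + ‖wirtBar M‖ ^ 2) +
        4 * (wirt L * conj (wirtBar L) * (wirt M * wirtBar M)).re := by
  have h := norm_sq_add_norm_sq_eq_wirt (L.comp M)
  rw [(wirt_comp L M).1, (wirt_comp L M).2, ContinuousLinearMap.comp_apply,
    ContinuousLinearMap.comp_apply] at h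
  rw [h]
  simp only [Complex.sq_norm, Complex.normSq_apply]
  simp
  ring

/-- Scalar core of the second-order expansion: $P=|\partial_zU|^2+|\partial_{\bar z}U|^2$, `h` is
the Hopf coefficient times $w/\bar w$, and $1-2\,\mathrm{Im}\,\kappa$ is the Jacobian. Here `κ` is
taken at $z$ and `κ'` at the image point $w$, so that the right side becomes the Jacobian times a
function of $w$; every discrepancy is of order $\delta^2P$ and is absorbed by $6\delta^2P$. -/
lemma twist_density_le {P δ : ℝ} {h κ κ' : ℂ} (hh : ‖h‖ ≤ P / 2) (hδ0 : 0 ≤ δ)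
    (hδ : δ ≤ 1 / 4) (hκ : ‖κ‖ ≤ δ / 2) (hκ' : ‖κ'‖ ≤ δ / 2) (hd : ‖κ - κ'‖ ≤ δ ^ 2 / 2) :
    P * (1 - 2 * κ.im + 2 * ‖κ‖ ^ 2) + 4 * (h * ((1 + Complex.I * κ) * (Complex.I * conj κ))).re ≤
      (1 - 2 * κ.im) * (P - 4 * (h * conj κ').im + 6 * δ ^ 2 * P) := by
  have hP : 0 ≤ P := by linarith [norm_nonneg h]
  have e : 4 * (h * ((1 + Complex.I * κ) * (Complex.I * conj κ))).re =
      -4 * (h * conj κ).im - 4 * (‖κ‖ ^ 2 * h.re) := by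
    rw [Complex.sq_norm, Complex.normSq_apply]
    simp
    ring
  have e2 : (h * conj κ).im = (h * conj (κ - κ')).im + (h * conj κ').im := by
    simp
    ring
  have b1 : |(h * conj (κ - κ')).im| ≤ P / 2 * (δ ^ 2 / 2) := by
    refine (Complex.abs_im_le_norm _).trans ?_
    rw [norm_mul, RCLike.norm_conj]
    gcongr
  have b2 : |(h * conj κ').im| ≤ P / 2 * (δ / 2) := by
    refine (Complex.abs_im_le_norm _).trans ?_
    rw [norm_mul, RCLike.norm_conj]
    gcongr
  have b3 : ‖κ‖ ^ 2 ≤ (δ / 2) ^ 2 := by gcongr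
  have b4 : |κ.im| ≤ δ / 2 := (Complex.abs_im_le_norm _).trans hκ
  have b5 : |h.re| ≤ P / 2 := (Complex.abs_re_le_norm _).trans hh
  have b6 : |κ.im * (h * conj κ').im| ≤ δ / 2 * (P / 2 * (δ / 2)) := by
    rw [abs_mul]; gcongr
  have b7 : |‖κ‖ ^ 2 * h.re| ≤ (δ / 2) ^ 2 * (P / 2) := by
    rw [abs_mul, abs_of_nonneg (by positivity : 0 ≤ ‖κ‖ ^ 2)]; gcongr
  have b8 : P * ‖κ‖ ^ 2 ≤ P * (δ / 2) ^ 2 := by gcongr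
  have b9 : κ.im * (δ ^ 2 * P) ≤ 1 / 8 * (δ ^ 2 * P) :=
    mul_le_mul_of_nonneg_right (by linarith [(abs_le.1 b4).2]) (by positivity)
  have hnn : 0 ≤ δ ^ 2 * P := by positivity
  rw [e, e2]
  nlinarith [abs_le.1 b1, abs_le.1 b6, abs_le.1 b7]

/-- The density of the first variation of the energy under the twists `twist α n`. -/
def twistDensity (U : ℂ → ℂ) (n : ℤ) (z : ℂ) : ℂ := hopf U z * (z / conj z) * conj z ^ n

lemma norm_hopf_le (U : ℂ → ℂ) (z : ℂ) : ‖hopf U z‖ ≤ gradSq U z / 4 := by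
  rw [hopf_eq_wirt, norm_mul, RCLike.norm_conj, gradSq, norm_sq_add_norm_sq_eq_wirt]
  nlinarith [sq_nonneg (‖wirt (fderiv ℝ U z)‖ - ‖wirtBar (fderiv ℝ U z)‖)]

lemma norm_div_conj {z : ℂ} (hz : z ≠ 0) : ‖z / conj z‖ = 1 := by
  rw [norm_div, RCLike.norm_conj, div_self (norm_ne_zero_iff.2 hz)]

/-- The bound is the Jacobian times a function evaluated at the image point, so integration over the
annulus undoes the twist. -/
lemma twist_energy_density_le {ϱ : ℝ} (h0 : 0 < ϱ) {α : ℂ} {n : ℤ} {δ : ℝ} (hn : n ≠ 0)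
    (hα : IsTwistBound ϱ α n δ) (hδ : δ ≤ 1 / 4) (U : ℂ → ℂ) {z : ℂ} (hz : z ∈ annulus ϱ) :
    (‖fderiv ℝ U (twist α n z) (twistDeriv α n z 1)‖ ^ 2 +
      ‖fderiv ℝ U (twist α n z) (twistDeriv α n z Complex.I)‖ ^ 2) / 2 ≤
    |(twistDeriv α n z).det| * ((1 + 6 * δ ^ 2) * (gradSq U (twist α n z) / 2) -
      2 * n * (conj α * twistDensity U n (twist α n z)).im) := by
  have hz0 := annulus_ne_zero h0 hz
  have hz1 : conj z ≠ 0 := by simpa using hz0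
  have hdet := three_quarters_le_det_twistDeriv h0 hα hδ hz
  rw [half_norm_sq_comp, abs_of_nonneg (by linarith), det_twistDeriv α n hz0,
    (norm_sq_wirt_twistDeriv α n hz0).1, (norm_sq_wirt_twistDeriv α n hz0).2,
    (wirt_twistDeriv α n hz0).1, (wirt_twistDeriv α n hz0).2, ← hopf_eq_wirt, gradSq,
    norm_sq_add_norm_sq_eq_wirt]
  set w := twist α n z with hw
  set P := ‖wirt (fderiv ℝ U w)‖ ^ 2 + ‖wirtBar (fderiv ℝ U w)‖ ^ 2 with hP
  set ψ := twistAngle α n z with hψ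
  set E := Complex.exp (ψ * Complex.I) with hE
  have hE0 : E ≠ 0 := Complex.exp_ne_zero _
  have hEc : conj E = E⁻¹ := by
    rw [hE, ← Complex.exp_conj, ← Complex.exp_neg]
    simp
  have hwE : w = z * E := rfl
  have hwA : w ∈ annulus ϱ := twist_mem_annulus hz
  have hw0 := annulus_ne_zero h0 hwA
  have hδ0 : 0 ≤ δ := le_trans (by positivity) (hα z hz.1.le hz.2.le)
  have hn1 : (1 : ℝ) ≤ |(n : ℝ)| := by exact_mod_cast Int.one_le_abs hn
  have hκn : ∀ z ∈ annulus ϱ, ‖(n * (α * z ^ n) / 2 : ℂ)‖ ≤ δ / 2 := fun z hz => by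
    have := hα z hz.1.le hz.2.le
    rw [norm_div, norm_mul, Complex.norm_intCast]
    simp only [Complex.norm_ofNat]
    linarith
  have key := twist_density_le (P := P) (δ := δ) (h := hopf U w * (w / conj w))
    (κ := n * (α * z ^ n) / 2) (κ' := n * (α * w ^ n) / 2) ?_ hδ0 hδ (hκn z hz) (hκn w hwA) ?_
  · have e1 : 2 * (n * (α * z ^ n) / 2 : ℂ).im = n * (α * z ^ n).im := by
      rw [show (n * (α * z ^ n) / 2 : ℂ) = ((n / 2 : ℝ) : ℂ) * (α * z ^ n) by push_cast; ring,
        Complex.im_ofReal_mul]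
      ring
    have e2 : 2 * ‖(n * (α * z ^ n) / 2 : ℂ)‖ ^ 2 = (n * ‖α * z ^ n‖) ^ 2 / 4 +
        (n * ‖α * z ^ n‖) ^ 2 / 4 := by
      rw [norm_div, norm_mul, Complex.norm_intCast, div_pow, mul_pow, sq_abs]
      simp only [Complex.norm_ofNat]
      ring
    have e3 : 4 * (hopf U w * (w / conj w) * conj (n * (α * w ^ n) / 2)).im =
        2 * n * (conj α * twistDensity U n w).im := by
      rw [twistDensity, show hopf U w * (w / conj w) * conj (n * (α * w ^ n) / 2) =
        ((n / 2 : ℝ) : ℂ) * (conj α * (hopf U w * (w / conj w) * conj w ^ n)) by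
          simp only [map_div₀, map_mul, map_intCast, map_zpow₀, map_ofNat]
          push_cast
          ring, Complex.im_ofReal_mul]
      ring
    have e4 : hopf U w * (E * (1 + Complex.I * (n * (α * z ^ n) / 2)) *
        (E * (Complex.I * (z / conj z) * conj (n * (α * z ^ n) / 2)))) =
        hopf U w * (w / conj w) * ((1 + Complex.I * (n * (α * z ^ n) / 2)) *
          (Complex.I * conj (n * (α * z ^ n) / 2))) := by
      rw [hwE, map_mul, hEc]
      field_simp
    rw [e1, e2, e3] at key
    rw [e4]
    linarith
  · rw [norm_mul, norm_div_conj hw0, mul_one]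
    have := norm_hopf_le U w
    rw [gradSq, norm_sq_add_norm_sq_eq_wirt] at this
    linarith
  -- Moving from $z$ to $w=ze^{i\psi}$ multiplies $\kappa$ by $e^{in\psi}$ with $|n\psi|\le\delta$,
  -- so the change is quadratic in $\delta$.
  · have e5 : (n * (α * z ^ n) / 2 : ℂ) - n * (α * w ^ n) / 2 =
        -(n * (α * z ^ n) / 2 * (Complex.exp (Complex.I * ((n * ψ : ℝ) : ℂ)) - 1)) := by
      have : E ^ n = Complex.exp (Complex.I * ((n * ψ : ℝ) : ℂ)) := by
        rw [hE, ← Complex.exp_int_mul]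
        push_cast
        ring_nf
      rw [hwE, mul_zpow, this]
      ring
    have b1 : ‖((n : ℝ) * ψ : ℝ)‖ ≤ δ := by
      rw [norm_mul, Real.norm_eq_abs, Real.norm_eq_abs]
      exact (mul_le_mul_of_nonneg_left (Complex.abs_re_le_norm _) (abs_nonneg _)).trans
        (hα z hz.1.le hz.2.le)
    rw [e5, norm_neg, norm_mul]
    calc _ ≤ δ / 2 * δ := by
          gcongr
          · exact hκn z hz
          · exact Real.norm_exp_I_mul_ofReal_sub_one_le.trans b1
      _ = _ := by ring

/-- Combines $E(u)\le E(v)$ with $E(v)\le(1+6\delta^2)E(u)-2n\,\mathrm{Im}(\bar\alpha\int\cdots)$,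
obtained by a change of variables for the twisted map $v$. -/
lemma IsMinimizer.twist_integral_le {ϱ : ℝ} (h0 : 0 < ϱ) (h1 : ϱ < 1) {p q : ℤ}
    {u : H1Annulus ϱ} (hu : IsMinimizer u p q) {U : ℂ → ℂ} (hU : ContDiffOn ℝ 1 U (annulus ϱ))
    (hu0 : u.toFun = U) (hux : u.dx = fun z => fderiv ℝ U z 1)
    (huy : u.dy = fun z => fderiv ℝ U z Complex.I) {n : ℤ} (hn : n ≠ 0)
    (hint : IntegrableOn (twistDensity U n) (annulus ϱ))
    {α : ℂ} {δ : ℝ} (hα : IsTwistBound ϱ α n δ) (hδ : δ ≤ 1 / 4) :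
    2 * n * (conj α * ∫ z in annulus ϱ, twistDensity U n z).im ≤ 6 * δ ^ 2 * energy u := by
  obtain ⟨v, hv, hvx, hvy⟩ := exists_classI_twist h0 h1 hα hδ hu.1 hU hu0 hux huy
  have hm := measurableSet_annulus ϱ
  have hg : IntegrableOn (gradSq U) (annulus ϱ) := by
    have h := integrable_energy_density u
    rw [hux, huy] at h
    exact h
  have hEu : energy u = ∫ z in annulus ϱ, gradSq U z / 2 := by
    rw [energy, ← integral_const_mul]
    simp only [hux, huy, gradSq]
    congr 1; ext z; ring
  have hi : Integrable (fun z => conj α * twistDensity U n z) (volume.restrict (annulus ϱ)) :=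
    hint.const_mul _
  have hi2 : Integrable (fun z => (1 + 6 * δ ^ 2) * (gradSq U z / 2))
      (volume.restrict (annulus ϱ)) := (hg.div_const 2).const_mul _
  have hi3 : Integrable (fun z => 2 * n * (conj α * twistDensity U n z).im)
      (volume.restrict (annulus ϱ)) := hi.im.const_mul _
  have hR : IntegrableOn (fun z => (1 + 6 * δ ^ 2) * (gradSq U z / 2) -
      2 * n * (conj α * twistDensity U n z).im) (annulus ϱ) := hi2.sub hi3
  have hRe : ∫ z in annulus ϱ, ((1 + 6 * δ ^ 2) * (gradSq U z / 2) -
      2 * n * (conj α * twistDensity U n z).im) = (1 + 6 * δ ^ 2) * energy u -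
        2 * n * (conj α * ∫ z in annulus ϱ, twistDensity U n z).im := by
    have him : ∫ z in annulus ϱ, (conj α * twistDensity U n z).im =
        (conj α * ∫ z in annulus ϱ, twistDensity U n z).im := by
      rw [← integral_const_mul]
      exact integral_im hi
    rw [integral_sub hi2 hi3, integral_const_mul, integral_const_mul, ← hEu, him]
  have hd : ∀ z ∈ annulus ϱ, HasFDerivWithinAt (twist α n) (twistDeriv α n z) (annulus ϱ) z :=
    fun z hz => (hasFDerivAt_twist α n (annulus_ne_zero h0 hz)).hasFDerivWithinAt
  have hinj := injOn_twist h0 hα hδ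
  have himg := image_twist h0 hα hδ
  have hch := integral_image_eq_integral_abs_det_fderiv_smul volume hm hd hinj
    (fun z => (1 + 6 * δ ^ 2) * (gradSq U z / 2) - 2 * n * (conj α * twistDensity U n z).im)
  rw [himg, hRe] at hch
  have hRi := (integrableOn_image_iff_integrableOn_abs_det_fderiv_smul volume hm hd hinj _).1
    (by rw [himg]; exact hR)
  have hle := hu.2 v hv
  have hEv : energy v ≤ (1 + 6 * δ ^ 2) * energy u -
        2 * n * (conj α * ∫ z in annulus ϱ, twistDensity U n z).im := by
    rw [hch, energy, ← integral_const_mul]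
    refine setIntegral_mono_on ((integrable_energy_density v).const_mul _) hRi hm fun z hz => ?_
    have := twist_energy_density_le h0 hn hα hδ U hz
    simp only [hvx, hvy, smul_eq_mul]
    linarith
  linarith

/-- Replacing $\alpha$ by $t\alpha$ makes the left side of `twist_integral_le` linear and the right
side quadratic in $t$; both signs of $t$ force the linear term to vanish. The choices $\alpha=1$ and
$\alpha=i$ give the imaginary and the real part. -/
lemma IsMinimizer.integral_twistDensity_eq_zero {ϱ : ℝ} (h0 : 0 < ϱ) (h1 : ϱ < 1) {p q : ℤ}
    {u : H1Annulus ϱ} (hu : IsMinimizer u p q) {U : ℂ → ℂ} (hU : ContDiffOn ℝ 1 U (annulus ϱ))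
    (hu0 : u.toFun = U) (hux : u.dx = fun z => fderiv ℝ U z 1)
    (huy : u.dy = fun z => fderiv ℝ U z Complex.I) {n : ℤ} (hn : n ≠ 0)
    (hint : IntegrableOn (twistDensity U n) (annulus ϱ)) :
    ∫ z in annulus ϱ, twistDensity U n z = 0 := by
  set J := ∫ z in annulus ϱ, twistDensity U n z with hJ
  obtain ⟨B, hB0, hB⟩ : ∃ B > 0, ∀ z : ℂ, ϱ ≤ ‖z‖ → ‖z‖ ≤ 1 → |(n : ℝ)| * ‖z ^ n‖ ≤ B := by
    refine ⟨|(n : ℝ)| * (1 + ϱ ^ n), by positivity, fun z hz1 hz2 => ?_⟩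
    gcongr
    rw [norm_zpow]
    rcases le_or_gt 0 n with h | h
    · obtain ⟨m, rfl⟩ := Int.eq_ofNat_of_zero_le h
      have : ‖z‖ ^ m ≤ 1 := pow_le_one₀ (norm_nonneg _) hz2
      have : 0 < ϱ ^ m := by positivity
      simp only [zpow_natCast]
      linarith
    · obtain ⟨m, rfl⟩ : ∃ m : ℕ, n = -m := ⟨n.natAbs, by omega⟩
      have : ‖z‖ ^ (-(m : ℤ)) ≤ ϱ ^ (-(m : ℤ)) := by
        rw [zpow_neg, zpow_neg, zpow_natCast, zpow_natCast]
        gcongr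
      linarith
  have hE0 : 0 ≤ energy u := by
    unfold energy
    have : 0 ≤ ∫ z in annulus ϱ, (‖u.dx z‖ ^ 2 + ‖u.dy z‖ ^ 2) :=
      integral_nonneg fun z => by positivity
    positivity
  have key : ∀ α : ℂ, ‖α‖ ≤ 1 → (conj α * J).im = 0 := by
    intro α hα
    set X := 2 * n * (conj α * J).im with hX
    have hsmall : ∀ t : ℝ, |t| ≤ 1 / (4 * B) → t * X ≤ t ^ 2 * (6 * B ^ 2 * energy u) := by
      intro t ht
      have hb : IsTwistBound ϱ (t * α) n (|t| * B) := fun z hz1 hz2 => by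
        have := hB z hz1 hz2
        rw [norm_mul, norm_mul, Complex.norm_real, Real.norm_eq_abs]
        calc _ = |t| * (‖α‖ * (|(n : ℝ)| * ‖z ^ n‖)) := by ring
          _ ≤ |t| * (1 * B) := by gcongr
          _ = _ := by ring
      have h := hu.twist_integral_le h0 h1 hU hu0 hux huy hn hint hb (by
        rw [le_div_iff₀ (by positivity)] at ht
        linarith)
      rw [map_mul, Complex.conj_ofReal, mul_assoc (t : ℂ), Complex.im_ofReal_mul, mul_pow, sq_abs] at h
      rw [hX]
      linarith
    -- Twists are available only for $|t|\le1/(4B)$; beyond that range the added coefficient $4B|X|$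
    -- makes the quadratic inequality trivial.
    have hX0 : -X = 0 := eq_zero_of_forall_quadratic_nonneg
      (C := 6 * B ^ 2 * energy u + 4 * B * |X|) fun t => by
        rcases le_or_gt |t| (1 / (4 * B)) with ht | ht
        · have : 0 ≤ t ^ 2 * (4 * B * |X|) := by positivity
          linarith [hsmall t ht]
        · rw [div_lt_iff₀ (by positivity)] at ht
          have h2 : t * X ≤ |t| * |X| := by rw [← abs_mul]; exact le_abs_self _
          have h3 : |t| * |X| * 1 ≤ |t| * |X| * (|t| * (4 * B)) := by gcongr
          have h4 : |t| * |X| * (|t| * (4 * B)) = t ^ 2 * (4 * B * |X|) := by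
            rw [← sq_abs t]; ring
          have : 0 ≤ t ^ 2 * (6 * B ^ 2 * energy u) := by positivity
          linarith
    have hn' : (n : ℝ) ≠ 0 := by exact_mod_cast hn
    have : 2 * (n : ℝ) * (conj α * J).im = 0 := by linarith
    simpa [hn'] using this
  have k1 := key 1 (by simp)
  have k2 := key Complex.I (by simp)
  simp at k1 k2
  exact Complex.ext k2 k1

/-! ### Polar coordinates and Fourier coefficients -/

lemma polarCoord_symm_eq_circleMap (p : ℝ × ℝ) :
    Complex.polarCoord.symm p = circleMap 0 p.1 p.2 := by
  rw [Complex.polarCoord_symm_apply, circleMap_zero, Complex.exp_mul_I]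
  push_cast
  rfl

lemma circleMap_mem_annulus {ϱ r : ℝ} (hr : 0 < r) (θ : ℝ) :
    circleMap 0 r θ ∈ annulus ϱ ↔ r ∈ Set.Ioo ϱ 1 := by
  simp [annulus, abs_of_pos hr]

lemma lintegral_Ioo_neg_pi_pi {G : ℝ → ℝ≥0∞} (hG : Function.Periodic G (2 * Real.pi)) :
    ∫⁻ θ in Set.Ioo (-Real.pi) Real.pi, G θ = ∫⁻ θ, G θ ∂angleMeasure := by
  have h := setLIntegral_Ioc_of_periodic hG (-Real.pi) 0
  rw [show -Real.pi + 2 * Real.pi = Real.pi by ring, zero_add] at h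
  rw [angleMeasure, ← h]
  exact setLIntegral_congr Ioo_ae_eq_Ioc

lemma lintegral_annulus {ϱ : ℝ} (h0 : 0 < ϱ) {f : ℂ → ℝ≥0∞} (hf : Measurable f) :
    ∫⁻ z in annulus ϱ, f z = ∫⁻ r in Set.Ioo ϱ 1, ENNReal.ofReal r *
      ∫⁻ θ, f (circleMap 0 r θ) ∂angleMeasure := by
  have hm := measurableSet_annulus ϱ
  have hfm : Measurable ((annulus ϱ).indicator f) := hf.indicator hm
  rw [← lintegral_indicator hm, ← Complex.lintegral_comp_polarCoord_symm, polarCoord_target,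
    Measure.volume_eq_prod, ← Measure.prod_restrict, lintegral_prod]
  · rw [← lintegral_indicator measurableSet_Ioo, ← lintegral_indicator measurableSet_Ioi]
    congr 1
    ext r
    by_cases hr : 0 < r
    · rw [Set.indicator_of_mem (Set.mem_Ioi.2 hr)]
      simp only [polarCoord_symm_eq_circleMap, smul_eq_mul]
      by_cases hr1 : r ∈ Set.Ioo ϱ 1
      · rw [Set.indicator_of_mem hr1, lintegral_const_mul' _ _ (by finiteness),
          ← lintegral_Ioo_neg_pi_pi fun θ => by simp only [periodic_circleMap 0 r θ]]
        congr 2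
        ext θ
        rw [Set.indicator_of_mem ((circleMap_mem_annulus hr θ).2 hr1)]
      · rw [Set.indicator_of_notMem hr1]
        simp [Set.indicator, circleMap_mem_annulus hr, hr1]
    · rw [Set.indicator_of_notMem (by simpa using hr), Set.indicator_of_notMem fun h =>
        hr (h0.trans h.1)]
  · simp only [polarCoord_symm_eq_circleMap]
    have : Measurable fun p : ℝ × ℝ => circleMap 0 p.1 p.2 := by
      unfold circleMap; fun_prop
    exact ((measurable_fst.ennreal_ofReal).mul (hfm.comp this)).aemeasurable

lemma integral_annulus {ϱ : ℝ} (h0 : 0 < ϱ) {f : ℂ → ℂ} (hf : ContinuousOn f (annulus ϱ))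
    (hi : IntegrableOn f (annulus ϱ)) :
    ∫ z in annulus ϱ, f z = ∫ r in Set.Ioo ϱ 1, r *
      ∫ θ in (0 : ℝ)..2 * Real.pi, f (circleMap 0 r θ) := by
  have hm := measurableSet_annulus ϱ
  have hfm : Measurable ((annulus ϱ).indicator f) := by
    classical
    have := hf.measurable_piecewise (g := 0) continuousOn_const hm
    rwa [Set.piecewise_eq_indicator] at this
  have hcm : Measurable fun p : ℝ × ℝ => circleMap 0 p.1 p.2 := by
    unfold circleMap; fun_prop
  rw [← integral_indicator hm, ← Complex.integral_comp_polarCoord_symm, polarCoord_target,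
    Measure.volume_eq_prod, setIntegral_prod]
  · rw [← integral_indicator measurableSet_Ioo, ← integral_indicator measurableSet_Ioi]
    congr 1
    ext r
    by_cases hr : 0 < r
    · rw [Set.indicator_of_mem (Set.mem_Ioi.2 hr)]
      simp only [polarCoord_symm_eq_circleMap]
      by_cases hr1 : r ∈ Set.Ioo ϱ 1
      · have hp : Function.Periodic (fun θ => f (circleMap 0 r θ)) (2 * Real.pi) := fun θ => by
          simp only [periodic_circleMap 0 r θ]
        have hpe := hp.intervalIntegral_add_eq (-Real.pi) 0
        rw [show -Real.pi + 2 * Real.pi = Real.pi by ring, zero_add] at hpe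
        rw [Set.indicator_of_mem hr1, integral_smul, ← hpe, Complex.real_smul,
          intervalIntegral.integral_of_le (by linarith [Real.pi_pos]),
          integral_Ioc_eq_integral_Ioo]
        congr 2
        ext θ
        rw [Set.indicator_of_mem ((circleMap_mem_annulus hr θ).2 hr1)]
      · rw [Set.indicator_of_notMem hr1]
        simp [Set.indicator, circleMap_mem_annulus hr, hr1]
    · rw [Set.indicator_of_notMem (by simpa using hr), Set.indicator_of_notMem fun h =>
        hr (h0.trans h.1)]
  · refine ⟨?_, ?_⟩
    · simp only [polarCoord_symm_eq_circleMap]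
      exact (measurable_fst.smul (hfm.comp hcm)).aestronglyMeasurable
    · have h2 : ∫⁻ z, ‖(annulus ϱ).indicator f z‖ₑ < ⊤ :=
        ((integrable_indicator_iff hm).2 hi).2
      rw [← Complex.lintegral_comp_polarCoord_symm] at h2
      refine lt_of_le_of_lt (le_of_eq ?_) h2
      refine setLIntegral_congr_fun polarCoord.open_target.measurableSet fun p hp => ?_
      have hp1 : 0 < p.1 := hp.1
      simp only [enorm_smul, smul_eq_mul]
      rw [← ofReal_norm p.1, Real.norm_eq_abs, abs_of_pos hp1]

/-- The (unnormalized) Fourier coefficients of a function on the circle. -/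
def circleCoeff (f : ℝ → ℂ) (n : ℤ) : ℂ :=
  ∫ x in (0 : ℝ)..2 * Real.pi, Complex.exp (-(n * x * Complex.I)) * f x

lemma hasSum_sq_circleCoeff {f : ℝ → ℂ} (hf : Continuous f) :
    HasSum (fun n => ‖circleCoeff f n‖ ^ 2)
      (2 * Real.pi * ∫ x in (0 : ℝ)..2 * Real.pi, ‖f x‖ ^ 2) := by
  have hL : MemLp f 2 (volume.restrict (Set.Ioc 0 (2 * Real.pi))) := by
    obtain ⟨C, hC⟩ := isCompact_Icc.exists_bound_of_continuousOn
      (hf.continuousOn (s := Set.Icc 0 (2 * Real.pi)))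
    refine MemLp.of_bound hf.aestronglyMeasurable C ?_
    filter_upwards [ae_restrict_mem measurableSet_Ioc] with x hx
    exact hC x (Set.Ioc_subset_Icc_self hx)
  have h := (hasSum_sq_fourierCoeffOn Real.two_pi_pos hL).mul_left ((2 * Real.pi) ^ 2)
  have e : ∀ n, (2 * Real.pi) ^ 2 * ‖fourierCoeffOn Real.two_pi_pos f n‖ ^ 2 =
      ‖circleCoeff f n‖ ^ 2 := fun n => by
    rw [fourierCoeffOn_eq_integral, norm_smul, mul_pow, circleCoeff]
    have e1 : ∀ x : ℝ, fourier (-n) (x : AddCircle (2 * Real.pi - 0)) • f x =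
        Complex.exp (-(n * x * Complex.I)) * f x := fun x => by
      rw [fourier_coe_apply, smul_eq_mul]
      congr 2
      have : (Real.pi : ℂ) ≠ 0 := by exact_mod_cast Real.pi_ne_zero
      push_cast
      field_simp
      ring
    simp_rw [e1]
    generalize ∫ x in (0 : ℝ)..2 * Real.pi, Complex.exp (-(n * x * Complex.I)) * f x = J
    rw [sub_zero, Real.norm_eq_abs, mul_pow, sq_abs]
    have := Real.pi_ne_zero
    field_simp
  simp_rw [e] at h
  have e2 : (2 * Real.pi) ^ 2 * (2 * Real.pi - 0)⁻¹ • ∫ x in (0 : ℝ)..2 * Real.pi, ‖f x‖ ^ 2 =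
      2 * Real.pi * ∫ x in (0 : ℝ)..2 * Real.pi, ‖f x‖ ^ 2 := by
    have := Real.pi_ne_zero
    rw [sub_zero, smul_eq_mul]
    field_simp
  rwa [e2] at h

lemma circleCoeff_const (m : ℂ) (n : ℤ) :
    circleCoeff (fun _ => m) n = if n = 0 then 2 * Real.pi * m else 0 := by
  rw [circleCoeff, intervalIntegral.integral_mul_const]
  split_ifs with h
  · simp [h]
  · have hc : -(n * Complex.I) ≠ 0 := by simp [h]
    have e : ∀ x : ℝ, Complex.exp (-(n * x * Complex.I)) =
        Complex.exp (-(n * Complex.I) * x) := fun x => by ring_nf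
    simp_rw [e]
    rw [integral_exp_mul_complex hc]
    have : Complex.exp (-(n * Complex.I) * (2 * Real.pi : ℝ)) = 1 := by
      rw [← Complex.exp_int_mul_two_pi_mul_I (-n)]
      push_cast
      ring_nf
    rw [this]
    simp

lemma circleCoeff_sub {f g : ℝ → ℂ} (hf : Continuous f) (hg : Continuous g) (n : ℤ) :
    circleCoeff (fun x => f x - g x) n = circleCoeff f n - circleCoeff g n := by
  unfold circleCoeff
  rw [← intervalIntegral.integral_sub (Continuous.intervalIntegrable (by fun_prop) _ _)
    (Continuous.intervalIntegrable (by fun_prop) _ _)]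
  simp only [mul_sub]

/-- A continuous function on the circle is constant if only its mean can be nonzero. -/
lemma eq_const_of_circleCoeff_eq_zero {f : ℝ → ℂ} (hf : Continuous f)
    (h : ∀ n : ℤ, n ≠ 0 → circleCoeff f n = 0) :
    ∃ m, ∀ x ∈ Set.Ioo 0 (2 * Real.pi), f x = m := by
  set m : ℂ := circleCoeff f 0 / (2 * Real.pi) with hm
  have hpi : (Real.pi : ℂ) ≠ 0 := by exact_mod_cast Real.pi_ne_zero
  have h0 : ∀ n, circleCoeff (fun x => f x - m) n = 0 := fun n => by
    rw [circleCoeff_sub hf continuous_const, circleCoeff_const]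
    split_ifs with hn
    · rw [hn, hm]
      field_simp
      ring
    · rw [h n hn, sub_zero]
  have hs := hasSum_sq_circleCoeff (f := fun x => f x - m) (by fun_prop)
  simp only [h0, norm_zero, ne_eq, OfNat.ofNat_ne_zero, not_false_eq_true, zero_pow] at hs
  have hi := hs.unique hasSum_zero
  have hi0 : ∫ x in (0 : ℝ)..2 * Real.pi, ‖f x - m‖ ^ 2 = 0 := by
    simpa [Real.pi_ne_zero] using hi
  refine ⟨m, fun x hx => ?_⟩
  by_contra hne
  have hpos : 0 < ∫ x in (0 : ℝ)..2 * Real.pi, ‖f x - m‖ ^ 2 :=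
    intervalIntegral.integral_pos Real.two_pi_pos (by fun_prop) (fun y _ => by positivity)
      ⟨x, Set.Ioo_subset_Icc_self hx, by
        have := norm_pos_iff.2 (sub_ne_zero.2 hne)
        positivity⟩
  exact hpos.ne' hi0

/-- Cauchy's theorem for $F(z)\,dz/z=iF\,d\theta$ between two concentric circles. -/
lemma integral_circleMap_eq {ϱ : ℝ} (h0 : 0 < ϱ) {F : ℂ → ℂ}
    (hF : DifferentiableOn ℂ F (annulus ϱ)) {r R : ℝ} (hr : ϱ < r) (hR : R < 1) (hrR : r ≤ R) :
    ∫ θ in (0 : ℝ)..2 * Real.pi, F (circleMap 0 R θ) =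
      ∫ θ in (0 : ℝ)..2 * Real.pi, F (circleMap 0 r θ) := by
  have hr0 : 0 < r := h0.trans hr
  have h := Complex.circleIntegral_sub_center_inv_smul_eq_of_differentiable_on_annulus_off_countable
    (c := 0) hr0 hrR (f := F) (s := ∅) Set.countable_empty
    (hF.continuousOn.mono fun z hz => by
      simp only [Set.mem_sdiff, mem_closedBall_zero_iff, mem_ball_zero_iff, not_lt] at hz
      exact ⟨hr.trans_le hz.2, hz.1.trans_lt hR⟩)
    (fun z hz => by
      simp only [Set.mem_sdiff, mem_closedBall_zero_iff, mem_ball_zero_iff, not_le] at hz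
      exact hF.differentiableAt ((isOpen_annulus ϱ).mem_nhds
        ⟨hr.trans hz.1.2, hz.1.1.trans hR⟩))
  have e : ∀ s : ℝ, 0 < s → (∮ z in C(0, s), (z - 0)⁻¹ • F z) =
      Complex.I * ∫ θ in (0 : ℝ)..2 * Real.pi, F (circleMap 0 s θ) := fun s hs => by
    rw [circleIntegral, ← intervalIntegral.integral_const_mul]
    congr 1
    ext θ
    have : circleMap 0 s θ ≠ 0 := circleMap_ne_center hs.ne'
    simp only [deriv_circleMap, smul_eq_mul, sub_zero]
    field_simp
  rw [e r hr0, e R (hr0.trans_le hrR)] at h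
  exact mul_left_cancel₀ Complex.I_ne_zero h

lemma eqOn_annulus_of_eqOn_arc {ϱ : ℝ} (h0 : 0 < ϱ) {R : ℝ} (hR : R ∈ Set.Ioo ϱ 1) {F : ℂ → ℂ}
    (hF : DifferentiableOn ℂ F (annulus ϱ)) {c : ℂ}
    (hc : ∀ θ ∈ Set.Ioo (1 : ℝ) 2, F (circleMap 0 R θ) = c) : ∀ z ∈ annulus ϱ, F z = c := by
  have hR0 : 0 < R := h0.trans hR.1
  have han : AnalyticOnNhd ℂ F (annulus ϱ) := hF.analyticOnNhd (isOpen_annulus ϱ)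
  refine han.eqOn_of_preconnected_of_frequently_eq analyticOnNhd_const
    (isPreconnected_annulus h0) ((circleMap_mem_annulus hR0 1).2 hR) ?_
  have htend : Tendsto (circleMap 0 R) (𝓝[>] 1) (𝓝[≠] (circleMap 0 R 1)) := by
    refine tendsto_nhdsWithin_iff.2 ⟨((continuous_circleMap 0 R).tendsto 1).mono_left
      nhdsWithin_le_nhds, ?_⟩
    have : Set.Ioo (1 : ℝ) 2 ∈ 𝓝[>] (1 : ℝ) := Ioo_mem_nhdsGT (by norm_num)
    -- The arc $1<\theta<2$ lies inside one period, so its points differ from the endpoint at angle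
    -- $1$ while accumulating there.
    filter_upwards [this] with θ hθ h
    have hπ := Real.pi_gt_three
    have := injOn_circleMap_of_abs_sub_le' (c := 0) (R := R) hR0.ne' (a := 0) (b := 2 * Real.pi)
      (by simp) ⟨by linarith [hθ.1], by linarith [hθ.2]⟩ ⟨by norm_num, by linarith⟩ h
    linarith [hθ.1]
  refine htend.frequently (Eventually.frequently ?_)
  have : Set.Ioo (1 : ℝ) 2 ∈ 𝓝[>] (1 : ℝ) := Ioo_mem_nhdsGT (by norm_num)
  filter_upwards [this] with θ hθ
  exact hc θ hθ

/-- A holomorphic function on the annulus is constant if its moments against `conj z ^ n / |z|²`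
vanish for all `n ≠ 0`. -/
lemma eqOn_const_of_integral_eq_zero {ϱ : ℝ} (h0 : 0 < ϱ) (h1 : ϱ < 1) {F : ℂ → ℂ}
    (hF : DifferentiableOn ℂ F (annulus ϱ))
    (hi : ∀ n : ℤ, n ≠ 0 → IntegrableOn (fun z => F z / (z * conj z) * conj z ^ n) (annulus ϱ))
    (hz : ∀ n : ℤ, n ≠ 0 → ∫ z in annulus ϱ, F z / (z * conj z) * conj z ^ n = 0) :
    ∃ c, ∀ z ∈ annulus ϱ, F z = c := by
  have hR0 : 0 < √ϱ := Real.sqrt_pos.2 h0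
  have hRϱ : ϱ < √ϱ := by
    rw [Real.lt_sqrt h0.le]; nlinarith
  have hR1 : √ϱ < 1 := by rw [Real.sqrt_lt' one_pos]; simpa using h1
  set R := √ϱ with hRdef
  have hcA : ∀ θ, circleMap 0 R θ ∈ annulus ϱ := fun θ =>
    (circleMap_mem_annulus hR0 θ).2 ⟨hRϱ, hR1⟩
  have hcont : Continuous fun θ => F (circleMap 0 R θ) :=
    hF.continuousOn.comp_continuous (continuous_circleMap 0 R) hcA
  have hcoeff : ∀ n : ℤ, n ≠ 0 → circleCoeff (fun θ => F (circleMap 0 R θ)) n = 0 := by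
    intro n hn
    -- The circle integral of $Fz^{-n}$ is $2\pi$ times the $n$-th Laurent coefficient of $F$, the
    -- same for every radius.
    set G : ℂ → ℂ := fun z => F z * z ^ (-n) with hG
    have hGd : DifferentiableOn ℂ G (annulus ϱ) := hF.mul fun z hz =>
      (differentiableAt_zpow.2 (Or.inl (annulus_ne_zero h0 hz))).differentiableWithinAt
    set g := ∫ θ in (0 : ℝ)..2 * Real.pi, G (circleMap 0 R θ) with hg
    have hgr : ∀ r ∈ Set.Ioo ϱ 1, ∫ θ in (0 : ℝ)..2 * Real.pi, G (circleMap 0 r θ) = g := by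
      intro r hr
      rcases le_total r R with h | h
      · exact (integral_circleMap_eq h0 hGd hr.1 hR1 h).symm
      · exact integral_circleMap_eq h0 hGd hRϱ hr.2 h
    have hcD : ContinuousOn (fun z => F z / (z * conj z) * conj z ^ n) (annulus ϱ) := by
      refine (hF.continuousOn.div (by fun_prop) fun z hz => ?_).mul
        (ContinuousOn.zpow₀ (by fun_prop) n fun z hz => Or.inl ?_)
      · simpa using annulus_ne_zero h0 hz
      · simpa using annulus_ne_zero h0 hz
    have hpol := integral_annulus h0 hcD (hi n hn)
    rw [hz n hn] at hpol
    -- On the circle of radius $r$ one has $\bar z=r^2/z$, so the moment factors into $\int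
    -- r^{2n-1}\,dr>0$ and the Laurent integral `g`.
    have e : ∀ r ∈ Set.Ioo ϱ 1, (r : ℂ) * ∫ θ in (0 : ℝ)..2 * Real.pi,
        F (circleMap 0 r θ) / (circleMap 0 r θ * conj (circleMap 0 r θ)) *
          conj (circleMap 0 r θ) ^ n = ((r ^ (2 * n - 1) : ℝ) : ℂ) * g := by
      intro r hr
      have hr0 : 0 < r := h0.trans hr.1
      have hrC : (r : ℂ) ≠ 0 := by exact_mod_cast hr0.ne'
      rw [← hgr r hr, ← intervalIntegral.integral_const_mul, ← intervalIntegral.integral_const_mul]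
      congr 1
      ext θ
      have hc0 : circleMap 0 r θ ≠ 0 := circleMap_ne_center hr0.ne'
      have hcc : circleMap 0 r θ * conj (circleMap 0 r θ) = (r : ℂ) ^ 2 := by
        rw [Complex.mul_conj, Complex.normSq_eq_norm_sq, norm_circleMap_zero, sq_abs]
        push_cast; rfl
      have hcc2 : conj (circleMap 0 r θ) = (r : ℂ) ^ 2 / circleMap 0 r θ := by
        rw [eq_div_iff hc0, mul_comm, hcc]
      rw [hcc, hcc2, div_zpow, hG]
      push_cast
      rw [zpow_sub_one₀ hrC, zpow_mul, zpow_neg]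
      field_simp
    rw [setIntegral_congr_fun measurableSet_Ioo e, integral_mul_const, integral_complex_ofReal]
      at hpol
    have hpos : 0 < ∫ r in Set.Ioo ϱ 1, r ^ (2 * n - 1) := by
      rw [← integral_Ioc_eq_integral_Ioo, ← intervalIntegral.integral_of_le h1.le]
      refine intervalIntegral.intervalIntegral_pos_of_pos_on ?_
        (fun r hr => zpow_pos (h0.trans hr.1) _) h1
      refine ContinuousOn.intervalIntegrable ?_
      rw [Set.uIcc_of_le h1.le]
      exact ContinuousOn.zpow₀ continuousOn_id _ fun r hr => Or.inl (h0.trans_le hr.1).ne'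
    have hg0 : g = 0 := by
      rcases mul_eq_zero.1 hpol.symm with h | h
      · exact absurd (by exact_mod_cast h) hpos.ne'
      · exact h
    have hRC : (R : ℂ) ≠ 0 := by exact_mod_cast hR0.ne'
    have e2 : circleCoeff (fun θ => F (circleMap 0 R θ)) n = (R : ℂ) ^ n * g := by
      rw [hg, circleCoeff, ← intervalIntegral.integral_const_mul]
      congr 1
      ext θ
      simp only [hG]
      rw [circleMap_zero, mul_zpow, ← Complex.exp_int_mul, zpow_neg]
      field_simp
      push_cast
      ring_nf
    rw [e2, hg0, mul_zero]
  obtain ⟨c, hc⟩ := eq_const_of_circleCoeff_eq_zero hcont hcoeff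
  exact ⟨c, eqOn_annulus_of_eqOn_arc h0 ⟨hRϱ, hR1⟩ hF fun θ hθ =>
    hc θ ⟨by linarith [hθ.1], by linarith [hθ.2, Real.pi_gt_three]⟩⟩

/-! ### The Hopf differential of a minimizer -/

lemma sqrt_mem_Ioo {ϱ : ℝ} (h0 : 0 < ϱ) (h1 : ϱ < 1) : √ϱ ∈ Set.Ioo ϱ 1 := by
  refine ⟨?_, ?_⟩
  · rw [Real.lt_sqrt h0.le]; nlinarith
  · rw [Real.sqrt_lt' one_pos]; simpa using h1

lemma differentiableOn_hopf {ϱ : ℝ} {U : ℂ → ℂ} (hU : HarmonicOnNhd U (annulus ϱ)) :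
    DifferentiableOn ℂ (hopf U) (annulus ϱ) := fun z hz =>
  (HarmonicAt.differentiableAt_hopf (hU z hz)).differentiableWithinAt

lemma integrableOn_twistDensity {ϱ : ℝ} (h0 : 0 < ϱ) {U : ℂ → ℂ}
    (hU : HarmonicOnNhd U (annulus ϱ)) (hg : IntegrableOn (gradSq U) (annulus ϱ)) (n : ℤ) :
    IntegrableOn (twistDensity U n) (annulus ϱ) := by
  have hm := measurableSet_annulus ϱ
  have hc : ContinuousOn (fun z : ℂ => z / conj z) (annulus ϱ) :=
    continuousOn_id.div (by fun_prop) fun z hz => by simpa using annulus_ne_zero h0 hz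
  have hp : ContinuousOn (fun z : ℂ => conj z ^ n) (annulus ϱ) :=
    ContinuousOn.zpow₀ (by fun_prop) n fun z hz => Or.inl (by simpa using annulus_ne_zero h0 hz)
  have hcont : ContinuousOn (twistDensity U n) (annulus ϱ) :=
    ((differentiableOn_hopf hU).continuousOn.mul hc).mul hp
  -- One bound for both signs of $n$: the power is at most $1$ for $n\ge0$ and at most $\varrho^n$
  -- for $n<0$.
  have hB : ∀ z ∈ annulus ϱ, ‖conj z ^ n‖ ≤ 1 + ϱ ^ n := fun z hz => by
    rw [norm_zpow, RCLike.norm_conj]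
    rcases le_or_gt 0 n with h | h
    · obtain ⟨m, rfl⟩ := Int.eq_ofNat_of_zero_le h
      have : ‖z‖ ^ m ≤ 1 := pow_le_one₀ (norm_nonneg _) hz.2.le
      have : 0 < ϱ ^ m := by positivity
      simp only [zpow_natCast]
      linarith
    · obtain ⟨m, rfl⟩ : ∃ m : ℕ, n = -m := ⟨n.natAbs, by omega⟩
      have h1 := hz.1.le
      have : ‖z‖ ^ (-(m : ℤ)) ≤ ϱ ^ (-(m : ℤ)) := by
        rw [zpow_neg, zpow_neg, zpow_natCast, zpow_natCast]
        gcongr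
      linarith
  refine Integrable.mono' (g := fun z => gradSq U z * (1 + ϱ ^ n)) (hg.mul_const _)
    (hcont.aestronglyMeasurable hm) ?_
  filter_upwards [ae_restrict_mem hm] with z hz
  have hgz : 0 ≤ gradSq U z := by unfold gradSq; positivity
  have hϱn : 0 ≤ ϱ ^ n := by positivity
  rw [twistDensity, norm_mul, norm_mul, norm_div_conj (annulus_ne_zero h0 hz), mul_one]
  have h1 := norm_hopf_le U z
  have h2 := hB z hz
  calc _ ≤ gradSq U z / 4 * (1 + ϱ ^ n) := by gcongr
    _ ≤ _ := by gcongr; linarith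

lemma wirt_of_radialDeriv_eq_zero {U : ℂ → ℂ} {z : ℂ} (hz : z ≠ 0) (h : radialDeriv U z = 0) :
    wirtBar (fderiv ℝ U z) * conj z = -(wirt (fderiv ℝ U z) * z) := by
  rw [radialDeriv, apply_eq_wirt] at h
  have hn : (‖z‖ : ℂ) ≠ 0 := by exact_mod_cast norm_ne_zero_iff.2 hz
  rw [map_div₀, Complex.conj_ofReal] at h
  field_simp at h
  linear_combination h

/-- A vanishing radial derivative means $\bar z\,\partial_{\bar z}U=-z\,\partial_zU$, so the product
defining $z^2\mathcal H_u$ becomes minus a squared modulus. This is the origin of the sign of $c$.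
-/
lemma sq_mul_hopf_of_radialDeriv_eq_zero {U : ℂ → ℂ} {z : ℂ} (hz : z ≠ 0)
    (h : radialDeriv U z = 0) :
    z ^ 2 * hopf U z = ((-(‖wirt (fderiv ℝ U z) * z‖ ^ 2) : ℝ) : ℂ) := by
  have e := congrArg conj (wirt_of_radialDeriv_eq_zero hz h)
  simp only [map_mul, map_neg, Complex.conj_conj] at e
  rw [hopf_eq_wirt, Complex.sq_norm, Complex.ofReal_neg, ← Complex.mul_conj, map_mul]
  linear_combination (wirt (fderiv ℝ U z) * z) * e

/-- With $F=z^2\mathcal H_u$ the twist density is $F\bar z^n/|z|^2$, the integrand of the moment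
criterion `eqOn_const_of_integral_eq_zero`. -/
lemma IsMinimizer.exists_hopf_eq {ϱ : ℝ} (h0 : 0 < ϱ) (h1 : ϱ < 1) {p q : ℤ}
    {u : H1Annulus ϱ} (hu : IsMinimizer u p q) {U : ℂ → ℂ} (hU : HarmonicOnNhd U (annulus ϱ))
    (hu0 : u.toFun = U) (hux : u.dx = fun z => fderiv ℝ U z 1)
    (huy : u.dy = fun z => fderiv ℝ U z Complex.I) :
    ∃ c : ℂ, ∀ z ∈ annulus ϱ, z ^ 2 * hopf U z = c := by
  have hU1 : ContDiffOn ℝ 1 U (annulus ϱ) := (contDiffOn_of_harmonic hU).of_le (by norm_cast)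
  have hg : IntegrableOn (gradSq U) (annulus ϱ) := by
    have h := integrable_energy_density u
    rw [hux, huy] at h
    exact h
  have hm := measurableSet_annulus ϱ
  have e : ∀ n : ℤ, ∀ z ∈ annulus ϱ, twistDensity U n z =
      z ^ 2 * hopf U z / (z * conj z) * conj z ^ n := fun n z hz => by
    have hz0 := annulus_ne_zero h0 hz
    have hz1 : conj z ≠ 0 := by simpa using hz0
    rw [twistDensity]
    field_simp
  refine eqOn_const_of_integral_eq_zero h0 h1
    ((differentiableOn_id.pow 2).mul (differentiableOn_hopf hU)) (fun n _ => ?_) fun n hn => ?_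
  · exact (integrableOn_congr_fun (e n) hm).1 (integrableOn_twistDensity h0 hU hg n)
  · rw [← hu.integral_twistDensity_eq_zero h0 h1 hU1 hu0 hux huy hn
      (integrableOn_twistDensity h0 hU hg n)]
    exact (setIntegral_congr_fun hm (e n)).symm

/-- If the Hopf differential vanishes then the map is constant. -/
lemma exists_eq_const_of_hopf_eq_zero {ϱ : ℝ} (h0 : 0 < ϱ) (h1 : ϱ < 1) {U : ℂ → ℂ}
    (hU : HarmonicOnNhd U (annulus ϱ)) (hr : ∀ z : ℂ, ‖z‖ = √ϱ → radialDeriv U z = 0)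
    (hH : ∀ z ∈ annulus ϱ, hopf U z = 0) : ∃ m, ∀ z ∈ annulus ϱ, U z = m := by
  have hR := sqrt_mem_Ioo h0 h1
  have hR0 : 0 < √ϱ := h0.trans hR.1
  -- On the middle circle $z^2\mathcal H_u=-|z\,\partial_zU|^2$, so both Wirtinger derivatives
  -- vanish there; the identity theorem then spreads this to the annulus.
  have hw : ∀ θ, wirt (fderiv ℝ U (circleMap 0 (√ϱ) θ)) = 0 ∧
      wirtBar (fderiv ℝ U (circleMap 0 (√ϱ) θ)) = 0 := by
    intro θ
    have hz0 : circleMap 0 (√ϱ) θ ≠ 0 := circleMap_ne_center hR0.ne'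
    have hz1 : conj (circleMap 0 (√ϱ) θ) ≠ 0 := by simpa using hz0
    have hrz := hr (circleMap 0 (√ϱ) θ) (by simp [abs_of_pos hR0])
    have e := sq_mul_hopf_of_radialDeriv_eq_zero hz0 hrz
    rw [hH _ ((circleMap_mem_annulus hR0 θ).2 hR), mul_zero] at e
    have e' : ‖wirt (fderiv ℝ U (circleMap 0 (√ϱ) θ)) * circleMap 0 (√ϱ) θ‖ ^ 2 = 0 := by
      have : (0 : ℝ) = -(‖wirt (fderiv ℝ U (circleMap 0 (√ϱ) θ)) * circleMap 0 (√ϱ) θ‖ ^ 2) := by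
        exact_mod_cast e
      linarith
    have e1 : wirt (fderiv ℝ U (circleMap 0 (√ϱ) θ)) = 0 := by
      rw [sq_eq_zero_iff, norm_eq_zero, mul_eq_zero] at e'
      exact e'.resolve_right hz0
    refine ⟨e1, ?_⟩
    have e2 := wirt_of_radialDeriv_eq_zero hz0 hrz
    rw [e1, zero_mul, neg_zero, mul_eq_zero] at e2
    exact e2.resolve_right hz1
  have k1 := eqOn_annulus_of_eqOn_arc h0 hR (F := fun w => wirt (fderiv ℝ U w)) (c := 0)
    (fun z hz => (HarmonicAt.differentiableAt_wirt (hU z hz)).differentiableWithinAt)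
    fun θ _ => (hw θ).1
  have k2 := eqOn_annulus_of_eqOn_arc h0 hR (F := fun w => conj (wirtBar (fderiv ℝ U w))) (c := 0)
    (fun z hz => (HarmonicAt.differentiableAt_conj_wirtBar (hU z hz)).differentiableWithinAt)
    fun θ _ => by simp only [(hw θ).2, map_zero]
  obtain ⟨m, hm⟩ := (isOpen_annulus ϱ).exists_is_const_of_fderiv_eq_zero (𝕜 := ℝ)
    (isPreconnected_annulus h0) ((contDiffOn_of_harmonic hU).differentiableOn (by simp))
    fun z hz => eq_zero_of_wirt (k1 z hz) (by simpa using k2 z hz)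
  exact ⟨m, hm⟩

/-! ### The degree is bounded by the `H^{1/2}` seminorm -/

lemma exp_neg_mul_two_pi_periodic (n : ℤ) :
    Function.Periodic (fun x : ℝ => Complex.exp (-(n * x * Complex.I))) (2 * Real.pi) := fun x => by
  have e : -((n : ℂ) * ((x + 2 * Real.pi : ℝ) : ℂ) * Complex.I) =
      -(n * x * Complex.I) + ((-n : ℤ) : ℂ) * (2 * Real.pi * Complex.I) := by
    push_cast; ring
  simp only [e, Complex.exp_add, Complex.exp_int_mul_two_pi_mul_I, mul_one]

lemma circleCoeff_deriv {f : ℝ → ℂ} (hf : IsSmoothCircleMap f) (n : ℤ) :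
    circleCoeff (deriv f) n = n * Complex.I * circleCoeff f n := by
  have hfd : Differentiable ℝ f := hf.1.differentiable (by simp)
  have hcd : Continuous (deriv f) := hf.1.continuous_deriv (by simp)
  have hc := hf.1.continuous
  have hd : ∀ x : ℝ, HasDerivAt (fun x : ℝ => Complex.exp (-(n * x * Complex.I)) * f x)
      (Complex.exp (-(n * x * Complex.I)) * deriv f x -
        n * Complex.I * (Complex.exp (-(n * x * Complex.I)) * f x)) x := fun x => by
    have h1 : HasDerivAt (fun x : ℝ => -((n : ℂ) * x * Complex.I)) (-(n * 1 * Complex.I)) x :=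
      (((Complex.ofRealCLM.hasDerivAt (x := x)).const_mul (n : ℂ)).mul_const Complex.I).neg
    refine (h1.cexp.mul (hfd x).hasDerivAt).congr_deriv ?_
    ring
  have h := intervalIntegral.integral_eq_sub_of_hasDerivAt (a := 0) (b := 2 * Real.pi)
    (fun x _ => hd x) (Continuous.intervalIntegrable (by fun_prop) _ _)
  have e : Complex.exp (-(n * (2 * Real.pi : ℝ) * Complex.I)) * f (2 * Real.pi) =
      Complex.exp (-(n * (0 : ℝ) * Complex.I)) * f 0 := by
    have h1 := exp_neg_mul_two_pi_periodic n 0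
    have h2 := hf.2.1 0
    rw [zero_add] at h1 h2
    simp only at h1
    rw [h1, h2]
  rw [e, sub_self, intervalIntegral.integral_sub (Continuous.intervalIntegrable (by fun_prop) _ _)
    (Continuous.intervalIntegrable (by fun_prop) _ _), intervalIntegral.integral_const_mul] at h
  exact sub_eq_zero.1 h

lemma circleCoeff_const_mul (a : ℂ) (f : ℝ → ℂ) (n : ℤ) :
    circleCoeff (fun x => a * f x) n = a * circleCoeff f n := by
  unfold circleCoeff
  rw [← intervalIntegral.integral_const_mul]
  congr 1
  ext x
  ring

/-- Parseval after polarization: $f\wedge f'=\tfrac12(|f-if'|^2-|f|^2-|f'|^2)$, and the coefficients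
of $f-if'$ are $(1+n)$ times those of $f$. -/
lemma hasSum_smoothDegree {f : ℝ → ℂ} (hf : IsSmoothCircleMap f) :
    HasSum (fun n : ℤ => (n : ℝ) * ‖circleCoeff f n‖ ^ 2)
      ((2 * Real.pi) ^ 2 * smoothDegree f) := by
  have hcd : Continuous (deriv f) := hf.1.continuous_deriv (by simp)
  have hc := hf.1.continuous
  have h1 := hasSum_sq_circleCoeff hc
  have h2 := hasSum_sq_circleCoeff hcd
  have h3 := hasSum_sq_circleCoeff (f := fun x => f x - Complex.I * deriv f x) (by fun_prop)
  have h := ((h3.sub h1).sub h2).mul_left (1 / 2)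
  have e : ∀ n : ℤ, 1 / 2 * (‖circleCoeff (fun x => f x - Complex.I * deriv f x) n‖ ^ 2 -
      ‖circleCoeff f n‖ ^ 2 - ‖circleCoeff (deriv f) n‖ ^ 2) = n * ‖circleCoeff f n‖ ^ 2 := by
    intro n
    have e1 : circleCoeff (fun x => f x - Complex.I * deriv f x) n =
        ((1 + n : ℝ) : ℂ) * circleCoeff f n := by
      rw [circleCoeff_sub hc (by fun_prop), circleCoeff_const_mul, circleCoeff_deriv hf]
      push_cast
      linear_combination -n * circleCoeff f n * Complex.I_sq
    rw [e1, circleCoeff_deriv hf, norm_mul, norm_mul, norm_mul, Complex.norm_real,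
      Complex.norm_intCast, Complex.norm_I, Real.norm_eq_abs, mul_pow, mul_pow, mul_pow, sq_abs,
      sq_abs]
    ring
  simp_rw [e] at h
  have e2 : ∀ x, wedge (f x) (deriv f x) =
      1 / 2 * (‖f x - Complex.I * deriv f x‖ ^ 2 - ‖f x‖ ^ 2 - ‖deriv f x‖ ^ 2) := fun x => by
    simp only [wedge, Complex.sq_norm, Complex.normSq_apply]
    simp
    ring
  have e3 : 1 / 2 * (2 * Real.pi * (∫ x in (0 : ℝ)..2 * Real.pi,
      ‖f x - Complex.I * deriv f x‖ ^ 2) - 2 * Real.pi * (∫ x in (0 : ℝ)..2 * Real.pi, ‖f x‖ ^ 2) -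
        2 * Real.pi * ∫ x in (0 : ℝ)..2 * Real.pi, ‖deriv f x‖ ^ 2) =
      (2 * Real.pi) ^ 2 * smoothDegree f := by
    rw [smoothDegree]
    simp_rw [e2]
    rw [intervalIntegral.integral_const_mul, intervalIntegral.integral_sub
      (Continuous.intervalIntegrable (by fun_prop) _ _)
      (Continuous.intervalIntegrable (by fun_prop) _ _), intervalIntegral.integral_sub
      (Continuous.intervalIntegrable (by fun_prop) _ _)
      (Continuous.intervalIntegrable (by fun_prop) _ _)]
    have := Real.pi_ne_zero
    field_simp
  rwa [e3] at h

lemma circleCoeff_shift {f : ℝ → ℂ} (hf : Function.Periodic f (2 * Real.pi)) (h : ℝ) (n : ℤ) :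
    circleCoeff (fun x => f (x + h)) n = Complex.exp (Complex.I * ((n * h : ℝ) : ℂ)) *
      circleCoeff f n := by
  set G : ℝ → ℂ := fun x => Complex.exp (-(n * x * Complex.I)) * f x with hG
  have hGp : Function.Periodic G (2 * Real.pi) := (exp_neg_mul_two_pi_periodic n).mul hf
  have e : ∀ x : ℝ, Complex.exp (-(n * x * Complex.I)) * f (x + h) =
      Complex.exp (Complex.I * ((n * h : ℝ) : ℂ)) * G (x + h) := fun x => by
    simp only [hG]
    rw [← mul_assoc, ← Complex.exp_add]
    push_cast
    ring_nf
  unfold circleCoeff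
  simp_rw [e]
  rw [intervalIntegral.integral_const_mul, intervalIntegral.integral_comp_add_right, zero_add,
    add_comm (2 * Real.pi) h, hGp.intervalIntegral_add_eq h 0, zero_add]

lemma tsum_shift_sub {f : ℝ → ℂ} (hf : Continuous f) (hp : Function.Periodic f (2 * Real.pi))
    (h : ℝ) :
    ∑' n : ℤ, ‖Complex.exp (Complex.I * ((n * h : ℝ) : ℂ)) - 1‖ₑ ^ 2 * ‖circleCoeff f n‖ₑ ^ 2 =
      ENNReal.ofReal (2 * Real.pi) * ∫⁻ x, ‖f x - f (x + h)‖ₑ ^ 2 ∂angleMeasure := by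
  have hs := hasSum_sq_circleCoeff (f := fun x => f (x + h) - f x) (by fun_prop)
  have e : ∀ n : ℤ, ‖Complex.exp (Complex.I * ((n * h : ℝ) : ℂ)) - 1‖ₑ ^ 2 *
      ‖circleCoeff f n‖ₑ ^ 2 =
      ENNReal.ofReal (‖circleCoeff (fun x => f (x + h) - f x) n‖ ^ 2) := fun n => by
    rw [circleCoeff_sub (by fun_prop) hf, circleCoeff_shift hp, ← enorm_sq_eq_ofReal, ← mul_pow,
      ← enorm_mul, sub_mul, one_mul]
  simp_rw [e]
  rw [← ENNReal.ofReal_tsum_of_nonneg (fun _ => by positivity) hs.summable, hs.tsum_eq,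
    ENNReal.ofReal_mul Real.two_pi_pos.le,
    intervalIntegral.integral_of_le Real.two_pi_pos.le, ofReal_integral_eq_lintegral_ofReal]
  · congr 1
    refine lintegral_congr fun x => ?_
    rw [← enorm_sq_eq_ofReal, ← enorm_neg, neg_sub]
  · exact (Continuous.integrableOn_Icc (by fun_prop)).mono_set Set.Ioc_subset_Icc_self
  · exact Eventually.of_forall fun x => by positivity

/-- Only $0<h\le\pi/|n|$ is needed. There the numerator is at least $2|n|h/\pi$ by Jordan's
inequality and the denominator at most $h$, so the integral is at least
$(2|n|/\pi)^2\cdot\pi/|n|=4|n|/\pi\ge|n|$. -/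
lemma natAbs_le_lintegral_ratio (n : ℤ) :
    ENNReal.ofReal |(n : ℝ)| ≤ ∫⁻ h, (‖Complex.exp (Complex.I * ((n * h : ℝ) : ℂ)) - 1‖ₑ /
      ‖Complex.exp (Complex.I * (h : ℂ)) - 1‖ₑ) ^ 2 ∂angleMeasure := by
  rcases eq_or_ne n 0 with rfl | hn
  · simp
  have hπ := Real.pi_pos
  have hn1 : (1 : ℝ) ≤ |(n : ℝ)| := by exact_mod_cast Int.one_le_abs hn
  have hn0 : 0 < |(n : ℝ)| := by linarith
  have hsub : Set.Ioc 0 (Real.pi / |(n : ℝ)|) ⊆ Set.Ioc 0 (2 * Real.pi) := by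
    refine Set.Ioc_subset_Ioc_right ?_
    rw [div_le_iff₀ hn0]
    nlinarith
  calc ENNReal.ofReal |(n : ℝ)|
      ≤ ∫⁻ _ in Set.Ioc 0 (Real.pi / |(n : ℝ)|), ENNReal.ofReal ((2 * |(n : ℝ)| / Real.pi) ^ 2) := by
        rw [lintegral_const, Measure.restrict_apply_univ, Real.volume_Ioc, sub_zero,
          ← ENNReal.ofReal_mul (by positivity)]
        refine ENNReal.ofReal_le_ofReal ?_
        have : (2 * |(n : ℝ)| / Real.pi) ^ 2 * (Real.pi / |(n : ℝ)|) = 4 * |(n : ℝ)| / Real.pi := by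
          field_simp
          ring
        rw [this, le_div_iff₀ hπ]
        nlinarith [Real.pi_lt_four]
    _ ≤ ∫⁻ h in Set.Ioc 0 (Real.pi / |(n : ℝ)|),
        (‖Complex.exp (Complex.I * ((n * h : ℝ) : ℂ)) - 1‖ₑ /
          ‖Complex.exp (Complex.I * (h : ℂ)) - 1‖ₑ) ^ 2 := by
        refine setLIntegral_mono' measurableSet_Ioc fun h hh => ?_
        rw [ENNReal.ofReal_pow (by positivity)]
        gcongr
        have hle : ‖Complex.exp (Complex.I * (h : ℂ)) - 1‖ₑ ≤ ENNReal.ofReal h := by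
          rw [← ofReal_norm]
          refine ENNReal.ofReal_le_ofReal (Real.norm_exp_I_mul_ofReal_sub_one_le.trans ?_)
          rw [Real.norm_eq_abs, abs_of_pos hh.1]
        have hge : ENNReal.ofReal (2 * |(n : ℝ)| / Real.pi * h) ≤
            ‖Complex.exp (Complex.I * ((n * h : ℝ) : ℂ)) - 1‖ₑ := by
          rw [← ofReal_norm, Complex.norm_exp_I_mul_ofReal_sub_one, norm_mul, Real.norm_eq_abs,
            Real.norm_eq_abs, abs_two]
          refine ENNReal.ofReal_le_ofReal ?_
          have habs : |(n * h / 2 : ℝ)| = |(n : ℝ)| * h / 2 := by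
            rw [abs_div, abs_mul, abs_of_pos hh.1, abs_two]
          have hb : |(n * h / 2 : ℝ)| ≤ Real.pi / 2 := by
            rw [habs]
            have := hh.2
            rw [le_div_iff₀ hn0] at this
            linarith
          have := Real.mul_abs_le_abs_sin hb
          rw [habs] at this
          have e : 2 * |(n : ℝ)| / Real.pi * h = 2 * (2 / Real.pi * (|(n : ℝ)| * h / 2)) := by ring
          linarith
        calc ENNReal.ofReal (2 * |(n : ℝ)| / Real.pi)
            = ENNReal.ofReal (2 * |(n : ℝ)| / Real.pi * h) / ENNReal.ofReal h := by
              rw [← ENNReal.ofReal_div_of_pos hh.1, mul_div_cancel_right₀ _ hh.1.ne']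
          _ ≤ _ := ENNReal.div_le_div hge hle
    _ ≤ _ := lintegral_mono_set hsub

/-- The squared `H^{1/2}` seminorm of a function on the circle. -/
def circleSeminormSq (w : ℝ → ℂ) : ℝ≥0∞ :=
  ∫⁻ s, ∫⁻ t, (‖w s - w t‖ₑ / ‖circleMap 0 1 s - circleMap 0 1 t‖ₑ) ^ 2 ∂angleMeasure ∂angleMeasure

lemma lintegral_angleMeasure_add_left {G : ℝ → ℝ≥0∞} (hG : Function.Periodic G (2 * Real.pi))
    (s : ℝ) : ∫⁻ h, G (s + h) ∂angleMeasure = ∫⁻ t, G t ∂angleMeasure := by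
  have h := setLIntegral_Ioc_of_periodic hG s 0
  rw [zero_add] at h
  rw [angleMeasure, ← h, ← lintegral_indicator measurableSet_Ioc,
    ← lintegral_indicator measurableSet_Ioc, ← lintegral_add_left_eq_self ((Set.Ioc s (s + 2 * Real.pi)).indicator G) s]
  congr 1
  ext t
  simp [Set.indicator]

lemma enorm_circleMap_sub_add (s h : ℝ) : ‖circleMap 0 1 s - circleMap 0 1 (s + h)‖ₑ =
    ‖Complex.exp (Complex.I * (h : ℂ)) - 1‖ₑ := by
  have : circleMap 0 1 s - circleMap 0 1 (s + h) =
      circleMap 0 1 s * (1 - Complex.exp (Complex.I * (h : ℂ))) := by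
    simp only [circleMap_zero, mul_sub, mul_one, Complex.ofReal_one, one_mul, ← Complex.exp_add]
    push_cast
    ring_nf
  rw [this, enorm_mul, ← enorm_neg (1 - _), neg_sub, ← ofReal_norm (circleMap 0 1 s)]
  simp

/-- Substituting $t=s+h$ makes the chord length depend on $h$ alone, so Parseval applies for each
shift. -/
lemma circleSeminormSq_eq {f : ℝ → ℂ} (hf : Continuous f)
    (hp : Function.Periodic f (2 * Real.pi)) :
    circleSeminormSq f = ∫⁻ h, (∫⁻ s, ‖f s - f (s + h)‖ₑ ^ 2 ∂angleMeasure) *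
      (‖Complex.exp (Complex.I * (h : ℂ)) - 1‖ₑ ^ 2)⁻¹ ∂angleMeasure := by
  have e : ∀ s, ∫⁻ t, (‖f s - f t‖ₑ / ‖circleMap 0 1 s - circleMap 0 1 t‖ₑ) ^ 2 ∂angleMeasure =
      ∫⁻ h, ‖f s - f (s + h)‖ₑ ^ 2 * (‖Complex.exp (Complex.I * (h : ℂ)) - 1‖ₑ ^ 2)⁻¹
        ∂angleMeasure := fun s => by
    rw [← lintegral_angleMeasure_add_left (s := s) fun t => by
      simp only [hp t, periodic_circleMap 0 1 t]]
    refine lintegral_congr fun h => ?_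
    rw [enorm_circleMap_sub_add, div_eq_mul_inv, mul_pow, ENNReal.inv_pow]
  unfold circleSeminormSq
  simp_rw [e]
  have : SFinite angleMeasure := by unfold angleMeasure; infer_instance
  rw [lintegral_lintegral_swap]
  · refine lintegral_congr fun h => ?_
    rw [lintegral_mul_const]
    fun_prop
  · apply Measurable.aemeasurable
    unfold Function.uncurry
    fun_prop

/-- The degree of a smooth circle map is bounded by its `H^{1/2}` seminorm. -/
lemma abs_smoothDegree_le {f : ℝ → ℂ} (hf : IsSmoothCircleMap f) :
    ENNReal.ofReal ((2 * Real.pi) ^ 2 * |smoothDegree f|) ≤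
      ENNReal.ofReal (2 * Real.pi) * circleSeminormSq f := by
  have hc := hf.1.continuous
  have hs := hasSum_smoothDegree hf
  calc ENNReal.ofReal ((2 * Real.pi) ^ 2 * |smoothDegree f|)
      = ‖∑' n : ℤ, (n : ℝ) * ‖circleCoeff f n‖ ^ 2‖ₑ := by
        rw [hs.tsum_eq, ← ofReal_norm, Real.norm_eq_abs, abs_mul,
          abs_of_nonneg (by positivity : (0 : ℝ) ≤ (2 * Real.pi) ^ 2)]
    _ ≤ ∑' n : ℤ, ‖(n : ℝ) * ‖circleCoeff f n‖ ^ 2‖ₑ := enorm_tsum_le_tsum_enorm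
    -- The weight $|n|$ is traded for an integral over shifts; summing first, each shift gives the
    -- $L^2$ norm of a difference of $f$.
    _ ≤ ∑' n : ℤ, ∫⁻ h, ‖Complex.exp (Complex.I * ((n * h : ℝ) : ℂ)) - 1‖ₑ ^ 2 *
          ‖circleCoeff f n‖ₑ ^ 2 * (‖Complex.exp (Complex.I * (h : ℂ)) - 1‖ₑ ^ 2)⁻¹
          ∂angleMeasure := by
        refine ENNReal.tsum_le_tsum fun n => ?_
        rw [enorm_mul, enorm_pow, enorm_norm, ← ofReal_norm (n : ℝ), Real.norm_eq_abs]
        refine (mul_le_mul_left (natAbs_le_lintegral_ratio n) _).trans (le_of_eq ?_)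
        rw [← lintegral_mul_const' _ _ (by finiteness)]
        refine lintegral_congr fun h => ?_
        rw [div_eq_mul_inv, mul_pow, ENNReal.inv_pow]
        ring
    _ = ∫⁻ h, ∑' n : ℤ, ‖Complex.exp (Complex.I * ((n * h : ℝ) : ℂ)) - 1‖ₑ ^ 2 *
          ‖circleCoeff f n‖ₑ ^ 2 * (‖Complex.exp (Complex.I * (h : ℂ)) - 1‖ₑ ^ 2)⁻¹
          ∂angleMeasure := by
        rw [lintegral_tsum]
        intro n
        fun_prop
    _ = _ := by
        rw [circleSeminormSq_eq hc hf.2.1, ← lintegral_const_mul' _ _ (by finiteness)]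
        refine lintegral_congr fun h => ?_
        rw [ENNReal.tsum_mul_right, tsum_shift_sub hc hf.2.1, mul_assoc]

/-- Subtracting a constant does not change the seminorm, so the smooth approximants have seminorm
tending to zero, while their fixed degree is bounded by it. -/
lemma not_hasDegree_of_ae_eq_const {g : ℝ → ℂ} {m : ℂ} (hg : ∀ᵐ θ ∂angleMeasure, g θ = m) {d : ℤ}
    (hd : d ≠ 0) : ¬ HasDegree g d := by
  rintro ⟨f, hf, ht⟩
  have hle : ∀ n, circleSeminormSq (f n) ≤ hHalfNormSq (fun θ => f n θ - g θ) := fun n => by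
    refine le_trans (le_of_eq ?_) le_add_self
    refine lintegral_congr_ae ?_
    filter_upwards [hg] with s hs
    refine lintegral_congr_ae ?_
    filter_upwards [hg] with t ht
    rw [hs, ht, sub_sub_sub_cancel_right]
  have h0 : Tendsto (fun n => ENNReal.ofReal (2 * Real.pi) *
      hHalfNormSq (fun θ => f n θ - g θ)) atTop (𝓝 0) := by
    have := ENNReal.Tendsto.const_mul (a := ENNReal.ofReal (2 * Real.pi)) ht
      (Or.inr (by finiteness))
    rwa [mul_zero] at this
  have hbound : ENNReal.ofReal ((2 * Real.pi) ^ 2 * |(d : ℝ)|) ≤ 0 :=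
    ge_of_tendsto' h0 fun n => by
      have := abs_smoothDegree_le (hf n).1
      rw [(hf n).2] at this
      exact this.trans (by gcongr; exact hle n)
  rw [nonpos_iff_eq_zero, ENNReal.ofReal_eq_zero] at hbound
  have : 0 < (2 * Real.pi) ^ 2 * |(d : ℝ)| := by
    have : (d : ℝ) ≠ 0 := by exact_mod_cast hd
    have := Real.pi_pos
    positivity
  linarith

/-! ### Constant maps have constant traces -/

lemma norm_sq_fderiv_circleMap_le (L : ℂ →L[ℝ] ℂ) (θ : ℝ) :
    ‖L (circleMap 0 1 θ)‖ ^ 2 ≤ 2 * (‖L 1‖ ^ 2 + ‖L Complex.I‖ ^ 2) := by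
  rw [apply_eq_wirt, norm_sq_add_norm_sq_eq_wirt]
  have h := norm_add_le (wirt L * circleMap 0 1 θ) (wirtBar L * conj (circleMap 0 1 θ))
  simp only [norm_mul, RCLike.norm_conj, norm_circleMap_zero, abs_one, mul_one] at h
  have h2 := pow_le_pow_left₀ (norm_nonneg _) h 2
  nlinarith [sq_nonneg (‖wirt L‖ - ‖wirtBar L‖), norm_nonneg (wirt L), norm_nonneg (wirtBar L)]

/-- The integrand of the squared `H¹` norm. -/
def sobolevDensity (w : ℂ → ℂ) (z : ℂ) : ℝ :=
  ‖w z‖ ^ 2 + 2 * (‖fderiv ℝ w z 1‖ ^ 2 + ‖fderiv ℝ w z Complex.I‖ ^ 2)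

lemma continuous_sobolevDensity {w : ℂ → ℂ} (hw : ContDiff ℝ ∞ w) :
    Continuous (sobolevDensity w) := by
  have h1 := hw.continuous
  have h2 : Continuous (fderiv ℝ w) := hw.continuous_fderiv (by simp)
  unfold sobolevDensity
  fun_prop

/-- The trace inequality along one ray: $|w|^2$ at radius $1$ is its value at radius $r$ plus the
integral of its radial derivative, and $2ab\le a^2+b^2$. -/
lemma norm_sq_circleMap_one_le {ϱ : ℝ} {w : ℂ → ℂ} (hw : ContDiff ℝ ∞ w) {r : ℝ}
    (hr : r ∈ Set.Ioo ϱ 1) (θ : ℝ) :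
    ENNReal.ofReal (‖w (circleMap 0 1 θ)‖ ^ 2) ≤
      ENNReal.ofReal (sobolevDensity w (circleMap 0 r θ)) +
        ∫⁻ s in Set.Ioo ϱ 1, ENNReal.ofReal (sobolevDensity w (circleMap 0 s θ)) := by
  set e := circleMap 0 1 θ with he
  have hse : ∀ s : ℝ, circleMap 0 s θ = s • e := fun s => by
    rw [circleMap_eq_mul s θ, Complex.real_smul]
  have hwd : Differentiable ℝ w := hw.differentiable (by simp)
  have hd : ∀ s : ℝ, HasDerivAt (fun s : ℝ => ‖w (s • e)‖ ^ 2)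
      (2 * inner ℝ (w (s • e)) (fderiv ℝ w (s • e) e)) s := fun s => by
    have h1 : HasDerivAt (fun s : ℝ => s • e) e s := by
      simpa using (hasDerivAt_id s).smul_const e
    exact ((hwd (s • e)).hasFDerivAt.comp_hasDerivAt s h1).norm_sq
  have hc1 : Continuous w := hw.continuous
  have hc2 : Continuous (fderiv ℝ w) := hw.continuous_fderiv (by simp)
  have hcd : Continuous fun s : ℝ => sobolevDensity w (s • e) :=
    (continuous_sobolevDensity hw).comp (by fun_prop)
  have h := intervalIntegral.integral_eq_sub_of_hasDerivAt (a := r) (b := 1)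
    (fun s _ => hd s) (Continuous.intervalIntegrable (by fun_prop) _ _)
  have hb : ∀ s : ℝ, 2 * inner ℝ (w (s • e)) (fderiv ℝ w (s • e) e) ≤
      sobolevDensity w (s • e) := fun s => by
    have h1 := norm_sq_fderiv_circleMap_le (fderiv ℝ w (s • e)) θ
    have h2 := real_inner_le_norm (w (s • e)) (fderiv ℝ w (s • e) e)
    unfold sobolevDensity
    nlinarith [sq_nonneg (‖w (s • e)‖ - ‖fderiv ℝ w (s • e) e‖)]
  have hI : ∫ s in r..1, 2 * inner ℝ (w (s • e)) (fderiv ℝ w (s • e) e) ≤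
      ∫ s in r..1, sobolevDensity w (s • e) :=
    intervalIntegral.integral_mono_on hr.2.le (Continuous.intervalIntegrable (by fun_prop) _ _)
      (hcd.intervalIntegrable _ _) fun s _ => hb s
  rw [h, one_smul] at hI
  have hn : ∀ z, 0 ≤ sobolevDensity w z := fun z => by unfold sobolevDensity; positivity
  have hr' : ‖w (r • e)‖ ^ 2 ≤ sobolevDensity w (r • e) := by
    unfold sobolevDensity
    have : 0 ≤ 2 * (‖fderiv ℝ w (r • e) 1‖ ^ 2 + ‖fderiv ℝ w (r • e) Complex.I‖ ^ 2) := by positivity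
    linarith
  calc ENNReal.ofReal (‖w e‖ ^ 2)
      ≤ ENNReal.ofReal (sobolevDensity w (r • e) + ∫ s in r..1, sobolevDensity w (s • e)) :=
        ENNReal.ofReal_le_ofReal (by linarith)
    _ = ENNReal.ofReal (sobolevDensity w (r • e)) +
        ∫⁻ s in Set.Ioc r 1, ENNReal.ofReal (sobolevDensity w (s • e)) := by
        rw [ENNReal.ofReal_add (hn _) (intervalIntegral.integral_nonneg hr.2.le fun s _ => hn _),
          intervalIntegral.integral_of_le hr.2.le, ofReal_integral_eq_lintegral_ofReal
            (hcd.integrableOn_Icc.mono_set Set.Ioc_subset_Icc_self)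
            (Eventually.of_forall fun s => hn _)]
    _ ≤ _ := by
        simp only [hse]
        rw [← setLIntegral_congr Ioo_ae_eq_Ioc]
        exact add_le_add le_rfl (lintegral_mono_set (Set.Ioo_subset_Ioo_left hr.1.le))

/-- Averaging the ray inequality over the angle and over the starting radius in $(\varrho,1)$; the
weight $r\ge\varrho$ of polar coordinates explains the factor `ϱ`. -/
lemma lintegral_circle_le {ϱ : ℝ} (h0 : 0 < ϱ) {w : ℂ → ℂ} (hw : ContDiff ℝ ∞ w) :
    ENNReal.ofReal (1 - ϱ) * (ENNReal.ofReal ϱ *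
      ∫⁻ θ, ENNReal.ofReal (‖w (circleMap 0 1 θ)‖ ^ 2) ∂angleMeasure) ≤
        2 * ∫⁻ z in annulus ϱ, ENNReal.ofReal (sobolevDensity w z) := by
  have hSF : SFinite angleMeasure := by unfold angleMeasure; infer_instance
  have hcd := continuous_sobolevDensity hw
  set D : ℂ → ℝ≥0∞ := fun z => ENNReal.ofReal (sobolevDensity w z) with hD
  have hDm : Continuous D := ENNReal.continuous_ofReal.comp hcd
  set T := ∫⁻ z in annulus ϱ, D z with hT
  have hpol : T = ∫⁻ r in Set.Ioo ϱ 1, ENNReal.ofReal r *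
      ∫⁻ θ, D (circleMap 0 r θ) ∂angleMeasure := lintegral_annulus h0 hDm.measurable
  have hcm : Continuous fun p : ℝ × ℝ => circleMap 0 p.2 p.1 := by
    unfold circleMap; fun_prop
  have hJ : ENNReal.ofReal ϱ * ∫⁻ θ, (∫⁻ s in Set.Ioo ϱ 1, D (circleMap 0 s θ)) ∂angleMeasure ≤ T := by
    rw [lintegral_lintegral_swap (f := fun θ s => D (circleMap 0 s θ)) (hDm.comp hcm).measurable.aemeasurable, hpol,
      ← lintegral_const_mul' _ _ (by finiteness)]
    refine setLIntegral_mono' measurableSet_Ioo fun r hr => ?_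
    gcongr
    exact hr.1.le
  have hm2 : ∀ r, Measurable fun θ => D (circleMap 0 r θ) := fun r =>
    (hDm.comp (continuous_circleMap 0 r)).measurable
  have hpt : ∀ r ∈ Set.Ioo ϱ 1, ENNReal.ofReal ϱ *
      ∫⁻ θ, ENNReal.ofReal (‖w (circleMap 0 1 θ)‖ ^ 2) ∂angleMeasure ≤
      ENNReal.ofReal r * (∫⁻ θ, D (circleMap 0 r θ) ∂angleMeasure) + T := fun r hr => by
    calc _ ≤ ENNReal.ofReal ϱ * ∫⁻ θ, (D (circleMap 0 r θ) +
          ∫⁻ s in Set.Ioo ϱ 1, D (circleMap 0 s θ)) ∂angleMeasure := by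
          gcongr with θ
          exact norm_sq_circleMap_one_le hw hr θ
      _ = ENNReal.ofReal ϱ * (∫⁻ θ, D (circleMap 0 r θ) ∂angleMeasure) + ENNReal.ofReal ϱ *
          ∫⁻ θ, (∫⁻ s in Set.Ioo ϱ 1, D (circleMap 0 s θ)) ∂angleMeasure := by
          rw [lintegral_add_left (hm2 r), mul_add]
      _ ≤ _ := by
          refine add_le_add ?_ hJ
          gcongr
          exact hr.1.le
  calc _ = ∫⁻ _ in Set.Ioo ϱ 1, ENNReal.ofReal ϱ *
        ∫⁻ θ, ENNReal.ofReal (‖w (circleMap 0 1 θ)‖ ^ 2) ∂angleMeasure := by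
        rw [setLIntegral_const, Real.volume_Ioo, mul_comm]
    _ ≤ ∫⁻ r in Set.Ioo ϱ 1, (ENNReal.ofReal r * (∫⁻ θ, D (circleMap 0 r θ) ∂angleMeasure) + T) :=
        setLIntegral_mono' measurableSet_Ioo hpt
    _ = T + ENNReal.ofReal (1 - ϱ) * T := by
        rw [lintegral_add_right _ measurable_const, ← hpol, setLIntegral_const, Real.volume_Ioo,
          mul_comm T]
    _ ≤ T + 1 * T := by
        gcongr
        rw [ENNReal.ofReal_le_one]
        linarith
    _ = 2 * T := by ring

/-- The trace inequality for $\varphi_n-m$ shows that the boundary values of the approximants tend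
to $m$ in $L^2$ of the outer circle. -/
lemma ae_eq_const_of_isTrace {ϱ : ℝ} (h0 : 0 < ϱ) (h1 : ϱ < 1) {u : H1Annulus ϱ} {m : ℂ}
    (hu : ∀ z ∈ annulus ϱ, u.toFun z = m) (hx : ∀ z ∈ annulus ϱ, u.dx z = 0)
    (hy : ∀ z ∈ annulus ϱ, u.dy z = 0) {g : ℂ → ℂ} (hg : IsTrace u g) :
    ∀ᵐ θ ∂angleMeasure, onCircle g 1 θ = m := by
  obtain ⟨hgm, φ, hφ, hd, hb⟩ := hg
  have hm1 := hgm 1 (by simp)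
  have hb1 := hb 1 (by simp)
  have hT : ∀ n, ∫⁻ z in annulus ϱ, ENNReal.ofReal (sobolevDensity (fun z => φ n z - m) z) ≤
      2 * h1DistSq u (φ n) := fun n => by
    rw [h1DistSq, ← lintegral_const_mul' _ _ (by finiteness)]
    refine setLIntegral_mono' (measurableSet_annulus ϱ) fun z hz => ?_
    rw [hu z hz, hx z hz, hy z hz, sub_zero, sub_zero, enorm_sq_eq_ofReal, enorm_sq_eq_ofReal,
      enorm_sq_eq_ofReal, ← ENNReal.ofReal_add (by positivity) (by positivity),
      ← ENNReal.ofReal_add (by positivity) (by positivity), ← ENNReal.ofReal_ofNat 2,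
      ← ENNReal.ofReal_mul zero_le_two]
    refine ENNReal.ofReal_le_ofReal ?_
    simp only [sobolevDensity, fderiv_sub_const]
    nlinarith [sq_nonneg ‖φ n z - m‖]
  set K := ENNReal.ofReal (1 - ϱ) * ENNReal.ofReal ϱ with hK
  have hK0 : K ≠ 0 := by
    rw [hK]
    simp [h1, h0]
  have hKt : K ≠ ⊤ := by rw [hK]; finiteness
  have hpt : ∀ n, K * ∫⁻ θ, ‖m - onCircle g 1 θ‖ₑ ^ 2 ∂angleMeasure ≤
      2 * (2 * (2 * h1DistSq u (φ n))) +
        2 * (K * ∫⁻ θ, ‖onCircle (φ n) 1 θ - onCircle g 1 θ‖ₑ ^ 2 ∂angleMeasure) := fun n => by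
    have hc : Continuous (onCircle (φ n) 1) := (hφ n).continuous.comp (continuous_circleMap 0 1)
    have h2 := lintegral_circle_le h0 (w := fun z => φ n z - m) ((hφ n).sub contDiff_const)
    rw [← mul_assoc] at h2
    have h3 : ∫⁻ θ, ‖m - onCircle g 1 θ‖ₑ ^ 2 ∂angleMeasure ≤
        2 * (∫⁻ θ, ENNReal.ofReal (‖φ n (circleMap 0 1 θ) - m‖ ^ 2) ∂angleMeasure) +
        2 * ∫⁻ θ, ‖onCircle (φ n) 1 θ - onCircle g 1 θ‖ₑ ^ 2 ∂angleMeasure := by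
      rw [← lintegral_const_mul' _ _ (by finiteness), ← lintegral_const_mul' _ _ (by finiteness),
        ← lintegral_add_left]
      · refine lintegral_mono fun θ => ?_
        have := enorm_sub_sq_le m (onCircle (φ n) 1 θ) (onCircle g 1 θ)
        rwa [← enorm_neg (m - onCircle (φ n) 1 θ), neg_sub,
          enorm_sq_eq_ofReal (onCircle (φ n) 1 θ - m)] at this
      · exact ((ENNReal.continuous_ofReal.comp ((hc.sub continuous_const).norm.pow 2)).measurable
          ).const_mul 2
    calc _ ≤ K * (2 * (∫⁻ θ, ENNReal.ofReal (‖φ n (circleMap 0 1 θ) - m‖ ^ 2) ∂angleMeasure) +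
        2 * ∫⁻ θ, ‖onCircle (φ n) 1 θ - onCircle g 1 θ‖ₑ ^ 2 ∂angleMeasure) := by gcongr
      _ = 2 * (K * ∫⁻ θ, ENNReal.ofReal (‖φ n (circleMap 0 1 θ) - m‖ ^ 2) ∂angleMeasure) +
        2 * (K * ∫⁻ θ, ‖onCircle (φ n) 1 θ - onCircle g 1 θ‖ₑ ^ 2 ∂angleMeasure) := by ring
      _ ≤ _ := by
        have h4 := h2.trans (mul_le_mul_right (hT n) 2)
        gcongr
  have hlim : Tendsto (fun n => 2 * (2 * (2 * h1DistSq u (φ n))) +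
        2 * (K * ∫⁻ θ, ‖onCircle (φ n) 1 θ - onCircle g 1 θ‖ₑ ^ 2 ∂angleMeasure))
        atTop (𝓝 0) := by
    have t1 := ENNReal.Tendsto.const_mul (a := 8) hd (Or.inr (by finiteness))
    have t2 := ENNReal.Tendsto.const_mul (a := 2 * K) hb1 (Or.inr (by finiteness))
    have t3 := t1.add t2
    simp only [mul_zero, add_zero] at t3
    refine t3.congr fun n => ?_
    ring
  have hz := ge_of_tendsto' hlim hpt
  rw [nonpos_iff_eq_zero, mul_eq_zero] at hz
  have hz := hz.resolve_left hK0
  rw [lintegral_eq_zero_iff' (by fun_prop)] at hz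
  filter_upwards [hz] with θ hθ
  rw [Pi.zero_apply, sq_eq_zero_iff, enorm_eq_zero, sub_eq_zero] at hθ
  exact hθ.symm

/-! ### The minimal surface -/

/-- The inclusion of the horizontal plane in three-space. -/
def horizontal : ℂ →L[ℝ] Fin 3 → ℝ :=
  ContinuousLinearMap.pi ![Complex.reCLM, Complex.imCLM, 0]

/-- The inclusion of the vertical axis in three-space. -/
def vertical : ℝ →L[ℝ] Fin 3 → ℝ :=
  ContinuousLinearMap.pi ![0, 0, ContinuousLinearMap.id ℝ ℝ]

/-- The height function of the lift. -/
def height (c : ℝ) (z : ℂ) : ℝ := √|c| * Real.log (z.re ^ 2 + z.im ^ 2)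

lemma lift_eq (U : ℂ → ℂ) (c : ℝ) :
    lift U c = fun z => horizontal (U z) + vertical (height c z) := by
  funext z i
  fin_cases i <;> simp [lift, horizontal, vertical, height]

lemma re_sq_add_im_sq (z : ℂ) : z.re ^ 2 + z.im ^ 2 = ‖z‖ ^ 2 := by
  rw [Complex.sq_norm, Complex.normSq_apply]; ring

lemma height_eq (c : ℝ) : height c = (2 * √|c|) • fun z : ℂ => Real.log ‖z‖ := by
  funext z
  rw [height, re_sq_add_im_sq, Real.log_pow, Pi.smul_apply, smul_eq_mul]
  push_cast
  ring

lemma harmonicAt_height (c : ℝ) {z : ℂ} (hz : z ≠ 0) : HarmonicAt (height c) z := by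
  rw [height_eq]
  exact HarmonicAt.const_smul (AnalyticAt.harmonicAt_log_norm (f := fun w : ℂ => w) (by fun_prop) hz)

lemma hasFDerivAt_height (c : ℝ) {z : ℂ} (hz : z ≠ 0) :
    ∃ L : ℂ →L[ℝ] ℝ, HasFDerivAt (height c) L z ∧
      L 1 = 2 * √|c| * z.re / ‖z‖ ^ 2 ∧ L Complex.I = 2 * √|c| * z.im / ‖z‖ ^ 2 := by
  have hne : z.re ^ 2 + z.im ^ 2 ≠ 0 := by
    rw [re_sq_add_im_sq]; simpa using hz
  have h := ((((Complex.reCLM.hasFDerivAt (x := z)).pow 2).add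
    ((Complex.imCLM.hasFDerivAt (x := z)).pow 2)).log hne).const_mul (√|c|)
  refine ⟨_, h, ?_, ?_⟩
  · rw [← re_sq_add_im_sq]; simp; ring
  · rw [← re_sq_add_im_sq]; simp; ring

lemma harmonicAt_lift {ϱ : ℝ} (h0 : 0 < ϱ) {U : ℂ → ℂ} (hU : HarmonicOnNhd U (annulus ϱ)) (c : ℝ)
    {z : ℂ} (hz : z ∈ annulus ϱ) : HarmonicAt (lift U c) z := by
  rw [lift_eq]
  exact HarmonicAt.add (HarmonicAt.comp_CLM (hU z hz) horizontal)
    (HarmonicAt.comp_CLM (harmonicAt_height c (annulus_ne_zero h0 hz)) vertical)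

lemma contDiffOn_lift {ϱ : ℝ} (h0 : 0 < ϱ) {U : ℂ → ℂ} (hU : HarmonicOnNhd U (annulus ϱ)) (c : ℝ) :
    ContDiffOn ℝ ∞ (lift U c) (annulus ϱ) := by
  rw [lift_eq]
  have h1 : ContDiffOn ℝ ∞ (height c) (annulus ϱ) := by
    refine contDiffOn_const.mul (ContDiffOn.log ?_ fun z hz => ?_)
    · exact ((Complex.reCLM.contDiff.pow 2).add (Complex.imCLM.contDiff.pow 2)).contDiffOn
    · have := annulus_ne_zero h0 hz
      rw [re_sq_add_im_sq]; simpa using this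
  exact (horizontal.contDiff.comp_contDiffOn (contDiffOn_of_harmonic hU)).add
    (vertical.contDiff.comp_contDiffOn h1)

lemma pd_lift {ϱ : ℝ} (h0 : 0 < ϱ) {U : ℂ → ℂ} (hU : HarmonicOnNhd U (annulus ϱ)) (c : ℝ)
    {z : ℂ} (hz : z ∈ annulus ϱ) :
    pdx (lift U c) z = ![(fderiv ℝ U z 1).re, (fderiv ℝ U z 1).im, 2 * √|c| * z.re / ‖z‖ ^ 2] ∧
    pdy (lift U c) z =
      ![(fderiv ℝ U z Complex.I).re, (fderiv ℝ U z Complex.I).im, 2 * √|c| * z.im / ‖z‖ ^ 2] := by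
  obtain ⟨L, hL, h1, hI⟩ := hasFDerivAt_height c (annulus_ne_zero h0 hz)
  have hUd : HasFDerivAt U (fderiv ℝ U z) z := ((hU z hz).1.differentiableAt two_ne_zero).hasFDerivAt
  have h := (horizontal.hasFDerivAt.comp z hUd).add (vertical.hasFDerivAt.comp z hL)
  have e : fderiv ℝ (lift U c) z = horizontal.comp (fderiv ℝ U z) + vertical.comp L := by
    rw [lift_eq]
    exact h.fderiv
  rw [pdx, pdy, e, ← h1, ← hI]
  constructor <;> (funext i; fin_cases i <;> simp [horizontal, vertical])

/-- The height satisfies $(\partial_zh)^2=-c/z^2$, which cancels the Hopf coefficient of $U$; real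
and imaginary parts are the two conformality relations. Positivity comes from the height alone, as
$c\ne0$. -/
lemma dotProduct_pd_lift {ϱ : ℝ} (h0 : 0 < ϱ) {U : ℂ → ℂ} (hU : HarmonicOnNhd U (annulus ϱ))
    {c : ℝ} (hc : c < 0) (hH : ∀ z ∈ annulus ϱ, hopf U z = (c : ℂ) / z ^ 2) {z : ℂ}
    (hz : z ∈ annulus ϱ) :
    pdx (lift U c) z ⬝ᵥ pdx (lift U c) z = pdy (lift U c) z ⬝ᵥ pdy (lift U c) z ∧
      pdx (lift U c) z ⬝ᵥ pdy (lift U c) z = 0 ∧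
      0 < pdx (lift U c) z ⬝ᵥ pdx (lift U c) z := by
  have hz0 := annulus_ne_zero h0 hz
  have hn0 : 0 < ‖z‖ ^ 2 := by have := norm_pos_iff.2 hz0; positivity
  have hs : (√|c|) ^ 2 = -c := by rw [Real.sq_sqrt (abs_nonneg c), abs_of_neg hc]
  have hn : ‖z‖ ^ 2 = z.re ^ 2 + z.im ^ 2 := (re_sq_add_im_sq z).symm
  have hh := hH z hz
  have ez : (c : ℂ) / z ^ 2 = c * conj z ^ 2 / ((‖z‖ ^ 2 : ℝ) : ℂ) ^ 2 := by
    have h1 : ((‖z‖ ^ 2 : ℝ) : ℂ) = z * conj z := by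
      rw [Complex.mul_conj, Complex.normSq_eq_norm_sq]
    have h2 : conj z ≠ 0 := by simpa using hz0
    rw [h1]
    field_simp
  rw [hopf, ez] at hh
  have hh2 : (((‖fderiv ℝ U z 1‖ ^ 2 - ‖fderiv ℝ U z Complex.I‖ ^ 2 : ℝ) : ℂ)
      - 2 * Complex.I * ((dot (fderiv ℝ U z 1) (fderiv ℝ U z Complex.I) : ℝ) : ℂ)) =
      ((4 * c * (((‖z‖ ^ 2) ^ 2))⁻¹ : ℝ) : ℂ) * (conj z * conj z) := by
    push_cast at hh ⊢
    linear_combination 4 * hh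
  rw [(pd_lift h0 hU c hz).1, (pd_lift h0 hU c hz).2]
  generalize fderiv ℝ U z 1 = a at *
  generalize fderiv ℝ U z Complex.I = b at *
  have hre := congrArg Complex.re hh2
  have him := congrArg Complex.im hh2
  rw [Complex.re_ofReal_mul, Complex.sub_re, Complex.ofReal_re, mul_assoc, mul_comm Complex.I,
    ← mul_assoc, show (2 : ℂ) * ((dot a b : ℝ) : ℂ) = ((2 * dot a b : ℝ) : ℂ) by push_cast; rfl,
    Complex.re_ofReal_mul, Complex.mul_re, Complex.conj_re, Complex.conj_im, Complex.I_re,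
    Complex.sq_norm, Complex.sq_norm, Complex.normSq_apply, Complex.normSq_apply] at hre
  rw [Complex.im_ofReal_mul, Complex.sub_im, Complex.ofReal_im, mul_assoc, mul_comm Complex.I,
    ← mul_assoc, show (2 : ℂ) * ((dot a b : ℝ) : ℂ) = ((2 * dot a b : ℝ) : ℂ) by push_cast; rfl,
    Complex.im_ofReal_mul, Complex.mul_im, Complex.conj_re, Complex.conj_im, Complex.I_im,
    dot] at him
  simp only [Matrix.vec3_dotProduct, Matrix.cons_val]
  have e1 : ∀ x y : ℝ, 2 * √|c| * x / ‖z‖ ^ 2 * (2 * √|c| * y / ‖z‖ ^ 2) =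
      -(4 * c * ((‖z‖ ^ 2) ^ 2)⁻¹) * (x * y) := fun x y => by
    rw [div_mul_div_comm, div_eq_mul_inv]
    linear_combination 4 * (x * y) * (‖z‖ ^ 2 * ‖z‖ ^ 2)⁻¹ * hs
  rw [e1, e1, e1]
  have hk : 0 < -(4 * c * ((‖z‖ ^ 2) ^ 2)⁻¹) := by
    have : 0 < (-c) * ((‖z‖ ^ 2) ^ 2)⁻¹ := mul_pos (by linarith) (by positivity)
    linarith
  set k := 4 * c * ((‖z‖ ^ 2) ^ 2)⁻¹ with hkdef
  have g1 : a.re * a.re + a.im * a.im + -k * (z.re * z.re) =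
      b.re * b.re + b.im * b.im + -k * (z.im * z.im) := by linarith
  refine ⟨g1, by linarith, ?_⟩
  have hpos : 0 < -k * (z.re * z.re + z.im * z.im) := mul_pos hk (by nlinarith)
  nlinarith [mul_self_nonneg a.re, mul_self_nonneg a.im, mul_self_nonneg b.re,
    mul_self_nonneg b.im]

lemma pdx_pdx_add_pdy_pdy_eq_zero {X : ℂ → Fin 3 → ℝ} {z : ℂ} (hX : HarmonicAt X z) :
    pdx (pdx X) z + pdy (pdy X) z = 0 := by
  have h := laplacian_apply_complex hX.1
  rw [hX.2.self_of_nhds] at h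
  exact h.symm

/-- A conformal harmonic map with nonvanishing derivative parametrizes a minimal surface. -/
lemma isConformalMinimalImmersion_lift {ϱ : ℝ} (h0 : 0 < ϱ) {U : ℂ → ℂ}
    (hU : HarmonicOnNhd U (annulus ϱ)) {c : ℝ} (hc : c < 0)
    (hH : ∀ z ∈ annulus ϱ, hopf U z = (c : ℂ) / z ^ 2) :
    IsConformalMinimalImmersion (lift U c) (annulus ϱ) := by
  refine ⟨⟨contDiffOn_lift h0 hU c, fun z hz hN => ?_⟩, fun z hz => ?_, fun z hz => ?_⟩
  · obtain ⟨h1, h2, h3⟩ := dotProduct_pd_lift h0 hU hc hH hz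
    -- Lagrange's identity: the squared length of the normal is $EG-F^2=E^2>0$.
    have h := cross_dot_cross (pdx (lift U c) z) (pdy (lift U c) z) (pdx (lift U c) z)
      (pdy (lift U c) z)
    rw [normal] at hN
    rw [hN, zero_dotProduct, h2, ← h1, zero_mul, sub_zero] at h
    exact (mul_pos h3 h3).ne h
  · obtain ⟨h1, h2, -⟩ := dotProduct_pd_lift h0 hU hc hH hz
    exact ⟨h1, h2⟩
  · obtain ⟨h1, h2, -⟩ := dotProduct_pd_lift h0 hU hc hH hz
    -- With $E=G$ and $F=0$ the numerator of the mean curvature is $E$ times the normal component of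
    -- the Laplacian of $X$.
    have h := pdx_pdx_add_pdy_pdy_eq_zero (harmonicAt_lift h0 hU c hz)
    simp only [meanCurvature]
    rw [h2, ← h1, mul_zero, sub_zero, ← add_mul, ← add_dotProduct, h, zero_dotProduct, zero_mul,
      zero_div]

lemma lift_inversion {ϱ : ℝ} (h0 : 0 < ϱ) {U : ℂ → ℂ} {c : ℝ} {z : ℂ} (hz : z ∈ annulus ϱ)
    (hinv : U (inversion ϱ z) = U z) :
    lift U c (inversion ϱ z) = reflectPlane (√|c| * Real.log ϱ) (lift U c z) := by
  have hz0 : 0 < ‖z‖ := h0.trans hz.1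
  have e : Real.log ((inversion ϱ z).re ^ 2 + (inversion ϱ z).im ^ 2) =
      2 * Real.log ϱ - Real.log (z.re ^ 2 + z.im ^ 2) := by
    rw [re_sq_add_im_sq, re_sq_add_im_sq, norm_inversion h0, Real.log_pow, Real.log_pow,
      Real.log_div h0.ne' hz0.ne']
    push_cast
    ring
  funext i
  fin_cases i
  · simp [lift, reflectPlane, hinv]
  · simp [lift, reflectPlane, hinv]
  · simp only [lift, reflectPlane, e]
    simp
    ring

/-- The constant is read off at one point of the middle circle, where it is minus a square. If it
were zero, $U$ and its outer trace would be constant, against the nonzero degree on the unit circle.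
-/
lemma IsMinimizer.exists_neg_hopf_eq {ϱ : ℝ} (h0 : 0 < ϱ) (h1 : ϱ < 1) {p q : ℤ} (hp : p ≠ 0)
    {u : H1Annulus ϱ} (hu : IsMinimizer u p q) {U : ℂ → ℂ} (hU : HarmonicOnNhd U (annulus ϱ))
    (hu0 : u.toFun = U) (hux : u.dx = fun z => fderiv ℝ U z 1)
    (huy : u.dy = fun z => fderiv ℝ U z Complex.I)
    (hr : ∀ z : ℂ, ‖z‖ = √ϱ → radialDeriv U z = 0) :
    ∃ c : ℝ, c < 0 ∧ ∀ z ∈ annulus ϱ, hopf U z = (c : ℂ) / z ^ 2 := by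
  have hR := sqrt_mem_Ioo h0 h1
  have hR0 : 0 < √ϱ := h0.trans hR.1
  obtain ⟨c, hc⟩ := hu.exists_hopf_eq h0 h1 hU hu0 hux huy
  set z₀ := circleMap 0 (√ϱ) 0 with hz₀
  have hzA : z₀ ∈ annulus ϱ := (circleMap_mem_annulus hR0 0).2 hR
  have hc₀ := sq_mul_hopf_of_radialDeriv_eq_zero (annulus_ne_zero h0 hzA)
    (hr z₀ (by simp [hz₀, abs_of_pos hR0]))
  rw [hc z₀ hzA] at hc₀
  have hform : ∀ z ∈ annulus ϱ, hopf U z = c / z ^ 2 := fun z hz => by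
    rw [eq_div_iff (pow_ne_zero 2 (annulus_ne_zero h0 hz)), mul_comm]
    exact hc z hz
  refine ⟨_, lt_of_le_of_ne (neg_nonpos.2 (sq_nonneg _)) fun h => ?_, fun z hz => by
    rw [← hc₀]; exact hform z hz⟩
  rw [h, Complex.ofReal_zero] at hc₀
  obtain ⟨m, hm⟩ := exists_eq_const_of_hopf_eq_zero h0 h1 hU hr fun z hz => by
    rw [hform z hz, hc₀, zero_div]
  have hfd : ∀ z ∈ annulus ϱ, fderiv ℝ U z = 0 := fun z hz => by
    have hev : U =ᶠ[𝓝 z] fun _ => m := by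
      filter_upwards [(isOpen_annulus ϱ).mem_nhds hz] with w hw
      exact hm w hw
    rw [hev.fderiv_eq, fderiv_fun_const]
    rfl
  obtain ⟨g, hg, -, hdp, -⟩ := hu.1
  refine not_hasDegree_of_ae_eq_const (ae_eq_const_of_isTrace h0 h1 (m := m) ?_ ?_ ?_ hg) hp hdp
  · rw [hu0]; exact hm
  · rw [hux]; exact fun z hz => by simp [hfd z hz]
  · rw [huy]; exact fun z hz => by simp [hfd z hz]

end SemiStiff

end

theorem mainTheorem11 (ϱ : ℝ) (hϱ0 : 0 < ϱ) (hϱ1 : ϱ < 1) (p : ℤ) (hp : p ≠ 0)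
    (u : SemiStiff.H1Annulus ϱ) (hu : SemiStiff.IsMinimizer u p p) :
    ∃ (U : ℂ → ℂ) (c : ℝ),
      -- `U` is the harmonic representative of `u`
      InnerProductSpace.HarmonicOnNhd U (SemiStiff.annulus ϱ) ∧
      u.toFun =ᵐ[volume.restrict (SemiStiff.annulus ϱ)] U ∧
      -- the radial derivative vanishes on the middle circle
      (∀ z : ℂ, ‖z‖ = √ϱ → SemiStiff.radialDeriv U z = 0) ∧
      -- the Hopf differential is `c / z²` with `c < 0`
      (∀ z ∈ SemiStiff.annulus ϱ, SemiStiff.hopf U z = (c : ℂ) / z ^ 2) ∧ c < 0 ∧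
      -- the lift is a conformally parametrized minimal surface
      SemiStiff.IsConformalMinimalImmersion (SemiStiff.lift U c) (SemiStiff.annulus ϱ) ∧
      -- the reflection in the plane at height `√|c| ln ϱ` maps the surface onto itself, and
      -- this is realised by the involution `z ↦ ϱ / conj z` of the parameter domain
      SemiStiff.reflectPlane (√|c| * Real.log ϱ) ''
          (SemiStiff.lift U c '' SemiStiff.annulus ϱ) =
        SemiStiff.lift U c '' SemiStiff.annulus ϱ ∧
      ∀ z ∈ SemiStiff.annulus ϱ,
        SemiStiff.lift U c ((ϱ : ℂ) / conj z) =
          SemiStiff.reflectPlane (√|c| * Real.log ϱ) (SemiStiff.lift U c z) := by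
  obtain ⟨U, hU, hae⟩ := hu.exists_harmonic hϱ0
  -- The minimizer is replaced by one whose function and weak derivatives are literally $U$ and its
  -- classical derivatives.
  obtain ⟨v, hv0, hvx, hvy, hvE, hvI⟩ := SemiStiff.exists_classical_representative u
    ((SemiStiff.contDiffOn_of_harmonic hU).of_le (by norm_cast)) hae
  have hv : SemiStiff.IsMinimizer v p p := ⟨hvI p p hu.1, fun w hw => hvE ▸ hu.2 w hw⟩
  have hinv : ∀ z ∈ SemiStiff.annulus ϱ, U (SemiStiff.inversion ϱ z) = U z := fun z hz =>
    hv.inversion_invariant hϱ0 hϱ1 hU hv0 hvx hvy hz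
  have hrad : ∀ z : ℂ, ‖z‖ = √ϱ → SemiStiff.radialDeriv U z = 0 := fun z hz =>
    SemiStiff.radialDeriv_eq_zero_of_inversion_invariant hϱ0 hϱ1
      ((SemiStiff.contDiffOn_of_harmonic hU).differentiableOn (by simp)) hinv hz
  obtain ⟨c, hc, hH⟩ : ∃ c : ℝ, c < 0 ∧
      ∀ z ∈ SemiStiff.annulus ϱ, SemiStiff.hopf U z = (c : ℂ) / z ^ 2 :=
    hv.exists_neg_hopf_eq hϱ0 hϱ1 hp hU hv0 hvx hvy hrad
  have hsymm : ∀ z ∈ SemiStiff.annulus ϱ, SemiStiff.lift U c (SemiStiff.inversion ϱ z) =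
      SemiStiff.reflectPlane (√|c| * Real.log ϱ) (SemiStiff.lift U c z) := fun z hz =>
    SemiStiff.lift_inversion hϱ0 hz (hinv z hz)
  refine ⟨U, c, hU, hae, hrad, hH, hc,
    SemiStiff.isConformalMinimalImmersion_lift hϱ0 hU hc hH, ?_, hsymm⟩
  ext P
  constructor
  · rintro ⟨_, ⟨z, hz, rfl⟩, rfl⟩
    exact ⟨_, SemiStiff.inversion_mem_annulus hϱ0 hz, hsymm z hz⟩
  -- The point over $z$ is the reflection of the point over $\varrho/\bar z$, as the inversion is an
  -- involution.
  · rintro ⟨z, hz, rfl⟩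
    have hz' := SemiStiff.inversion_mem_annulus hϱ0 hz
    refine ⟨_, ⟨_, hz', rfl⟩, ?_⟩
    rw [← hsymm _ hz', SemiStiff.inversion_inversion hϱ0 (SemiStiff.annulus_ne_zero hϱ0 hz)]
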